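/- Let $p\ge 3$ be a prime, let $F$ be a finite extension of $\mathbb{Q}_p$ with ramification index $e$ and residue field $\overline F$, and let $p^w$ be the largest power of $p$ dividing $e$. Let $D$ be a finite-dimensional central division algebra over $F$ of degree $d$ (so $\dim_F D=d^2$), with ring of integers $O_D$ and a uniformizer $\pi$ (a generator of the maximal ideal of $O_D$), and assume $(p,d,|\overline F|)\neq(3,2,3)$. Let $G=SL_1(D)$ be the group of elements of $D$ of reduced norm $1$, put $n=de+1$, and let $\mathfrak g_n=\mathfrak{sl}_1(\pi^nO_D)$ be the $\mathbb{Z}_p$-Lie algebra of elements of $\pi^nO_D$ of reduced trace $0$, with bracket $[x,y]=xy-yx$, on which $G$ acts by conjugation. Let $s\ge 0$, regard $\mathbb{Z}/p^s\mathbb{Z}$ as an abelian $\mathbb{Z}_p$-Lie algebra with trivial action of $G$ and of $\mathfrak g_n$, and let $H^2(\mathfrak g_n,\mathbb{Z}/p^s)$ be the group of alternating $\mathbb{Z}_p$-bilinear maps $f:\mathfrak g_n\times\mathfrak g_n\to\mathbb{Z}/p^s$ with $f([x,y],z)+f([y,z],x)+f([z,x],y)=0$ for all $x,y,z$, modulo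 those of the form $f(x,y)=u([x,y])$ with $u:\mathfrak g_n\to\mathbb{Z}/p^s$ a $\mathbb{Z}_p$-linear map. Call a class $c$ $G$-equivariant if the corresponding central extension of $\mathbb{Z}_p$-Lie algebras $0\to\mathbb{Z}/p^s\to\widehat{\mathfrak g}\to\mathfrak g_n\to 0$ is $G$-equivariant, that is, if $G$ acts on $\widehat{\mathfrak g}$ by $\mathbb{Z}_p$-Lie algebra automorphisms compatibly with its actions on $\mathbb{Z}/p^s$ and $\mathfrak g_n$. Then the group $H^2(\mathfrak g_n,\mathbb{Z}/p^s)^G$ of $G$-equivariant classes has exponent at most $p^{w+4}$. -/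

import Mathlib

open scoped TensorProduct

attribute [local instance 100] LieRing.ofAssociativeRing

namespace NormOne

universe u

section Absolute

variable (p : ℕ) [Fact p.Prime] {D : Type u} [DivisionRing D] [Algebra ℚ_[p] D]

/-- The absolute value of `D` extending the `p`-adic one (auxiliary: it is used to prove that the
integral elements form a ring). -/
noncomputable def absD (x : D) : ℝ := spectralValue (minpoly ℚ_[p] x)

theorem norm_pow_field {L : Type*} [Field L] [Algebra ℚ_[p] L] [FiniteDimensional ℚ_[p] L]
    (α : L) :
    ‖Algebra.norm ℚ_[p] α‖ = spectralNorm ℚ_[p] L α ^ Module.finrank ℚ_[p] L := by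
  let E := AlgebraicClosure ℚ_[p]
  have h := Algebra.norm_eq_prod_embeddings ℚ_[p] E α
  have h2 : spectralMulAlgNorm ℚ_[p] E (algebraMap ℚ_[p] E (Algebra.norm ℚ_[p] α)) =
      ∏ σ : L →ₐ[ℚ_[p]] E, spectralMulAlgNorm ℚ_[p] E (σ α) := by
    rw [h, map_prod]
  rw [spectralMulAlgNorm_def, spectralNorm_extends] at h2
  have h3 : ∀ σ : L →ₐ[ℚ_[p]] E, spectralMulAlgNorm ℚ_[p] E (σ α) = spectralNorm ℚ_[p] L α := by
    intro σ
    rw [spectralMulAlgNorm_def, spectralNorm, spectralNorm,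
      minpoly.algHom_eq σ σ.toRingHom.injective]
  rw [h2, Finset.prod_congr rfl fun σ _ => h3 σ, Finset.prod_const, Finset.card_univ,
    AlgHom.card]

/-- Every element of `D` lies in a commutative subfield. -/
theorem exists_subfield [FiniteDimensional ℚ_[p] D] (x : D) : ∃ (L : Type u) (_ : Field L) (_ : Algebra ℚ_[p] L)
    (_ : FiniteDimensional ℚ_[p] L) (i : L →ₐ[ℚ_[p]] D) (α : L), i α = x := by
  let A := Algebra.adjoin ℚ_[p] ({x} : Set D)
  open scoped IsMulCommutative in
  let hA : CommRing A := inferInstance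
  let hF : Field A := fieldOfFiniteDimensional ℚ_[p] A
  exact ⟨A, hF, inferInstance, inferInstance, A.val,
    ⟨x, Algebra.self_mem_adjoin_singleton _ _⟩, rfl⟩

theorem absD_map {L : Type*} [Field L] [Algebra ℚ_[p] L] (i : L →ₐ[ℚ_[p]] D) (α : L) :
    absD p (i α) = spectralNorm ℚ_[p] L α := by
  rw [absD, spectralNorm, minpoly.algHom_eq i i.toRingHom.injective]

theorem absD_nonneg (x : D) : 0 ≤ absD p x := spectralValue_nonneg _

variable [FiniteDimensional ℚ_[p] D]

theorem norm_eq_absD_pow (x : D) :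
    ‖Algebra.norm ℚ_[p] x‖ = absD p x ^ Module.finrank ℚ_[p] D := by
  obtain ⟨L, _, _, _, i, α, rfl⟩ := exists_subfield p x
  let : Module L D := Module.compHom D i.toRingHom
  have hs : ∀ (l : L) (y : D), l • y = i l * y := fun _ _ => rfl
  have : IsScalarTower ℚ_[p] L D := ⟨fun a l y => by
    rw [hs, hs, map_smul, smul_mul_assoc]⟩
  have : Module.Finite L D := Module.Finite.of_restrictScalars_finite ℚ_[p] L D
  have h1 : Algebra.norm ℚ_[p] (i α) =
      LinearMap.det ((α • (LinearMap.id : D →ₗ[L] D)).restrictScalars ℚ_[p]) := by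
    rw [Algebra.norm_apply]
    congr 1
  rw [h1, LinearMap.det_restrictScalars, LinearMap.det_smul, LinearMap.det_id, mul_one, map_pow,
    norm_pow, norm_pow_field, absD_map, ← pow_mul, Module.finrank_mul_finrank]

theorem absD_mul (x y : D) : absD p (x * y) = absD p x * absD p y := by
  have h : Module.finrank ℚ_[p] D ≠ 0 := Module.finrank_pos.ne'
  rw [← pow_left_inj₀ (absD_nonneg p _) (mul_nonneg (absD_nonneg p _) (absD_nonneg p _)) h,
    mul_pow, ← norm_eq_absD_pow, ← norm_eq_absD_pow, ← norm_eq_absD_pow, map_mul, norm_mul]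

theorem absD_algebraMap (a : ℚ_[p]) : absD p (algebraMap ℚ_[p] D a) = ‖a‖ := by
  have := absD_map p (Algebra.ofId ℚ_[p] D) a
  rw [show algebraMap ℚ_[p] D a = Algebra.ofId ℚ_[p] D a from rfl, this]
  exact spectralNorm_extends a

theorem absD_one : absD p (1 : D) = 1 := by
  simpa using absD_algebraMap p (D := D) 1

theorem absD_zero : absD p (0 : D) = 0 := by
  simpa using absD_algebraMap p (D := D) 0

theorem absD_inv (x : D) : absD p x⁻¹ = (absD p x)⁻¹ := by
  by_cases hx : x = 0
  · simp [hx, absD_zero]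
  · refine eq_inv_of_mul_eq_one_left ?_
    rw [← absD_mul, inv_mul_cancel₀ hx, absD_one]

theorem absD_eq_zero_iff (x : D) : absD p x = 0 ↔ x = 0 := by
  refine ⟨fun h => ?_, fun h => by rw [h, absD_zero]⟩
  by_contra hx
  have := absD_mul p x x⁻¹
  rw [mul_inv_cancel₀ hx, absD_one, h, zero_mul] at this
  exact one_ne_zero this

theorem absD_one_add_le (x : D) (hx : absD p x ≤ 1) : absD p (1 + x) ≤ 1 := by
  obtain ⟨L, _, _, _, i, α, rfl⟩ := exists_subfield p x
  rw [absD_map] at hx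
  rw [← map_one i, ← map_add, absD_map]
  refine (isNonarchimedean_spectralNorm (K := ℚ_[p]) (L := L) 1 α).trans ?_
  exact max_le spectralNorm_one.le hx

theorem absD_add_le (x y : D) : absD p (x + y) ≤ max (absD p x) (absD p y) := by
  wlog h : absD p y ≤ absD p x generalizing x y
  · rw [add_comm, max_comm]; exact this y x (le_of_not_ge h)
  by_cases hx : x = 0
  · have : y = 0 := by
      rw [← absD_eq_zero_iff p]
      exact le_antisymm (h.trans (by rw [hx, absD_zero])) (absD_nonneg p y)
    simp [hx, this]
  have h1 : x + y = x * (1 + x⁻¹ * y) := by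
    rw [mul_add, mul_one, mul_inv_cancel_left₀ hx]
  have h2 : absD p (x⁻¹ * y) ≤ 1 := by
    rw [absD_mul, absD_inv]
    exact inv_mul_le_one_of_le₀ h (absD_nonneg p x)
  rw [h1, absD_mul]
  exact (mul_le_of_le_one_right (absD_nonneg p x) (absD_one_add_le p _ h2)).trans (le_max_left _ _)

variable [Algebra ℤ_[p] D] [IsScalarTower ℤ_[p] ℚ_[p] D]

theorem isIntegral_iff (x : D) : IsIntegral ℤ_[p] x ↔ absD p x ≤ 1 := by
  obtain ⟨L, _, _, _, i, α, rfl⟩ := exists_subfield p x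
  let : Algebra ℤ_[p] L := ((algebraMap ℚ_[p] L).comp (algebraMap ℤ_[p] ℚ_[p])).toAlgebra
  have : IsScalarTower ℤ_[p] ℚ_[p] L := IsScalarTower.of_algebraMap_eq fun _ => rfl
  have hi : IsIntegral ℤ_[p] (i α) ↔ IsIntegral ℤ_[p] α :=
    isIntegral_algHom_iff (i.restrictScalars ℤ_[p]) i.toRingHom.injective
  have hα : IsIntegral ℚ_[p] α := Algebra.IsIntegral.isIntegral α
  rw [hi, absD_map, spectralNorm, spectralValue_le_one_iff (minpoly.monic hα)]
  constructor
  · intro h n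
    rw [minpoly.isIntegrallyClosed_eq_field_fractions' ℚ_[p] h, Polynomial.coeff_map]
    exact PadicInt.norm_le_one _
  · intro h
    have : minpoly ℚ_[p] α ∈ Polynomial.lifts (algebraMap ℤ_[p] ℚ_[p]) := by
      rw [Polynomial.lifts_iff_coeff_lifts]
      intro n
      exact ⟨⟨_, h n⟩, rfl⟩
    obtain ⟨q, hq, -, hqm⟩ := Polynomial.lifts_and_degree_eq_and_monic this (minpoly.monic hα)
    refine ⟨q, hqm, ?_⟩
    rw [← Polynomial.aeval_def, ← Polynomial.aeval_map_algebraMap ℚ_[p], hq, minpoly.aeval]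

end Absolute
section Integers

variable (p : ℕ) [Fact p.Prime] (D : Type*) [DivisionRing D] [Algebra ℚ_[p] D]
  [FiniteDimensional ℚ_[p] D] [Algebra ℤ_[p] D] [IsScalarTower ℤ_[p] ℚ_[p] D]

/-- The ring of integers `O_D` of a finite-dimensional division algebra `D` over `ℚ_p`
(in particular, of a finite extension of `ℚ_p`): the elements integral over `ℤ_p`. -/
noncomputable def integers : Subalgebra ℤ_[p] D where
  carrier := {x | IsIntegral ℤ_[p] x}
  mul_mem' := by
    intro x y hx hy
    rw [Set.mem_ofPred_eq, isIntegral_iff] at hx hy ⊢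
    rw [absD_mul]
    exact mul_le_one₀ hx (absD_nonneg p y) hy
  add_mem' := by
    intro x y hx hy
    rw [Set.mem_ofPred_eq, isIntegral_iff] at hx hy ⊢
    exact (absD_add_le p x y).trans (max_le hx hy)
  algebraMap_mem' := fun r => isIntegral_algebraMap

variable {D}

theorem mem_integers_iff (x : D) : x ∈ integers p D ↔ absD p x ≤ 1 := isIntegral_iff p x

theorem isUnit_integers_iff (x : integers p D) : IsUnit x ↔ absD p (x : D) = 1 := by
  constructor
  · rintro ⟨u, rfl⟩
    have h1 := (mem_integers_iff p _).1 (u : integers p D).2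
    have h2 := (mem_integers_iff p _).1 ((u⁻¹ : (integers p D)ˣ) : integers p D).2
    have h3 : absD p ((u : integers p D) : D) *
        absD p (((u⁻¹ : (integers p D)ˣ) : integers p D) : D) = 1 := by
      rw [← absD_mul, ← MulMemClass.coe_mul, Units.mul_inv]
      exact absD_one p
    refine le_antisymm h1 ?_
    rw [← h3]
    exact mul_le_of_le_one_right (absD_nonneg p _) h2
  · intro h
    have hx : (x : D) ≠ 0 := by
      intro h0
      rw [h0, absD_zero] at h
      exact zero_ne_one h
    have hi : (x : D)⁻¹ ∈ integers p D := by
      rw [mem_integers_iff, absD_inv, h, inv_one]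
    exact ⟨⟨x, ⟨_, hi⟩, Subtype.ext (mul_inv_cancel₀ hx), Subtype.ext (inv_mul_cancel₀ hx)⟩, rfl⟩

/-- The ring of integers is local. -/
instance : IsLocalRing (integers p D) := by
  refine IsLocalRing.of_nonunits_add fun a b ha hb => ?_
  have hlt : ∀ c : integers p D, c ∈ nonunits (integers p D) ↔ absD p (c : D) < 1 := by
    intro c
    rw [mem_nonunits_iff, isUnit_integers_iff, lt_iff_le_and_ne]
    exact ⟨fun h => ⟨(mem_integers_iff p _).1 c.2, h⟩, fun h => h.2⟩
  rw [hlt] at ha hb ⊢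
  exact (absD_add_le p (a : D) b).trans_lt (max_lt ha hb)

/-- A uniformizer of a ring with unique maximal ideal `𝔪` (the set of non-units):
an element `π` with `𝔪 = πR`. -/
def IsUniformizer {R : Type*} [Ring R] (π : R) : Prop := ∀ x : R, ¬ IsUnit x ↔ π ∣ x

/-- Conjugation by a unit of `D` preserves each `π ^ n O_D`. -/
theorem conj_mem (π : integers p D) (n : ℕ) (g : Dˣ) (x : D)
    (h : ∃ y ∈ integers p D, x = (π : D) ^ n * y) :
    ∃ y ∈ integers p D, (g : D) * x * ((g⁻¹ : Dˣ) : D) = (π : D) ^ n * y := by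
  obtain ⟨y, hy, rfl⟩ := h
  by_cases h0 : (π : D) ^ n = 0
  · exact ⟨y, hy, by simp [h0]⟩
  refine ⟨((π : D) ^ n)⁻¹ * ((g : D) * ((π : D) ^ n * y) * ((g⁻¹ : Dˣ) : D)), ?_,
    (mul_inv_cancel_left₀ h0 _).symm⟩
  rw [mem_integers_iff] at hy ⊢
  have hg : absD p (g : D) ≠ 0 := by
    rw [ne_eq, absD_eq_zero_iff]
    exact g.ne_zero
  have hπ : absD p ((π : D) ^ n) ≠ 0 := by
    rwa [ne_eq, absD_eq_zero_iff]
  rw [Units.val_inv_eq_inv_val, absD_mul, absD_mul, absD_mul, absD_mul, absD_inv, absD_inv]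
  convert hy using 1
  field_simp

end Integers

section Cohomology

variable (R L M : Type*) [CommRing R] [LieRing L] [LieAlgebra R L] [AddCommGroup M] [Module R M]

/-- The `2`-cocycles of the Lie algebra `L` with values in the trivial `L`-module `M`: alternating
`R`-bilinear maps `f` with `f([x,y],z) + f([y,z],x) + f([z,x],y) = 0`. -/
def Z2 : AddSubgroup (L →ₗ[R] L →ₗ[R] M) where
  carrier := {f | (∀ x, f x x = 0) ∧ ∀ x y z, f ⁅x, y⁆ z + f ⁅y, z⁆ x + f ⁅z, x⁆ y = 0}
  zero_mem' := by simp
  add_mem' := by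
    rintro f g ⟨hf, hf'⟩ ⟨hg, hg'⟩
    refine ⟨fun x => by simp [hf, hg], fun x y z => ?_⟩
    have := congrArg₂ (· + ·) (hf' x y z) (hg' x y z)
    simp only [add_zero] at this
    rw [← this]
    simp only [LinearMap.add_apply]
    abel
  neg_mem' := by
    rintro f ⟨hf, hf'⟩
    refine ⟨fun x => by simp [hf], fun x y z => ?_⟩
    simp only [LinearMap.neg_apply, ← neg_add, hf', neg_zero]

/-- The `2`-coboundaries: bilinear maps of the form `(x, y) ↦ u([x,y])` with `u` linear. -/
def B2 : AddSubgroup (L →ₗ[R] L →ₗ[R] M) where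
  carrier := {f | ∃ u : L →ₗ[R] M, ∀ x y, f x y = u ⁅x, y⁆}
  zero_mem' := ⟨0, by simp⟩
  add_mem' := by
    rintro f g ⟨u, hu⟩ ⟨v, hv⟩
    exact ⟨u + v, fun x y => by simp [hu, hv]⟩
  neg_mem' := by
    rintro f ⟨u, hu⟩
    exact ⟨-u, fun x y => by simp [hu]⟩

/-- The second cohomology `H²(L, M) = Z² / B²` of a Lie algebra `L` that is free as an `R`-module
(as `sl₁(π ^ n O_D)` over `ℤ_p` is), with values in the trivial module `M`. -/
abbrev H2 : Type _ := Z2 R L M ⧸ (B2 R L M).addSubgroupOf (Z2 R L M)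

/-- A central extension `0 → M → E → L → 0` of `R`-Lie algebras. -/
structure CentralExtension where
  E : Type*
  [lieRing : LieRing E]
  [lieAlgebra : LieAlgebra R E]
  incl : M →ₗ[R] E
  proj : E →ₗ⁅R⁆ L
  injective : Function.Injective incl
  surjective : Function.Surjective proj
  exact : Function.Exact incl proj
  central : ∀ a (x : E), ⁅incl a, x⁆ = 0

attribute [instance] CentralExtension.lieRing CentralExtension.lieAlgebra

variable {R L M}

/-- A central extension is equivariant for given actions of `G` on `L` and on `M`
if `G` acts on the middle term by Lie algebra automorphisms, compatibly with both actions. -/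
def CentralExtension.IsEquivariant {G : Type*} [Group G] (ρL : Representation R G L)
    (ρM : Representation R G M) (X : CentralExtension R L M) : Prop :=
  ∃ ρ : Representation R G X.E,
    (∀ g x y, ρ g ⁅x, y⁆ = ⁅ρ g x, ρ g y⁆) ∧
    (∀ g a, ρ g (X.incl a) = X.incl (ρM g a)) ∧
    (∀ g x, X.proj (ρ g x) = ρL g (X.proj x))

/-- The module `L ⊕ M`, the underlying module of the central extension attached to `z`. -/
def ExtAlg (_z : Z2 R L M) : Type _ := L × M

namespace ExtAlg

variable (z : Z2 R L M)

instance : AddCommGroup (ExtAlg z) := inferInstanceAs (AddCommGroup (L × M))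
instance : Module R (ExtAlg z) := inferInstanceAs (Module R (L × M))

/-- The bracket `[(h₁, a₁), (h₂, a₂)] = ([h₁, h₂], z(h₁, h₂))`. -/
instance : LieRing (ExtAlg z) where
  bracket x y := (⁅x.1, y.1⁆, z.1 x.1 y.1)
  add_lie x y w := Prod.ext (add_lie x.1 y.1 w.1)
    (by change z.1 (x.1 + y.1) w.1 = z.1 x.1 w.1 + z.1 y.1 w.1; simp)
  lie_add x y w := Prod.ext (lie_add x.1 y.1 w.1)
    (by change z.1 x.1 (y.1 + w.1) = z.1 x.1 y.1 + z.1 x.1 w.1; simp)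
  lie_self x := Prod.ext (lie_self x.1) (z.2.1 x.1)
  leibniz_lie x y w := Prod.ext (leibniz_lie x.1 y.1 w.1) (by
    change z.1 x.1 ⁅y.1, w.1⁆ = z.1 ⁅x.1, y.1⁆ w.1 + z.1 y.1 ⁅x.1, w.1⁆
    have hs : ∀ a b, z.1 a b = - z.1 b a := fun a b => by
      have h := z.2.1 (a + b)
      simp only [map_add, LinearMap.add_apply, z.2.1, zero_add, add_zero] at h
      exact eq_neg_of_add_eq_zero_right h
    have h := z.2.2 x.1 y.1 w.1
    rw [hs x.1, hs y.1 ⁅x.1, w.1⁆, ← lie_skew x.1 w.1, map_neg, LinearMap.neg_apply, neg_neg,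
      neg_eq_iff_add_eq_zero, ← h]
    abel)

instance : LieAlgebra R (ExtAlg z) where
  lie_smul r x y := Prod.ext (lie_smul r x.1 y.1)
    (by change z.1 x.1 (r • y.1) = r • z.1 x.1 y.1; simp)

end ExtAlg

/-- The central extension attached to a `2`-cocycle. -/
def extOfCocycle (z : Z2 R L M) : CentralExtension R L M where
  E := ExtAlg z
  incl := LinearMap.inr R L M
  proj :=
    { LinearMap.fst R L M with
      map_lie' := rfl }
  injective := LinearMap.inr_injective
  surjective := Prod.fst_surjective
  exact := by
    rintro ⟨h, a⟩
    constructor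
    · rintro rfl
      exact ⟨a, rfl⟩
    · rintro ⟨b, hb⟩
      exact (congrArg Prod.fst hb).symm
  central := by
    rintro a ⟨h, b⟩
    exact Prod.ext (zero_lie h) (by change z.1 0 h = 0; simp)

theorem isEquivariant_extOfCocycle_iff
    {G : Type*} [Group G] (ρL : Representation R G L)
    (ρM : Representation R G M) (hL : ∀ g x y, ρL g ⁅x, y⁆ = ⁅ρL g x, ρL g y⁆) (z : Z2 R L M) :
    (extOfCocycle z).IsEquivariant ρL ρM ↔
      ∃ l : G → L →ₗ[R] M,
        (∀ x, l 1 x = 0) ∧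
        (∀ g h x, l (g * h) x = l g (ρL h x) + ρM g (l h x)) ∧
        (∀ g x y, l g ⁅x, y⁆ = z.1 (ρL g x) (ρL g y) - ρM g (z.1 x y)) := by
  constructor
  · rintro ⟨ρ, h1, h2, h3⟩
    let ρ' : G → (L × M) →ₗ[R] (L × M) := fun g => ρ g
    have hfst : ∀ g (x : L × M), (ρ' g x).1 = ρL g x.1 := h3
    have hin : ∀ g a, ρ' g (0, a) = (0, ρM g a) := h2
    have hone : ∀ x, ρ' 1 x = x := fun x => by
      change ρ 1 x = x
      rw [map_one]; rfl
    have hmul : ∀ g h x, ρ' (g * h) x = ρ' g (ρ' h x) := fun g h x => by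
      change ρ (g * h) x = _
      rw [map_mul]; rfl
    have hlie : ∀ g (x y : L × M), ρ' g (⁅x.1, y.1⁆, z.1 x.1 y.1) =
      (⁅(ρ' g x).1, (ρ' g y).1⁆, z.1 (ρ' g x).1 (ρ' g y).1) := h1
    have hρ : ∀ g x a, ρ' g (x, a) = (ρL g x, (ρ' g (x, 0)).2 + ρM g a) := by
      intro g x a
      have : ((x, a) : L × M) = (x, 0) + (0, a) := by simp
      rw [this, map_add, hin]
      exact Prod.ext (by simp [hfst]) rfl
    refine ⟨fun g => LinearMap.snd R L M ∘ₗ ρ' g ∘ₗ LinearMap.inl R L M, ?_, ?_, ?_⟩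
    · intro x
      change (ρ' 1 (x, 0)).2 = 0
      rw [hone]
    · intro g h x
      change (ρ' (g * h) (x, 0)).2 = (ρ' g (ρL h x, 0)).2 + ρM g (ρ' h (x, 0)).2
      rw [hmul]
      have : ρ' h (x, 0) = (ρL h x, (ρ' h (x, 0)).2) := Prod.ext (hfst _ _) rfl
      conv_lhs => rw [this, hρ]
    · intro g x y
      change (ρ' g (⁅x, y⁆, 0)).2 = _
      have e := congrArg Prod.snd (hlie g (x, 0) (y, 0))
      simp only [hfst] at e
      rw [hρ] at e
      exact eq_sub_of_add_eq e
  · rintro ⟨l, h1, h2, h3⟩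
    let ρ' : G → (L × M) →ₗ[R] (L × M) := fun g =>
      LinearMap.prod (ρL g ∘ₗ LinearMap.fst R L M)
        (l g ∘ₗ LinearMap.fst R L M + ρM g ∘ₗ LinearMap.snd R L M)
    have hone : ρ' 1 = 1 := by
      refine LinearMap.ext fun x => Prod.ext ?_ ?_
      · simp [ρ']
      · simp [ρ', h1]
    have hmul : ∀ g h, ρ' (g * h) = ρ' g * ρ' h := by
      intro g h
      refine LinearMap.ext fun x => Prod.ext ?_ ?_
      · simp [ρ']
      · simp [ρ', h2]; abel
    refine ⟨⟨⟨ρ', hone⟩, hmul⟩, ?_, ?_, ?_⟩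
    · intro g x y
      refine Prod.ext (hL g x.1 y.1) ?_
      change l g ⁅x.1, y.1⁆ + ρM g (z.1 x.1 y.1) = z.1 (ρL g x.1) (ρL g y.1)
      rw [h3, sub_add_cancel]
    · intro g a
      refine Prod.ext ?_ ?_
      · change ρL g 0 = 0
        simp
      · change l g 0 + ρM g a = ρM g a
        simp
    · intro g x
      rfl

variable (R L M) in
/-- The group of `G`-equivariant classes: those `c` for which the extension attached to `c` is
`G`-equivariant. -/
def equivariantH2 {G : Type*} [Group G] (ρL : Representation R G L)
    (ρM : Representation R G M) (hL : ∀ g x y, ρL g ⁅x, y⁆ = ⁅ρL g x, ρL g y⁆) :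
    AddSubgroup (H2 R L M) where
  carrier := {c | ∃ z : Z2 R L M, QuotientAddGroup.mk z = c ∧
    (extOfCocycle z).IsEquivariant ρL ρM}
  zero_mem' := by
    refine ⟨0, rfl, ?_⟩
    rw [isEquivariant_extOfCocycle_iff ρL ρM hL]
    exact ⟨fun _ => 0, by simp, by simp, by simp⟩
  add_mem' := by
    rintro _ _ ⟨z, rfl, hz⟩ ⟨z', rfl, hz'⟩
    refine ⟨z + z', rfl, ?_⟩
    rw [isEquivariant_extOfCocycle_iff ρL ρM hL] at hz hz' ⊢
    obtain ⟨l, h1, h2, h3⟩ := hz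
    obtain ⟨l', h1', h2', h3'⟩ := hz'
    refine ⟨fun g => l g + l' g, ?_, ?_, ?_⟩
    · intro x; simp [h1, h1']
    · intro g h x; simp only [LinearMap.add_apply, h2, h2', map_add]; abel
    · intro g x y
      rw [LinearMap.add_apply, h3, h3']
      simp only [AddSubgroup.coe_add, LinearMap.add_apply, map_add]
      abel
  neg_mem' := by
    rintro _ ⟨z, rfl, hz⟩
    refine ⟨-z, rfl, ?_⟩
    rw [isEquivariant_extOfCocycle_iff ρL ρM hL] at hz ⊢
    obtain ⟨l, h1, h2, h3⟩ := hz
    refine ⟨fun g => - l g, ?_, ?_, ?_⟩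
    · intro x; simp [h1]
    · intro g h x; simp only [LinearMap.neg_apply, h2, map_neg]; abel
    · intro g x y
      rw [LinearMap.neg_apply, h3]
      simp only [AddSubgroup.coe_neg, LinearMap.neg_apply, map_neg]
      abel

end Cohomology

section Splitting

variable (F D : Type*) [Field F] [DivisionRing D] [Algebra F D]

/-- The degree of a central division algebra: the square root of its dimension. -/
noncomputable def degree : ℕ := Nat.sqrt (Module.finrank F D)

/-- A central division algebra stays simple after extension of scalars. -/
theorem isSimpleRing_baseChange (K : Type*) [Field K] [Algebra F K] [Algebra.IsCentral F D] :
    IsSimpleRing (K ⊗[F] D) := by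
  classical
  have : Nontrivial (K ⊗[F] D) := inferInstance
  refine ⟨⟨fun I => ?_⟩⟩
  by_cases hI : I = ⊥
  · exact Or.inl hI
  right
  let b := Module.Basis.ofVectorSpace F K
  let f := TensorProduct.equivFinsuppOfBasisLeft (N := D) b
  have hfr : ∀ (x : K ⊗[F] D) (a : D) i, f (x * (1 ⊗ₜ a)) i = f x i * a := by
    intro x a i
    induction x with
    | zero => simp
    | add x y hx hy => simp [add_mul, hx, hy]
    | tmul k d => simp [f]
  have hfl : ∀ (x : K ⊗[F] D) (a : D) i, f ((1 ⊗ₜ a) * x) i = a * f x i := by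
    intro x a i
    induction x with
    | zero => simp
    | add x y hx hy => simp [mul_add, hx, hy]
    | tmul k d => simp [f]
  have hex : ∃ n, ∃ x ∈ I, x ≠ 0 ∧ (f x).support.card = n := by
    by_contra! h
    apply hI
    rw [eq_bot_iff]
    intro x hx
    by_contra hx0
    exact h _ x hx (by simpa using hx0) rfl
  obtain ⟨x, hxI, hx0, hxn⟩ := Nat.find_spec hex
  have hmin : ∀ y ∈ I, (f y).support.card < (f x).support.card → y = 0 := by
    intro y hy hlt
    by_contra hy0
    exact Nat.find_min hex (hxn ▸ hlt) ⟨y, hy, hy0, rfl⟩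
  have hfx : f x ≠ 0 := by simpa using hx0
  obtain ⟨j, hj⟩ := Finsupp.support_nonempty_iff.mpr hfx
  rw [Finsupp.mem_support_iff] at hj
  obtain ⟨y, hy⟩ : ∃ y, y = x * (1 ⊗ₜ (f x j)⁻¹) := ⟨_, rfl⟩
  have hyI : y ∈ I := hy ▸ I.mul_mem_right _ _ hxI
  have hyj : f y j = 1 := by rw [hy, hfr, mul_inv_cancel₀ hj]
  have hyx : (f y).support ⊆ (f x).support := by
    intro i hi
    rw [Finsupp.mem_support_iff] at hi ⊢
    intro h0
    apply hi
    rw [hy, hfr, h0, zero_mul]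
  have hcomm : ∀ a : D, (1 ⊗ₜ a) * y - y * (1 ⊗ₜ a) = 0 := by
    intro a
    apply hmin
    · exact I.sub_mem (I.mul_mem_left _ _ hyI) (I.mul_mem_right _ _ hyI)
    · apply Finset.card_lt_card
      refine ⟨?_, ?_⟩
      · intro i hi
        apply hyx
        rw [Finsupp.mem_support_iff] at hi ⊢
        intro h0
        apply hi
        rw [map_sub, Finsupp.sub_apply, hfl, hfr, h0, mul_zero, zero_mul, sub_zero]
      · intro hss
        have := hss (Finsupp.mem_support_iff.mpr hj)
        rw [Finsupp.mem_support_iff] at this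
        apply this
        rw [map_sub, Finsupp.sub_apply, hfl, hfr, hyj, mul_one, one_mul, sub_self]
  have hcen : ∀ i, ∃ c : F, f y i = algebraMap F D c := by
    intro i
    rw [← Algebra.IsCentral.mem_center_iff F, Subalgebra.mem_center_iff]
    intro a
    have := congrArg (fun z => f z i) (hcomm a)
    simp only [map_sub, Finsupp.sub_apply, hfl, hfr, map_zero, Finsupp.coe_zero,
      Pi.zero_apply] at this
    exact sub_eq_zero.mp this
  choose c hc using hcen
  have hk : y = (∑ i ∈ (f y).support, c i • b i) ⊗ₜ (1 : D) := by
    apply f.injective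
    ext i
    rw [TensorProduct.sum_tmul, map_sum, Finsupp.finsetSum_apply]
    simp only [f, TensorProduct.equivFinsuppOfBasisLeft_apply_tmul_apply, map_smul,
      Finsupp.smul_apply, Module.Basis.repr_self, Finsupp.single_apply, smul_eq_mul]
    rw [Finset.sum_eq_single i]
    · simpa [Algebra.smul_def] using hc i
    · intro k _ hki
      simp [hki]
    · intro hi
      rw [Finsupp.notMem_support_iff, hc] at hi
      simp [Algebra.smul_def, hi]
  set k := ∑ i ∈ (f y).support, c i • b i
  have hk0 : k ≠ 0 := by
    intro h0
    rw [h0, TensorProduct.zero_tmul] at hk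
    rw [hk] at hyj
    simp at hyj
  rw [eq_top_iff]
  intro z _
  have h1 : (k⁻¹ ⊗ₜ[F] (1 : D)) * y = 1 := by
    rw [hk, Algebra.TensorProduct.tmul_mul_tmul, inv_mul_cancel₀ hk0, one_mul]; rfl
  have : (1 : K ⊗[F] D) ∈ I := h1 ▸ I.mul_mem_left _ _ hyI
  simpa using I.mul_mem_left z _ this

variable [FiniteDimensional F D]

theorem exists_splitting [Algebra.IsCentral F D] :
    Nonempty ((AlgebraicClosure F ⊗[F] D) ≃ₐ[AlgebraicClosure F]
      Matrix (Fin (degree F D)) (Fin (degree F D)) (AlgebraicClosure F)) := by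
  have := isSimpleRing_baseChange F D (AlgebraicClosure F)
  obtain ⟨n, _, ⟨e⟩⟩ := IsSimpleRing.exists_algEquiv_matrix_of_isAlgClosed (AlgebraicClosure F)
    (AlgebraicClosure F ⊗[F] D)
  have h := e.toLinearEquiv.finrank_eq
  rw [Module.finrank_baseChange, Module.finrank_matrix] at h
  simp only [Fintype.card_fin, Module.finrank_self, mul_one] at h
  have hn : degree F D = n := by rw [degree, h, Nat.sqrt_eq]
  exact ⟨e.trans (Matrix.reindexAlgEquiv _ _ (finCongr hn.symm))⟩

/-- A splitting of `D` over an algebraic closure of `F`. -/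
noncomputable def splitting [Algebra.IsCentral F D] :
    (AlgebraicClosure F ⊗[F] D) ≃ₐ[AlgebraicClosure F]
      Matrix (Fin (degree F D)) (Fin (degree F D)) (AlgebraicClosure F) :=
  (exists_splitting F D).some

variable {D}

/-- The reduced norm `Nrd(a)`, regarded as an element of the algebraic closure of `F`: the
determinant of the image of `1 ⊗ a` under a splitting of `D` (it lies in `F` and
does not depend on the splitting). -/
noncomputable def reducedNorm [Algebra.IsCentral F D] : D →* AlgebraicClosure F where
  toFun a := (splitting F D (1 ⊗ₜ[F] a)).det
  map_one' := by
    have : (1 ⊗ₜ[F] 1 : AlgebraicClosure F ⊗[F] D) = 1 := rfl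
    rw [this, map_one, Matrix.det_one]
  map_mul' a b := by
    have : (1 ⊗ₜ[F] (a * b) : AlgebraicClosure F ⊗[F] D) = (1 ⊗ₜ[F] a) * (1 ⊗ₜ[F] b) := by
      rw [Algebra.TensorProduct.tmul_mul_tmul, one_mul]
    rw [this, map_mul, Matrix.det_mul]

/-- The reduced trace `Trd(a)`, regarded as an element of the algebraic closure of `F`: the
trace of the image of `1 ⊗ a` under a splitting of `D`. -/
noncomputable def reducedTrace [Algebra.IsCentral F D] : D →ₗ[F] AlgebraicClosure F where
  toFun a := (splitting F D (1 ⊗ₜ[F] a)).trace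
  map_add' a b := by rw [TensorProduct.tmul_add, map_add, Matrix.trace_add]
  map_smul' r a := by
    have : (1 ⊗ₜ[F] (r • a) : AlgebraicClosure F ⊗[F] D) =
        algebraMap F (AlgebraicClosure F) r • (1 ⊗ₜ[F] a) := by
      rw [TensorProduct.tmul_smul, algebraMap_smul]
    rw [this, map_smul, Matrix.trace_smul, RingHom.id_apply, algebraMap_smul]

theorem reducedTrace_mul_comm [Algebra.IsCentral F D] (a b : D) :
    reducedTrace F (a * b) = reducedTrace F (b * a) := by
  have h : ∀ a b : D, (1 ⊗ₜ[F] (a * b) : AlgebraicClosure F ⊗[F] D) =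
      (1 ⊗ₜ[F] a) * (1 ⊗ₜ[F] b) := fun a b => by
    rw [Algebra.TensorProduct.tmul_mul_tmul, one_mul]
  change (splitting F D (1 ⊗ₜ[F] (a * b))).trace = (splitting F D (1 ⊗ₜ[F] (b * a))).trace
  rw [h, h, map_mul, map_mul, Matrix.trace_mul_comm]

variable (D)

/-- The group `SL₁(D)` of elements of `D` of reduced norm one. -/
noncomputable def SL1 [Algebra.IsCentral F D] : Subgroup Dˣ :=
  ((reducedNorm F (D := D)).comp (Units.coeHom D)).ker

end Splitting

section LieAlgebras

variable (p : ℕ) [Fact p.Prime] (F D : Type*) [Field F] [Algebra ℚ_[p] F]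
  [DivisionRing D] [Algebra F D] [Algebra.IsCentral F D] [FiniteDimensional F D]
  [Algebra ℚ_[p] D] [IsScalarTower ℚ_[p] F D] [FiniteDimensional ℚ_[p] D]
  [Algebra ℤ_[p] D] [IsScalarTower ℤ_[p] ℚ_[p] D]

variable {D}

/-- The `ℤ_p`-Lie algebra `sl₁(π ^ n O_D)`: the elements of `π ^ n O_D` of reduced trace zero,
with the bracket `[x, y] = x y - y x`. -/
noncomputable def sl1 (π : integers p D) (n : ℕ) : LieSubalgebra ℤ_[p] D where
  carrier := {x | (∃ y ∈ integers p D, x = (π : D) ^ n * y) ∧ reducedTrace F x = 0}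
  zero_mem' := ⟨⟨0, zero_mem _, by simp⟩, map_zero _⟩
  add_mem' := by
    rintro _ _ ⟨⟨y, hy, rfl⟩, hx⟩ ⟨⟨z, hz, rfl⟩, hx'⟩
    exact ⟨⟨y + z, add_mem hy hz, by rw [mul_add]⟩, by rw [map_add, hx, hx', add_zero]⟩
  smul_mem' := by
    rintro a _ ⟨⟨y, hy, rfl⟩, hx⟩
    refine ⟨⟨a • y, Subalgebra.smul_mem _ hy a, by rw [mul_smul_comm]⟩, ?_⟩
    have : a • ((π : D) ^ n * y) =
        algebraMap ℚ_[p] F (algebraMap ℤ_[p] ℚ_[p] a) • ((π : D) ^ n * y) := by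
      rw [algebraMap_smul, algebraMap_smul]
    rw [this, map_smul, hx, smul_zero]
  lie_mem' := by
    rintro _ _ ⟨⟨y, hy, rfl⟩, -⟩ ⟨⟨z, hz, rfl⟩, -⟩
    rw [Ring.lie_def]
    refine ⟨⟨y * ((π : D) ^ n * z) - z * ((π : D) ^ n * y), ?_, ?_⟩, ?_⟩
    · exact sub_mem (mul_mem hy (mul_mem (pow_mem π.2 n) hz))
        (mul_mem hz (mul_mem (pow_mem π.2 n) hy))
    · rw [mul_sub, mul_assoc, mul_assoc]
    · rw [map_sub, reducedTrace_mul_comm, sub_self]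

/-- The action of `SL₁(D)` on `sl₁(π ^ n O_D)` by conjugation. -/
noncomputable def conjRep (π : integers p D) (n : ℕ) :
    Representation ℤ_[p] (SL1 F D) (sl1 p F π n) where
  toFun g :=
    { toFun := fun x => ⟨((g : Dˣ) : D) * (x : D) * (((g : Dˣ)⁻¹ : Dˣ) : D),
        conj_mem p π n g x x.2.1, by
          rw [reducedTrace_mul_comm, ← mul_assoc, Units.inv_mul, one_mul]
          exact x.2.2⟩
      map_add' := fun x y => Subtype.ext (by simp [mul_add, add_mul])
      map_smul' := fun a x => Subtype.ext (by simp) }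
  map_one' := LinearMap.ext fun x => Subtype.ext (by simp)
  map_mul' g h := LinearMap.ext fun x => Subtype.ext (by simp [mul_assoc])

/-- `SL₁(D)` acts on `sl₁(π ^ n O_D)` by Lie algebra automorphisms. -/
theorem conjRep_lie (π : integers p D) (n : ℕ) (g : SL1 F D) (x y : sl1 p F π n) :
    conjRep p F π n g ⁅x, y⁆ = ⁅conjRep p F π n g x, conjRep p F π n g y⁆ := by
  apply Subtype.ext
  change ((g : Dˣ) : D) * ⁅(x : D), (y : D)⁆ * (((g : Dˣ)⁻¹ : Dˣ) : D) =
    ⁅((g : Dˣ) : D) * (x : D) * (((g : Dˣ)⁻¹ : Dˣ) : D),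
      ((g : Dˣ) : D) * (y : D) * (((g : Dˣ)⁻¹ : Dˣ) : D)⁆
  simp only [Ring.lie_def, mul_sub, sub_mul, mul_assoc, Units.inv_mul_cancel_left]

/-- The group `H²(sl₁(π ^ n O_D), ℤ/p^s)^G` of `G`-equivariant classes for `G = SL₁(D)`, acting by
conjugation on `sl₁(π ^ n O_D)` and trivially on `ℤ/p^s = ℤ_p/p^sℤ_p`. -/
noncomputable def equivariantClasses (π : integers p D) (n s : ℕ) :
    AddSubgroup (H2 ℤ_[p] (sl1 p F π n) (ℤ_[p] ⧸ Ideal.span {(p : ℤ_[p]) ^ s})) :=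
  equivariantH2 ℤ_[p] (sl1 p F π n) (ℤ_[p] ⧸ Ideal.span {(p : ℤ_[p]) ^ s}) (conjRep p F π n)
    (Representation.trivial ℤ_[p] (SL1 F D) (ℤ_[p] ⧸ Ideal.span {(p : ℤ_[p]) ^ s}))
    (conjRep_lie p F π n)

end LieAlgebras

end NormOne

set_option linter.unusedSectionVars false

/-! The bound holds for every alternating 2-cocycle `f` on the Lie algebra 𝔤_n = `sl1 p F π n`, with
values in any ℤ_p-module: `p ^ (w + 4) • f` is a coboundary. The exponent splits as 2 + (w + 2).

The 2 comes from rescaling. Let τ = ϖ^d, a uniformizer of F. Since |p| = |τ|^e = |ϖ|^(de) and n = de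
+ 1, multiplication by p is an isomorphism 𝔤_1 → 𝔤_n, and [px, py] = p · p[x, y]. Hence (x, y) ↦ p
f(px, py) is a cocycle on 𝔤_1, and a trivialization of p^(w+2) times it trivializes p^(w+4) f
(`smul_mem_B2`).

The w + 2 comes from a computation with root vectors on 𝔤_1. D contains roots of unity of order
prime to p representing the nonzero residues, and a uniformizer ϖ normalizing them
(`exists_cyclicStructure`). Together with τ they generate the integers S of a maximal unramified
subfield. Over S the characters of the roots of unity give orthogonal idempotents of S ⊗ D, which
conjugation by ϖ permutes in cycles of length d. So S ⊗ 𝔤_1 becomes a Lie algebra of block matrices,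
of trace zero in each block and strictly upper triangular modulo τ, whose entries are polynomials in
τ subject to the equation of τ. `Frame` records exactly what is used of this picture.

Let f be a cocycle there (`Frame.exists_functional`). The diagonal element with entries p and -p at
i and j is a multiple by p of a coroot. If it acts on x and y by pr and ps, then p(r + s) f(x, y) =
f(h, [x, y]). For root vectors that are not opposite one can reach r + s ∈ {2, 3, 4}; these divide
12, and 12 divides p in ℤ_p because p is odd, so p² suffices. For opposite root vectors f may be
normalized so that f(e_0i(1), e_i0(c)) = 0. Then f(e_0i(a), e_i0(c)) depends on a only through its
differential: f(e_0i(a), e_i0(c)) = f(e_0i(X), e_i0(a'c)). If P is the equation of τ, then P'(τ)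
kills this expression, and τP'(τ) divides p^(w+1) (`exists_eisenstein`): the coefficients of P can
be chosen so that the terms of τP'(τ)/p have values in distinct classes modulo e, one of them being
e times a unit. The factor p^(w+2) covers both kinds of pairs.

Finally, 1 is part of a ℤ_p-basis of S, so a ℤ_p-linear retraction S → ℤ_p brings the trivialization
back to 𝔤_1 (`exists_functional_of_frame`). -/

namespace NormOne

/-! ### Cocycles on a Lie algebra of block matrices -/

section Frames

open Polynomial

/-- A description by coordinates of a Lie algebra of block matrices that are strictly upper
triangular modulo `τ`: `e ν i j a` is the matrix of the block `ν` with single entry `a(τ)`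
(if `i < j`) or `τ a(τ)` (if `j < i`) at `(i, j)`, and `h ν i j a` is the diagonal matrix with
entries `τ a(τ)` at `i` and `- τ a(τ)` at `j`. -/
structure Frame (S N I : Type*) [CommRing S] [LieRing N] [LieAlgebra S N] [DecidableEq I]
    (d : ℕ) [NeZero d] (q : ℕ) (Q : ℕ) where
  e : I → Fin d → Fin d → S[X] →ₗ[S] N
  h : I → Fin d → Fin d → S[X] →ₗ[S] N
  P : I → Fin d → Fin d → N →ₗ[S] N
  -- The position `(i, 0)` lies below the diagonal, so it carries the same factor `τ` as a diagonal
  -- entry. Moving the entry there turns a functional of one coefficient into a well defined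
  -- functional on `N`, whatever the relations among the `h ν i j a`.
  κ : I → Fin d → N →ₗ[S] N
  lie_opp : ∀ ν i j a b, i ≠ j → ⁅e ν i j a, e ν j i b⁆ = h ν i j (a * b)
  lie_mul : ∀ ν i j k a b, i ≠ j → j ≠ k → i ≠ k → ⁅e ν i j a, e ν j k b⁆ =
    e ν i k (X ^ ((if j < i then 1 else 0) + (if k < j then 1 else 0) -
      (if k < i then 1 else 0)) * (a * b))
  lie_zero : ∀ ν i j μ k l a b, i ≠ j → k ≠ l → (ν = μ → j ≠ k ∧ i ≠ l) →
    ⁅e ν i j a, e μ k l b⁆ = 0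
  lie_diag : ∀ ν i j μ k l a b, i ≠ j → k ≠ l → ⁅h ν i j a, e μ k l b⁆ =
    (if ν = μ then (if i = k then 1 else 0) + (if j = l then 1 else 0) - (if i = l then 1 else 0)
      - (if j = k then 1 else 0) else 0 : ℤ) • e μ k l (X * (a * b))
  P_e : ∀ ν i j μ k l a, i ≠ j → k ≠ l → P ν i j (e μ k l a) =
    if ν = μ ∧ i = k ∧ j = l then e μ k l a else 0
  P_h : ∀ ν i j μ k l a, i ≠ j → k ≠ l → P ν i j (h μ k l a) = 0
  κ_e : ∀ ν i μ k l a, i ≠ 0 → k ≠ l → κ ν i (e μ k l a) = 0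
  κ_h : ∀ ν i μ k l a, i ≠ 0 → k ≠ l → κ ν i (h μ k l a) =
    (if ν = μ then (if i = k then 1 else 0) - (if i = l then 1 else 0) else 0 : ℤ) • e ν i 0 a
  span : ∀ x : N, x ∈ Submodule.span S
    ({y | ∃ ν i j a, i ≠ j ∧ y = e ν i j a} ∪ {y | ∃ ν i j a, i ≠ j ∧ y = h ν i j a})
  -- On the block `ν`, `pol` is the equation of `τ`, `quo` stands for `q / τ` and `inv` for `Q / (τ
  -- pol'(τ))`. In the application `q = p` and `Q = p ^ (w + 1)`.
  pol : I → S[X]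
  quo : I → S[X]
  inv : I → S[X]
  e_pol : ∀ ν i j a, i ≠ j → e ν i j (pol ν * a) = 0
  e_quo : ∀ ν i j a, i ≠ j → e ν i j (X * (quo ν * a)) = (q : S) • e ν i j a
  e_inv : ∀ ν i j a, i ≠ j → e ν i j (X * (derivative (pol ν) * inv ν * a)) = (Q : S) • e ν i j a

namespace Frame

variable {S N I M : Type*} [CommRing S] [LieRing N] [LieAlgebra S N] [DecidableEq I]
  {d : ℕ} [NeZero d] {q Q : ℕ} (Φ : Frame S N I d q Q) [AddCommGroup M] [Module S M]

/-- Cochains that are determined by a functional of the bracket on all pairs of generators are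
coboundaries. -/
theorem ext_generators (B : N →ₗ[S] N →ₗ[S] M) (hs : ∀ x y, B x y = - B y x)
    (h1 : ∀ ν i j μ k l a b, i ≠ j → k ≠ l → B (Φ.e ν i j a) (Φ.e μ k l b) = 0)
    (h2 : ∀ ν i j μ k l a b, i ≠ j → k ≠ l → B (Φ.e ν i j a) (Φ.h μ k l b) = 0)
    (h3 : ∀ ν i j μ k l a b, i ≠ j → k ≠ l → B (Φ.h ν i j a) (Φ.h μ k l b) = 0) (x y : N) :
    B x y = 0 := by
  induction Φ.span x using Submodule.span_induction with
  | zero => simp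
  | add x x' _ _ hx hx' => simp [hx, hx']
  | smul r x _ hx => simp [hx]
  | mem x hx =>
    induction Φ.span y using Submodule.span_induction with
    | zero => simp
    | add x x' _ _ hx hx' => simp [hx, hx']
    | smul r x _ hx => simp [hx]
    | mem y hy =>
      rcases hx with ⟨ν, i, j, a, hij, rfl⟩ | ⟨ν, i, j, a, hij, rfl⟩ <;>
      rcases hy with ⟨μ, k, l, b, hkl, rfl⟩ | ⟨μ, k, l, b, hkl, rfl⟩
      · exact h1 _ _ _ _ _ _ _ _ hij hkl
      · exact h2 _ _ _ _ _ _ _ _ hij hkl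
      · rw [hs, h2 _ _ _ _ _ _ _ _ hkl hij, neg_zero]
      · exact h3 _ _ _ _ _ _ _ _ hij hkl

variable {f : N →ₗ[S] N →ₗ[S] M} (hs : ∀ x y, f x y = - f y x)
  (hJ : ∀ x y z, f ⁅x, y⁆ z + f ⁅y, z⁆ x + f ⁅z, x⁆ y = 0)

include hs hJ in
-- The cocycle identity in Leibniz form: bracketing with `x` distributes over the two arguments of
-- `f`.
theorem lie_right (x y z : N) : f x ⁅y, z⁆ = f ⁅x, y⁆ z + f y ⁅x, z⁆ := by
  have := hJ x y z
  rw [hs x, hs y ⁅x, z⁆, ← lie_skew x z, map_neg, LinearMap.neg_apply, neg_neg]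
  rw [← sub_eq_zero]
  rw [← neg_eq_zero, ← this]; abel

include hs hJ in
/-- The cocycle on pairs of opposite generators, when it vanishes on pairs with first
coefficient `1`. -/
theorem opp_eq_derivative (ν : I) (i j : Fin d) (hij : i ≠ j)
    (h2 : IsUnit (2 : S))
    (h1 : ∀ c, f (Φ.e ν i j 1) (Φ.e ν j i c) = 0) (a c : S[X]) :
    f (Φ.e ν i j a) (Φ.e ν j i c) = f (Φ.e ν i j X) (Φ.e ν j i (derivative a * c)) := by
  -- The left side sees only the product `b * c`, while the right side separates the factors. Two
  -- factorizations of one product therefore give a relation.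
  have hh : ∀ a b c, f (Φ.h ν i j a) (Φ.h ν i j (b * c)) =
      (2 : S) • (f (Φ.e ν i j (X * (a * b))) (Φ.e ν j i c)
        - f (Φ.e ν i j b) (Φ.e ν j i (X * (a * c)))) := by
    intro a b c
    rw [← Φ.lie_opp ν i j b c hij, lie_right hs hJ, Φ.lie_diag _ _ _ _ _ _ _ _ hij hij,
      Φ.lie_diag _ _ _ _ _ _ _ _ hij hij.symm]
    simp [hij, hij.symm]
    rw [show (2 : S) = ((2 : ℤ) : S) by norm_num, Int.cast_smul_eq_zsmul]
    module
  -- A Leibniz rule in the first argument, from the factorizations `b * c` and `1 * (b * c)` after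
  -- cancelling 2; the normalization `h1` removes the fourth term.
  have hrec : ∀ b c, f (Φ.e ν i j (X * b)) (Φ.e ν j i c) =
      f (Φ.e ν i j X) (Φ.e ν j i (b * c)) + f (Φ.e ν i j b) (Φ.e ν j i (X * c)) := by
    intro b c
    have e1 := hh 1 b c
    have e2 := hh 1 1 (b * c)
    rw [one_mul] at e2
    rw [e2] at e1
    have := h2.smul_left_cancel.1 e1
    simp only [one_mul, mul_one, h1, sub_zero] at this
    rw [this, sub_add_cancel]
  have hpow : ∀ (k : ℕ) (c : S[X]), f (Φ.e ν i j (X ^ k)) (Φ.e ν j i c) =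
      f (Φ.e ν i j X) (Φ.e ν j i (derivative (X ^ k) * c)) := by
    intro k
    induction k with
    | zero => intro c; simp [h1]
    | succ k ih =>
      intro c
      rw [pow_succ', hrec, ih, ← map_add, ← map_add]
      congr 2
      simp only [derivative_mul, derivative_X]
      ring
  induction a using Polynomial.induction_on' with
  | add a b ha hb => simp [ha, hb, add_mul]
  | monomial k r =>
    have : monomial k r = r • (X ^ k : S[X]) := by rw [smul_X_eq_monomial]
    rw [this, map_smul, map_smul, LinearMap.smul_apply, hpow, derivative_smul, smul_mul_assoc,
      map_smul, map_smul]

include hs hJ in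
-- Since `pol` gives the zero element, the derivation formula shows that pairing with the
-- coefficient `X` kills multiples of the derivative of `pol`. By `e_inv`, `Q` acts as such a
-- multiple: the exponent is bounded by the different.
theorem opp_killed (ν : I) (i j : Fin d) (hij : i ≠ j) (h2 : IsUnit (2 : S))
    (h1 : ∀ c, f (Φ.e ν i j 1) (Φ.e ν j i c) = 0) (a c : S[X]) :
    (Q : S) • f (Φ.e ν i j a) (Φ.e ν j i c) = 0 := by
  have key := Φ.opp_eq_derivative hs hJ ν i j hij h2 h1
  rw [key, ← map_smul, ← Φ.e_inv ν j i _ hij.symm]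
  have h0 : ∀ c, f (Φ.e ν i j X) (Φ.e ν j i (derivative (Φ.pol ν) * c)) = 0 := by
    intro c
    rw [← key, ← mul_one (Φ.pol ν), Φ.e_pol _ _ _ _ hij]
    simp
  rw [← h0 (X * (Φ.inv ν * (derivative a * c)))]
  congr 2
  ring


/-- The functional that normalizes a cocycle on pairs of opposite generators. -/
noncomputable def oppFunctional [Fintype I] (f : N →ₗ[S] N →ₗ[S] M) : N →ₗ[S] M :=
  - ∑ ν, ∑ i, if i = 0 then 0 else f (Φ.e ν 0 i 1) ∘ₗ Φ.κ ν i

theorem oppFunctional_e [Fintype I] (ν : I) (i j : Fin d) (hij : i ≠ j) (a : S[X]) :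
    Φ.oppFunctional f (Φ.e ν i j a) = 0 := by
  simp only [oppFunctional, LinearMap.neg_apply, LinearMap.sum_apply, neg_eq_zero]
  refine Finset.sum_eq_zero fun μ _ => Finset.sum_eq_zero fun k _ => ?_
  split_ifs with h
  · simp
  · simp [Φ.κ_e _ _ _ _ _ _ h hij]

/-- The entry of `h ν 0 i a` at `i` is negative, so `κ ν i` takes the sign `-1` on it. This is the
reason for the minus sign in `oppFunctional`. -/
theorem oppFunctional_h [Fintype I] (ν : I) (i : Fin d) (hi : i ≠ 0) (a : S[X]) :
    Φ.oppFunctional f (Φ.h ν 0 i a) = f (Φ.e ν 0 i 1) (Φ.e ν i 0 a) := by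
  simp only [oppFunctional, LinearMap.neg_apply, LinearMap.sum_apply]
  rw [Finset.sum_eq_single ν, Finset.sum_eq_single i]
  · simp [hi, Φ.κ_h _ _ _ _ _ _ hi hi.symm]
  · intro k _ hki
    split_ifs with h
    · simp
    · simp [Φ.κ_h _ _ _ _ _ _ h hi.symm, h, hki]
  · simp
  · intro μ _ hμ
    refine Finset.sum_eq_zero fun k _ => ?_
    split_ifs with h
    · simp
    · simp [Φ.κ_h _ _ _ _ _ _ h hi.symm, hμ]
  · simp

include hs hJ in
-- Subtracting one coboundary normalizes the pairs `(0, k)` with first coefficient 1; the derivation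
-- argument then kills the pairs `(0, k)`, and the Jacobi identity carries this over to all pairs.
theorem opp_eq [Fintype I] (h2 : IsUnit (2 : S)) (ν : I) (i j : Fin d) (hij : i ≠ j) (a b : S[X]) :
    (Q : S) • f (Φ.e ν i j a) (Φ.e ν j i b) =
      (Q : S) • Φ.oppFunctional f ⁅Φ.e ν i j a, Φ.e ν j i b⁆ := by
  obtain ⟨f', hf'⟩ : ∃ f' : N →ₗ[S] N →ₗ[S] M,
      ∀ x y, f' x y = f x y - Φ.oppFunctional f ⁅x, y⁆ :=
    ⟨LinearMap.mk₂ S (fun x y => f x y - Φ.oppFunctional f ⁅x, y⁆)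
      (fun x y z => by simp only [map_add, LinearMap.add_apply, add_lie]; abel)
      (fun r x y => by simp [smul_sub]) (fun x y z => by simp only [map_add, lie_add]; abel)
      (fun r x y => by simp [smul_sub]), fun _ _ => rfl⟩
  have hs' : ∀ x y, f' x y = - f' y x := fun x y => by
    rw [hf', hf', hs, ← lie_skew x y, map_neg]; abel
  have hJ' : ∀ x y z, f' ⁅x, y⁆ z + f' ⁅y, z⁆ x + f' ⁅z, x⁆ y = 0 := fun x y z => by
    have := congrArg (Φ.oppFunctional f) (lie_jacobi x y z)
    rw [← lie_skew x ⁅y, z⁆, ← lie_skew y ⁅z, x⁆, ← lie_skew z ⁅x, y⁆] at this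
    simp only [map_add, map_neg, map_zero] at this
    rw [hf', hf', hf']
    generalize Φ.oppFunctional f ⁅⁅x, y⁆, z⁆ = t1 at *
    generalize Φ.oppFunctional f ⁅⁅y, z⁆, x⁆ = t2 at *
    generalize Φ.oppFunctional f ⁅⁅z, x⁆, y⁆ = t3 at *
    have h' := hJ x y z
    generalize f ⁅x, y⁆ z = s1 at *
    generalize f ⁅y, z⁆ x = s2 at *
    generalize f ⁅z, x⁆ y = s3 at *
    rw [show s1 - t1 + (s2 - t2) + (s3 - t3) = (s1 + s2 + s3) + (-t2 + -t3 + -t1) by abel,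
      h', this, add_zero]
  have h0 : ∀ ν (k : Fin d), k ≠ 0 → ∀ c, f' (Φ.e ν 0 k 1) (Φ.e ν k 0 c) = 0 := by
    intro ν k hk c
    rw [hf', Φ.lie_opp _ _ _ _ _ hk.symm, Φ.oppFunctional_h _ _ hk, one_mul, sub_self]
  have hk0 : ∀ (k : Fin d), k ≠ 0 → ∀ a c, (Q : S) • f' (Φ.e ν 0 k a) (Φ.e ν k 0 c) = 0 :=
    fun k hk => Φ.opp_killed hs' hJ' ν 0 k hk.symm h2 (h0 ν k hk)
  have main : ∀ i j : Fin d, i < j → ∀ a b, (Q : S) • f' (Φ.e ν i j a) (Φ.e ν j i b) = 0 := by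
    intro i j hij a b
    have hj : j ≠ 0 := ((Fin.zero_le i).trans_lt hij).ne'
    by_cases hi : i = 0
    · subst hi
      exact hk0 j hj a b
    · have hi0 : 0 < i := lt_of_le_of_ne (Fin.zero_le i) (Ne.symm hi)
      have hj0 : 0 < j := hi0.trans hij
      -- All three brackets of this triple are opposite to the remaining vector. The term at `(0,
      -- i)` vanishes by the normalization, because its coefficient is 1, so the pair `(i, j)`
      -- reduces to the pair `(0, j)`.
      have e := hJ' (Φ.e ν 0 i 1) (Φ.e ν i j a) (Φ.e ν j 0 b)
      rw [Φ.lie_mul _ _ _ _ _ _ hi0.ne hij.ne hj0.ne,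
        Φ.lie_mul _ _ _ _ _ _ hij.ne hj0.ne' hi0.ne',
        Φ.lie_mul _ _ _ _ _ _ hj0.ne' hi0.ne hij.ne'] at e
      simp only [hi0.not_gt, hij.not_gt, hj0.not_gt, hi0, hj0, hij, if_true, if_false, pow_zero,
        one_mul, mul_one, add_zero, zero_add, Nat.sub_self, zero_tsub] at e
      rw [hs' (Φ.e ν i 0 _), h0 _ _ hi, neg_zero, add_zero, add_comm] at e
      rw [hs', eq_neg_of_add_eq_zero_left e, smul_neg, smul_neg, hk0 j hj]
      simp
  have main' : (Q : S) • f' (Φ.e ν i j a) (Φ.e ν j i b) = 0 := by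
    rcases lt_or_gt_of_ne hij with h | h
    · exact main _ _ h _ _
    · rw [hs', smul_neg, main _ _ h, neg_zero]
  rw [hf', smul_sub] at main'
  exact sub_eq_zero.1 main'

/-- The functional that trivializes a cocycle on pairs of non-opposite weights. -/
noncomputable def rootFunctional [Fintype I] (f : N →ₗ[S] N →ₗ[S] M) : N →ₗ[S] M :=
  ∑ ν, ∑ i, ∑ j, if i = j then 0 else f (Φ.h ν i j (Φ.quo ν)) ∘ₗ Φ.P ν i j

theorem rootFunctional_h [Fintype I] (ν : I) (i j : Fin d) (hij : i ≠ j) (a : S[X]) :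
    Φ.rootFunctional f (Φ.h ν i j a) = 0 := by
  simp only [rootFunctional, LinearMap.sum_apply]
  refine Finset.sum_eq_zero fun μ _ => Finset.sum_eq_zero fun k _ =>
    Finset.sum_eq_zero fun l _ => ?_
  split_ifs with h
  · simp
  · simp [Φ.P_h _ _ _ _ _ _ _ h hij]

theorem rootFunctional_e [Fintype I] (ν : I) (i j : Fin d) (hij : i ≠ j) (a : S[X]) :
    Φ.rootFunctional f (Φ.e ν i j a) = f (Φ.h ν i j (Φ.quo ν)) (Φ.e ν i j a) := by
  simp only [rootFunctional, LinearMap.sum_apply]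
  rw [Finset.sum_eq_single ν, Finset.sum_eq_single i, Finset.sum_eq_single j]
  · simp [hij, Φ.P_e _ _ _ _ _ _ _ hij hij]
  · intro k _ hk
    split_ifs with h
    · simp
    · simp [Φ.P_e _ _ _ _ _ _ _ h hij, hk]
  · simp
  · intro k _ hk
    refine Finset.sum_eq_zero fun l _ => ?_
    split_ifs with h
    · simp
    · simp [Φ.P_e _ _ _ _ _ _ _ h hij, hk]
  · simp
  · intro k _ hk
    refine Finset.sum_eq_zero fun l _ => Finset.sum_eq_zero fun m _ => ?_
    split_ifs with h
    · simp
    · simp [Φ.P_e _ _ _ _ _ _ _ h hij, hk]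
  · simp

/-- The coefficient `quo` cancels the factor `τ` of `h` up to `q`, so this diagonal element acts as
`q` times a coroot, by integral weights. -/
theorem lie_quo (ν i j μ k l) (b : S[X]) (hij : i ≠ j) (hkl : k ≠ l) :
    ⁅Φ.h ν i j (Φ.quo ν), Φ.e μ k l b⁆ =
    ((if ν = μ then (if i = k then 1 else 0) + (if j = l then 1 else 0) - (if i = l then 1 else 0)
      - (if j = k then 1 else 0) else 0 : ℤ) * q : S) • Φ.e μ k l b := by
  rw [Φ.lie_diag _ _ _ _ _ _ _ _ hij hkl]
  by_cases h : ν = μ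
  · subst h
    rw [Φ.e_quo _ _ _ _ hkl, ← smul_assoc, zsmul_eq_mul]
  · simp [h]

include hs hJ in
/-- An element acting on two elements by scalars trivializes the cocycle on them. -/
theorem smul_apply_of_lie (c x y : N) (r s : S) (hx : ⁅c, x⁆ = r • x) (hy : ⁅c, y⁆ = s • y) :
    (r + s) • f x y = f c ⁅x, y⁆ := by
  rw [lie_right hs hJ, hx, hy, map_smul, map_smul, LinearMap.smul_apply, add_smul]

/-- A diagonal element is a bracket of opposite root vectors, whose weights cancel. -/
theorem lie_h_h (ν i j μ k l) (a b : S[X]) (hij : i ≠ j) (hkl : k ≠ l) :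
    ⁅Φ.h ν i j a, Φ.h μ k l b⁆ = 0 := by
  have : Φ.h μ k l b = ⁅Φ.e μ k l b, Φ.e μ l k 1⁆ := by rw [Φ.lie_opp _ _ _ _ _ hkl, mul_one]
  rw [this, leibniz_lie, Φ.lie_diag _ _ _ _ _ _ _ _ hij hkl,
    Φ.lie_diag _ _ _ _ _ _ _ _ hij hkl.symm, smul_lie, lie_smul, Φ.lie_opp _ _ _ _ _ hkl,
    Φ.lie_opp _ _ _ _ _ hkl]
  have : X * (a * b) * 1 = b * (X * (a * 1)) := by ring
  rw [this, ← add_smul]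
  convert zero_smul ℤ _
  split_ifs <;> simp

include hs hJ in
/-- The cohomology of a Lie algebra with a frame has bounded exponent. -/
theorem exists_functional [Fintype I] (Φ : Frame S N I d q Q) (h2 : IsUnit (2 : S)) (v : S) (hv : 12 * v = q) (Q' : ℕ)
    (hQ : Q = q * Q') : ∃ u : N →ₗ[S] M, ∀ x y, ((q * Q : ℕ) : S) • f x y = u ⁅x, y⁆ := by
  -- The factor `2 * q` is to be produced by a weight sum 2; what is left, `Q' * 6 * v`, is the
  -- coefficient given to `rootFunctional` in `U`.
  have hqq : ((q * Q : ℕ) : S) = (Q' * 6 * v) * (2 * q) := by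
    rw [hQ]; push_cast; rw [← hv]; ring
  obtain ⟨U, hU⟩ : ∃ U : N →ₗ[S] M, ∀ z, U z =
      ((q * Q : ℕ) : S) • Φ.oppFunctional f z + (Q' * 6 * v : S) • Φ.rootFunctional f z :=
    ⟨((q * Q : ℕ) : S) • Φ.oppFunctional f + (Q' * 6 * v : S) • Φ.rootFunctional f, fun _ => rfl⟩
  have hUe : ∀ ν i j a, i ≠ j →
      U (Φ.e ν i j a) = (Q' * 6 * v : S) • f (Φ.h ν i j (Φ.quo ν)) (Φ.e ν i j a) := by
    intro ν i j a hij
    rw [hU, Φ.oppFunctional_e _ _ _ hij, Φ.rootFunctional_e _ _ _ hij, smul_zero, zero_add]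
  -- a pair of generators of which the difference of two coordinates acts by the weight `2`
  have two : ∀ ν i j a x y (r s : S), i ≠ j → r + s = 2 * q →
      ⁅Φ.h ν i j (Φ.quo ν), x⁆ = r • x → ⁅Φ.h ν i j (Φ.quo ν), y⁆ = s • y →
      ⁅x, y⁆ = Φ.e ν i j a → ((q * Q : ℕ) : S) • f x y = U ⁅x, y⁆ := by
    intro ν i j a x y r s hij hrs hx hy hxy
    rw [hqq, mul_smul, ← hrs, smul_apply_of_lie hs hJ _ _ _ _ _ hx hy, hxy, hUe _ _ _ _ hij]
  -- When the bracket vanishes, `f x y` is killed by `q` times the weight sum. The sums 2, 3 and 4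
  -- all divide 12, hence the condition `12 * v = q`.
  have zero : ∀ ν i j x y (m n : ℤ), i ≠ j → m + n = 2 ∨ m + n = 3 ∨ m + n = 4 →
      ⁅Φ.h ν i j (Φ.quo ν), x⁆ = (m * q : S) • x → ⁅Φ.h ν i j (Φ.quo ν), y⁆ = (n * q : S) • y →
      ⁅x, y⁆ = 0 → ((q * Q : ℕ) : S) • f x y = U ⁅x, y⁆ := by
    intro ν i j x y m n hij hmn hx hy hxy
    have := smul_apply_of_lie hs hJ _ _ _ _ _ hx hy
    rw [hxy, map_zero, ← add_mul, ← Int.cast_add] at this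
    rw [hxy, map_zero]
    rcases hmn with h | h | h <;> rw [h] at this
    · rw [show ((q * Q : ℕ) : S) = (Q' * 6 * v) * (((2 : ℤ) : S) * q) by rw [hqq]; norm_num,
        mul_smul, this, smul_zero]
    · rw [show ((q * Q : ℕ) : S) = (Q' * 4 * v) * (((3 : ℤ) : S) * q) by
        rw [hqq]; push_cast; ring, mul_smul, this, smul_zero]
    · rw [show ((q * Q : ℕ) : S) = (Q' * 3 * v) * (((4 : ℤ) : S) * q) by
        rw [hqq]; push_cast; ring, mul_smul, this, smul_zero]
  obtain ⟨B, hB⟩ : ∃ B : N →ₗ[S] N →ₗ[S] M,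
      ∀ x y, B x y = ((q * Q : ℕ) : S) • f x y - U ⁅x, y⁆ :=
    ⟨LinearMap.mk₂ S (fun x y => ((q * Q : ℕ) : S) • f x y - U ⁅x, y⁆)
      (fun x y z => by simp only [map_add, LinearMap.add_apply, add_lie, smul_add]; abel)
      (fun r x y => by simp [smul_sub, smul_comm r])
      (fun x y z => by simp only [map_add, lie_add, smul_add]; abel)
      (fun r x y => by simp [smul_sub, smul_comm r]), fun _ _ => rfl⟩
  have hee : ∀ ν i j μ k l a b, i ≠ j → k ≠ l →
      ((q * Q : ℕ) : S) • f (Φ.e ν i j a) (Φ.e μ k l b) = U ⁅Φ.e ν i j a, Φ.e μ k l b⁆ := by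
    intro ν i j μ k l a b hij hkl
    by_cases hν : ν = μ
    swap
    · refine zero ν i j _ _ 2 0 hij (by norm_num) ?_ ?_
        (Φ.lie_zero _ _ _ _ _ _ _ _ hij hkl fun h => (hν h).elim)
      · rw [Φ.lie_quo _ _ _ _ _ _ _ hij hij]; simp [hij, hij.symm]
      · rw [Φ.lie_quo _ _ _ _ _ _ _ hij hkl]; simp [hν]
    subst hν
    by_cases hjk : j = k
    · subst hjk
      by_cases hil : i = l
      · subst hil
        rw [Nat.cast_mul, mul_smul, Φ.opp_eq hs hJ h2 _ _ _ hij, hU, Φ.lie_opp _ _ _ _ _ hij,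
          Φ.rootFunctional_h _ _ _ hij, smul_zero, add_zero, ← mul_smul, ← Nat.cast_mul]
      -- The two roots add up to the root `(i, l)`, whose coroot has weight 1 on each of them.
      · refine two ν i l _ _ _ q q hil (by ring) ?_ ?_ (Φ.lie_mul _ _ _ _ _ _ hij hkl hil)
        · rw [Φ.lie_quo _ _ _ _ _ _ _ hil hij]; simp [hij, hkl.symm, Ne.symm hil]
        · rw [Φ.lie_quo _ _ _ _ _ _ _ hil hkl]; simp [hij, hkl.symm, hil]
    · by_cases hil : i = l
      · subst hil
        have hsw : ⁅Φ.e ν i j a, Φ.e ν k i b⁆ = - ⁅Φ.e ν k i b, Φ.e ν i j a⁆ :=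
          (lie_skew _ _).symm
        rw [hs, smul_neg, hsw, map_neg]
        congr 1
        refine two ν k j _ _ _ q q (Ne.symm hjk) (by ring) ?_ ?_
          (Φ.lie_mul _ _ _ _ _ _ hkl hij (Ne.symm hjk))
        · rw [Φ.lie_quo _ _ _ _ _ _ _ (Ne.symm hjk) hkl]
          simp [hkl, hij.symm, hjk]
        · rw [Φ.lie_quo _ _ _ _ _ _ _ (Ne.symm hjk) hij]
          simp [hkl, hij.symm, Ne.symm hjk]
      -- The sum of the roots is not a root. The coroot of the first has weight 2 on it and weight
      -- 0, 1 or 2 on the second, the last when the roots coincide.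
      · refine zero ν i j _ _ 2 ((if i = k then 1 else 0) + (if j = l then 1 else 0)) hij ?_ ?_ ?_
          (Φ.lie_zero _ _ _ _ _ _ _ _ hij hkl fun _ => ⟨hjk, hil⟩)
        · split_ifs <;> norm_num
        · rw [Φ.lie_quo _ _ _ _ _ _ _ hij hij]; simp [hij, hij.symm]
        · rw [Φ.lie_quo _ _ _ _ _ _ _ hij hkl]; simp [hil, hjk]
  have heh : ∀ ν i j μ k l a b, i ≠ j → k ≠ l →
      ((q * Q : ℕ) : S) • f (Φ.e ν i j a) (Φ.h μ k l b) = U ⁅Φ.e ν i j a, Φ.h μ k l b⁆ := by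
    intro ν i j μ k l a b hij hkl
    have hx : ⁅Φ.h ν i j (Φ.quo ν), Φ.e ν i j a⁆ = (2 * q : S) • Φ.e ν i j a := by
      rw [Φ.lie_quo _ _ _ _ _ _ _ hij hij]; simp [hij, hij.symm]
    have hy : ⁅Φ.h ν i j (Φ.quo ν), Φ.h μ k l b⁆ = (0 : S) • Φ.h μ k l b := by
      rw [Φ.lie_h_h _ _ _ _ _ _ _ _ hij hkl, zero_smul]
    have hsw : ⁅Φ.e ν i j a, Φ.h μ k l b⁆ = - ⁅Φ.h μ k l b, Φ.e ν i j a⁆ := (lie_skew _ _).symm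
    rw [hqq, mul_smul, ← add_zero (2 * q : S), smul_apply_of_lie hs hJ _ _ _ _ _ hx hy, hsw,
      Φ.lie_diag _ _ _ _ _ _ _ _ hkl hij, map_neg, map_neg, map_zsmul, map_zsmul, hUe _ _ _ _ hij,
      smul_neg, smul_comm]
  have hhh : ∀ ν i j μ k l a b, i ≠ j → k ≠ l →
      ((q * Q : ℕ) : S) • f (Φ.h ν i j a) (Φ.h μ k l b) = U ⁅Φ.h ν i j a, Φ.h μ k l b⁆ := by
    intro ν i j μ k l a b hij hkl
    -- Expanding one diagonal element as a bracket reduces to opposite pairs, on which the two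
    -- resulting terms have opposite weights and equal coefficient products.
    have h1 : Φ.h μ k l b = ⁅Φ.e μ k l b, Φ.e μ l k 1⁆ := by rw [Φ.lie_opp _ _ _ _ _ hkl, mul_one]
    conv_lhs => rw [h1]
    rw [lie_right hs hJ, Φ.lie_diag _ _ _ _ _ _ _ _ hij hkl,
      Φ.lie_diag _ _ _ _ _ _ _ _ hij hkl.symm, map_zsmul, map_zsmul, LinearMap.smul_apply,
      smul_add, smul_comm, hee _ _ _ _ _ _ _ _ hkl hkl.symm, smul_comm,
      hee _ _ _ _ _ _ _ _ hkl hkl.symm, Φ.lie_opp _ _ _ _ _ hkl, Φ.lie_opp _ _ _ _ _ hkl,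
      Φ.lie_h_h _ _ _ _ _ _ _ _ hij hkl, map_zero,
      show X * (a * b) * 1 = b * (X * (a * 1)) by ring, ← add_smul]
    convert zero_smul ℤ _
    split_ifs <;> simp
  refine ⟨U, fun x y => sub_eq_zero.1 ?_⟩
  rw [← hB]
  refine Φ.ext_generators B (fun x y => ?_) ?_ ?_ ?_ x y
  · rw [hB, hB, hs, ← lie_skew x y, map_neg, smul_neg]; abel
  · intro ν i j μ k l a b hij hkl; rw [hB, hee _ _ _ _ _ _ _ _ hij hkl, sub_self]
  · intro ν i j μ k l a b hij hkl; rw [hB, heh _ _ _ _ _ _ _ _ hij hkl, sub_self]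
  · intro ν i j μ k l a b hij hkl; rw [hB, hhh _ _ _ _ _ _ _ _ hij hkl, sub_self]

end Frame

end Frames

end NormOne

namespace NormOne

/-! ### The absolute value of D and Teichmüller representatives -/

section AbsoluteValue

variable (p : ℕ) [Fact p.Prime] {D : Type*} [DivisionRing D] [Algebra ℚ_[p] D]
  [FiniteDimensional ℚ_[p] D]

theorem absD_neg (x : D) : absD p (-x) = absD p x := by
  have h : absD p (-1 : D) = 1 := by
    have := absD_algebraMap p (D := D) (-1)
    simpa using this
  rw [← neg_one_mul, absD_mul, h, one_mul]

theorem absD_sub_le (x y : D) : absD p (x - y) ≤ max (absD p x) (absD p y) := by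
  rw [sub_eq_add_neg, ← absD_neg p y]
  exact absD_add_le p x (-y)

theorem absD_add_lt {x y : D} {r : ℝ} (hx : absD p x < r) (hy : absD p y < r) :
    absD p (x + y) < r := (absD_add_le p x y).trans_lt (max_lt hx hy)

theorem absD_sub_lt {x y : D} {r : ℝ} (hx : absD p x < r) (hy : absD p y < r) :
    absD p (x - y) < r := (absD_sub_le p x y).trans_lt (max_lt hx hy)

theorem absD_add_eq_right {x y : D} (h : absD p x < absD p y) : absD p (x + y) = absD p y := by
  refine le_antisymm ((absD_add_le p x y).trans (max_le h.le le_rfl)) ?_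
  by_contra! h'
  have := absD_sub_lt p h' h
  rw [add_sub_cancel_left] at this
  exact lt_irrefl _ this

theorem absD_pow (x : D) (n : ℕ) : absD p (x ^ n) = absD p x ^ n := by
  induction n with
  | zero => simp [absD_one]
  | succ n ih => rw [pow_succ, absD_mul, ih, pow_succ]

theorem absD_zpow (x : D) (n : ℤ) : absD p (x ^ n) = absD p x ^ n := by
  cases n with
  | ofNat n => simp [absD_pow]
  | negSucc n => rw [zpow_negSucc, zpow_negSucc, absD_inv, absD_pow]

theorem absD_pos {x : D} (hx : x ≠ 0) : 0 < absD p x :=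
  (absD_nonneg p x).lt_of_ne fun h => hx ((absD_eq_zero_iff p x).1 h.symm)

theorem absD_natCast (n : ℕ) : absD p (n : D) = ‖(n : ℚ_[p])‖ := by
  rw [← absD_algebraMap p (D := D), map_natCast]

theorem absD_natCast_le (n : ℕ) : absD p (n : D) ≤ 1 := by
  rw [absD_natCast]
  exact_mod_cast Padic.norm_int_le_one (p := p) n

theorem absD_natCast_self : absD p (p : D) = (p : ℝ)⁻¹ := by
  rw [absD_natCast, Padic.norm_p]

theorem absD_natCast_self_lt : absD p (p : D) < 1 := by
  rw [absD_natCast]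
  exact Padic.norm_p_lt_one

theorem absD_natCast_eq_one {n : ℕ} (h : p.Coprime n) : absD p (n : D) = 1 := by
  rw [absD_natCast]
  exact Padic.norm_natCast_eq_one_iff.2 h

theorem absD_sum_le {ι : Type*} (s : Finset ι) (f : ι → D) (r : ℝ) (hr : 0 ≤ r)
    (h : ∀ i ∈ s, absD p (f i) ≤ r) : absD p (∑ i ∈ s, f i) ≤ r := by
  classical
  induction s using Finset.induction_on with
  | empty => simpa [absD_zero] using hr
  | insert a s ha ih =>
    rw [Finset.sum_insert ha]
    exact (absD_add_le p _ _).trans (max_le (h a (Finset.mem_insert_self a s))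
      (ih fun i hi => h i (Finset.mem_insert_of_mem hi)))

theorem absD_sum_lt {ι : Type*} (s : Finset ι) (f : ι → D) (r : ℝ) (hr : 0 < r)
    (h : ∀ i ∈ s, absD p (f i) < r) : absD p (∑ i ∈ s, f i) < r := by
  classical
  induction s using Finset.induction_on with
  | empty => simpa [absD_zero] using hr
  | insert a s ha ih =>
    rw [Finset.sum_insert ha]
    exact absD_add_lt p (h a (Finset.mem_insert_self a s))
      (ih fun i hi => h i (Finset.mem_insert_of_mem hi))

theorem absD_eq_one_of_pow_eq_one {x : D} {n : ℕ} (hn : n ≠ 0) (h : x ^ n = 1) :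
    absD p x = 1 := by
  have := absD_pow p x n
  rw [h, absD_one] at this
  exact (pow_eq_one_iff_of_nonneg (absD_nonneg p x) hn).1 this.symm

theorem absD_conj (x y : D) (hx : x ≠ 0) : absD p (x * y * x⁻¹) = absD p y := by
  have := (absD_pos p hx).ne'
  rw [absD_mul, absD_mul, absD_inv]
  field_simp

/-- The division algebra `D`, normed by the absolute value. -/
noncomputable abbrev normedRing : NormedRing D :=
  AbsoluteValue.toNormedRing
    { toFun := absD p
      map_mul' := absD_mul p
      nonneg' := absD_nonneg p
      eq_zero' := absD_eq_zero_iff p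
      add_le' := fun x y => (absD_add_le p x y).trans
        (max_le_add_of_nonneg (absD_nonneg p x) (absD_nonneg p y)) }

/-- The division algebra `D`, as a normed algebra over `ℚ_p`. -/
noncomputable abbrev normedAlgebra : @NormedAlgebra ℚ_[p] D _ (normedRing p).toSeminormedRing :=
  let _ := normedRing p (D := D)
  { ‹Algebra ℚ_[p] D› with
    norm_smul_le := fun a x => by
      change absD p (a • x) ≤ ‖a‖ * absD p x
      rw [Algebra.smul_def, absD_mul, absD_algebraMap] }

/-- Linear functionals are bounded. -/
theorem exists_bound (φ : D →ₗ[ℚ_[p]] ℚ_[p]) : ∃ C : ℝ, ∀ x, ‖φ x‖ ≤ C * absD p x := by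
  let _ := normedRing p (D := D)
  let _ := normedAlgebra p (D := D)
  let ψ : D →L[ℚ_[p]] ℚ_[p] := LinearMap.toContinuousLinearMap φ
  exact ⟨‖ψ‖, fun x => ψ.le_opNorm x⟩

/-- The limit of a sequence of powers. -/
theorem exists_limit (P : ℕ) (x : D) (r : ℝ) (hr : r < 1) (C : ℝ)
    (h : ∀ k, absD p (x ^ P ^ (k + 1) - x ^ P ^ k) ≤ C * r ^ k) :
    ∃ y : D, y ^ P = y ∧ ∃ k, absD p (y - x ^ P ^ k) < 1 := by
  let _ := normedRing p (D := D)
  let _ := normedAlgebra p (D := D)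
  have : CompleteSpace D := FiniteDimensional.complete ℚ_[p] D
  have hc : CauchySeq fun k => x ^ P ^ k := by
    refine cauchySeq_of_le_geometric r C hr fun k => ?_
    rw [dist_comm, dist_eq_norm]
    exact h k
  obtain ⟨y, hy⟩ := cauchySeq_tendsto_of_complete hc
  refine ⟨y, ?_, ?_⟩
  · have h1 : Filter.Tendsto (fun k => x ^ P ^ (k + 1)) Filter.atTop (nhds y) :=
      hy.comp (Filter.tendsto_add_atTop_nat 1)
    have h2 : Filter.Tendsto (fun k => (x ^ P ^ k) ^ P) Filter.atTop (nhds (y ^ P)) := hy.pow P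
    refine tendsto_nhds_unique ?_ h1
    convert h2 using 2 with k
    rw [← pow_mul, pow_succ]
  · obtain ⟨k, hk⟩ := ((Metric.tendsto_nhds.1 hy) 1 one_pos).exists
    refine ⟨k, ?_⟩
    rw [dist_comm, dist_eq_norm] at hk
    exact hk

/-- The Teichmüller representative of `x`. -/
theorem exists_teichmuller (P : ℕ) (hP : p ∣ P) (x : D) (hx : absD p x ≤ 1)
    (hxP : absD p (x ^ P - x) < 1) :
    ∃ y : D, y ^ P = y ∧ absD p (y - x) < 1 := by
  set r := max (absD p (p : D)) (absD p (x ^ P - x)) with hr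
  have hr1 : r < 1 := max_lt (absD_natCast_self_lt p) hxP
  have hr0 : 0 ≤ r := (absD_nonneg p _).trans (le_max_left _ _)
  -- Raising to the power `P` contracts distances by `r`: in `y ^ P - z ^ P = (y - z) * ∑ y ^ i * z
  -- ^ (P - 1 - i)` the sum is congruent to `P * z ^ (P - 1)` modulo `y - z`, and `p ∣ P`.
  have step : ∀ (y z : D) (s : ℝ), Commute y z → absD p y ≤ 1 → absD p z ≤ 1 →
      absD p (y - z) ≤ s → s ≤ r → absD p (y ^ P - z ^ P) ≤ s * r := by
    intro y z s hc hy hz h hs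
    have hs0 : 0 ≤ s := (absD_nonneg p _).trans h
    rw [← hc.mul_geom_sum₂, absD_mul]
    refine mul_le_mul h ?_ (absD_nonneg p _) hs0
    have e : ∑ i ∈ Finset.range P, y ^ i * z ^ (P - 1 - i) =
        ∑ i ∈ Finset.range P, (y ^ i - z ^ i) * z ^ (P - 1 - i) + P * z ^ (P - 1) := by
      rw [← nsmul_eq_mul, ← Finset.card_range P, ← Finset.sum_const, Finset.card_range,
        ← Finset.sum_add_distrib]
      refine Finset.sum_congr rfl fun i hi => ?_
      have hi := Finset.mem_range.1 hi
      rw [sub_mul, ← pow_add, show i + (P - 1 - i) = P - 1 by omega]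
      abel
    rw [e]
    have hz' : ∀ k, absD p (z ^ k) ≤ 1 := fun k => by
      rw [absD_pow]; exact pow_le_one₀ (absD_nonneg p z) hz
    refine (absD_add_le p _ _).trans (max_le (absD_sum_le p _ _ _ hr0 fun i _ => ?_) ?_)
    · rw [absD_mul, ← hc.mul_geom_sum₂, absD_mul]
      refine (mul_le_of_le_one_right (mul_nonneg (absD_nonneg p _) (absD_nonneg p _))
        (hz' _)).trans ((mul_le_of_le_one_right (absD_nonneg p _) ?_).trans (h.trans hs))
      refine absD_sum_le p _ _ _ zero_le_one fun j _ => ?_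
      rw [absD_mul]
      refine mul_le_one₀ ?_ (absD_nonneg p _) (hz' _)
      rw [absD_pow]; exact pow_le_one₀ (absD_nonneg p y) hy
    · rw [absD_mul]
      refine (mul_le_of_le_one_right (absD_nonneg p _) (hz' _)).trans ?_
      obtain ⟨m, rfl⟩ := hP
      rw [Nat.cast_mul, absD_mul]
      exact (mul_le_of_le_one_right (absD_nonneg p _) (absD_natCast_le p m)).trans (le_max_left _ _)
  have hpow : ∀ k, absD p (x ^ k) ≤ 1 := fun k => by
    rw [absD_pow]; exact pow_le_one₀ (absD_nonneg p x) hx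
  have h : ∀ k, absD p (x ^ P ^ (k + 1) - x ^ P ^ k) ≤ r * r ^ k := by
    intro k
    induction k with
    | zero =>
      rw [zero_add, pow_one, pow_zero, pow_one, pow_zero, mul_one]
      exact le_max_right _ _
    | succ k ih =>
      rw [pow_succ P (k + 1), pow_mul, pow_succ P k, pow_mul x (P ^ k) P]
      refine (step _ _ _ ?_ ?_ (hpow _) ?_ ?_).trans (le_of_eq (by ring_nf : r * r ^ k * r = _))
      · rw [← pow_mul]
        exact (Commute.refl x).pow_pow _ _
      · rw [← pow_mul]
        exact hpow _
      · rw [← pow_mul, ← pow_succ]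
        exact ih
      · exact mul_le_of_le_one_right hr0 (pow_le_one₀ hr0 hr1.le)
  obtain ⟨y, hy, k, hk⟩ := exists_limit p P x r hr1 r h
  refine ⟨y, hy, ?_⟩
  have : ∀ k, absD p (x ^ P ^ k - x) < 1 := by
    intro k
    induction k with
    | zero => simp [absD_zero]
    | succ k ih =>
      have := absD_add_lt p ((h k).trans_lt (lt_of_le_of_lt
        (mul_le_of_le_one_right hr0 (pow_le_one₀ hr0 hr1.le)) hr1)) ih
      simpa using this
  simpa using absD_add_lt p hk (this k)

end AbsoluteValue

/-- The multiplicative group of a finite division ring is cyclic. -/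
theorem exists_generator_of_finite (p : ℕ) [Fact p.Prime] {κ : Type*} [Ring κ] [Nontrivial κ]
    [Finite κ] (hu : ∀ a : κ, IsUnit a ∨ a = 0) (hp0 : (p : κ) = 0) :
    ∃ (P : ℕ) (g : κ), p ∣ P ∧ 2 ≤ P ∧ g ≠ 0 ∧ (∀ a : κ, a ^ P = a) ∧
      (∀ k, g ^ k = 1 → P - 1 ∣ k) ∧ ∀ a : κ, a ≠ 0 → ∃ k : ℕ, a = g ^ k := by
  classical
  let _ : DivisionRing κ := DivisionRing.ofIsUnitOrEqZero hu
  let _ : Field κ := littleWedderburn κ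
  let _ : Fintype κ := Fintype.ofFinite κ
  have hchar : CharP κ p := (CharP.charP_iff_prime_eq_zero Fact.out).2 hp0
  obtain ⟨g, hg⟩ := IsCyclic.exists_generator (α := κˣ)
  refine ⟨Fintype.card κ, g, ?_, Fintype.one_lt_card, g.ne_zero, FiniteField.pow_card,
    fun k hk => ?_, fun a ha => ?_⟩
  · obtain ⟨n, hn, h⟩ := FiniteField.card κ p
    rw [h]
    exact dvd_pow_self _ n.ne_zero
  · have : g ^ k = 1 := Units.ext hk
    rw [← orderOf_dvd_iff_pow_eq_one, orderOf_eq_card_of_forall_mem_zpowers hg,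
      Nat.card_eq_fintype_card, Fintype.card_units] at this
    exact this
  · obtain ⟨k, hk⟩ : Units.mk0 a ha ∈ Submonoid.powers g := mem_powers_iff_mem_zpowers.2 (hg _)
    exact ⟨k, (congrArg Units.val hk).symm⟩

/-! ### The ring of integers and its residue field -/

section Integers

variable (p : ℕ) [Fact p.Prime] (D : Type*) [DivisionRing D] [Algebra ℚ_[p] D]
  [FiniteDimensional ℚ_[p] D] [Algebra ℤ_[p] D] [IsScalarTower ℤ_[p] ℚ_[p] D]

theorem smul_eq_padic_smul (a : ℤ_[p]) (x : D) : a • x = (a : ℚ_[p]) • x :=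
  (algebraMap_smul ℚ_[p] a x).symm

theorem absD_algebraMap_int (a : ℤ_[p]) : absD p (algebraMap ℤ_[p] D a) = ‖a‖ := by
  rw [IsScalarTower.algebraMap_apply ℤ_[p] ℚ_[p] D, absD_algebraMap]
  rfl

/-- The ring of integers is a lattice. -/
instance finite_integers : Module.Finite ℤ_[p] (integers p D) := by
  let b := Module.finBasis ℚ_[p] D
  choose C hC using fun i => exists_bound p (D := D) (b.coord i)
  -- One power of `p` clears the denominators of the coordinates of all integral elements, which
  -- embeds them in a free module of finite rank over the noetherian ring `ℤ_[p]`.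
  obtain ⟨m, hm⟩ : ∃ m : ℕ, ∀ i, C i ≤ (p : ℝ) ^ m := by
    have hp : (1 : ℝ) < p := by exact_mod_cast (Fact.out : p.Prime).one_lt
    choose m hm using fun i => pow_unbounded_of_one_lt (C i) hp
    obtain ⟨M, hM⟩ := (Set.finite_range m).bddAbove
    exact ⟨M, fun i => (hm i).le.trans (pow_le_pow_right₀ hp.le (hM ⟨i, rfl⟩))⟩
  have key : ∀ (x : integers p D) i, ‖(p : ℚ_[p]) ^ m * b.coord i (x : D)‖ ≤ 1 := by
    intro x i
    have hp : (0 : ℝ) < p := by exact_mod_cast (Fact.out : p.Prime).pos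
    have h1 := (mem_integers_iff p (x : D)).1 x.2
    have h2 : ‖b.coord i (x : D)‖ ≤ (p : ℝ) ^ m := by
      refine (hC i x).trans ?_
      by_cases hCi : 0 ≤ C i
      · exact (mul_le_of_le_one_right hCi h1).trans (hm i)
      · exact (mul_nonpos_of_nonpos_of_nonneg (le_of_not_ge hCi) (absD_nonneg p _)).trans
          (by positivity)
    rw [norm_mul, norm_pow, Padic.norm_p, inv_pow]
    exact inv_mul_le_one_of_le₀ h2 (by positivity)
  let φ : integers p D →ₗ[ℤ_[p]] (Fin (Module.finrank ℚ_[p] D) → ℤ_[p]) :=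
    { toFun := fun x i => ⟨_, key x i⟩
      map_add' := fun x y => funext fun i => Subtype.ext (by
        change (p : ℚ_[p]) ^ m * b.coord i ((x : D) + y) = p ^ m * b.coord i (x : D) + p ^ m * b.coord i (y : D)
        rw [map_add, mul_add])
      map_smul' := fun a x => funext fun i => Subtype.ext (by
        change (p : ℚ_[p]) ^ m * b.coord i (a • (x : D)) = a * (p ^ m * b.coord i (x : D))
        rw [smul_eq_padic_smul, map_smul, smul_eq_mul]
        ring) }
  refine Module.Finite.of_injective φ fun x y h => Subtype.ext (b.ext_elem fun i => ?_)
  have := congrArg Subtype.val (congrFun h i)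
  have hp : (p : ℚ_[p]) ^ m ≠ 0 := pow_ne_zero _ (by exact_mod_cast (Fact.out : p.Prime).ne_zero)
  exact mul_left_cancel₀ hp this

/-- The maximal ideal of the ring of integers. -/
noncomputable def maxIdeal : Ideal (integers p D) where
  carrier := {x | absD p (x : D) < 1}
  zero_mem' := by simp [absD_zero]
  add_mem' := fun {x y} hx hy => absD_add_lt p hx hy
  smul_mem' := fun c x hx => by
    change absD p ((c : D) * x) < 1
    rw [absD_mul]
    exact mul_lt_one_of_nonneg_of_lt_one_right ((mem_integers_iff p _).1 c.2)
      (absD_nonneg p _) hx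

theorem mem_maxIdeal (x : integers p D) : x ∈ maxIdeal p D ↔ absD p (x : D) < 1 := Iff.rfl

instance : (maxIdeal p D).IsTwoSided := ⟨fun {a} b ha => by
  rw [mem_maxIdeal] at ha ⊢
  rw [MulMemClass.coe_mul, absD_mul]
  exact mul_lt_one_of_nonneg_of_lt_one_left (absD_nonneg p _) ha ((mem_integers_iff p _).1 b.2)⟩

instance : Finite (integers p D ⧸ maxIdeal p D) := by
  obtain ⟨m, b, hb⟩ := Module.Finite.exists_fin (R := ℤ_[p]) (M := integers p D)
  let g : (Fin m → Fin p) → integers p D ⧸ maxIdeal p D := fun c =>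
    Ideal.Quotient.mk _ (∑ i, (c i : ℕ) • b i)
  refine Finite.of_surjective g fun x => ?_
  obtain ⟨x, rfl⟩ := Ideal.Quotient.mk_surjective x
  have hx : x ∈ Submodule.span ℤ_[p] (Set.range b) := hb ▸ Submodule.mem_top
  obtain ⟨z, rfl⟩ := (Submodule.mem_span_range_iff_exists_fun _).1 hx
  choose c hc hz using fun i => PadicInt.exists_mem_range (z i)
  refine ⟨fun i => ⟨c i, hc i⟩, ?_⟩
  rw [Ideal.Quotient.eq, ← Finset.sum_sub_distrib]
  refine Ideal.sum_mem _ fun i _ => ?_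
  rw [← Nat.cast_smul_eq_nsmul ℤ_[p], ← sub_smul, Algebra.smul_def]
  refine Ideal.mul_mem_right _ _ ?_
  rw [mem_maxIdeal]
  change absD p (algebraMap ℤ_[p] D _) < 1
  rw [absD_algebraMap_int, ← norm_neg, neg_sub]
  exact PadicInt.mem_nonunits.1 (hz i)

/-- A root of unity generating the residue field. -/
theorem exists_rootOfUnity : ∃ (N : ℕ) (ω : D), N ≠ 0 ∧ p.Coprime N ∧ ω ^ N = 1 ∧
    (∀ k, absD p (ω ^ k - 1) < 1 → N ∣ k) ∧
    ∀ x : D, absD p x ≤ 1 → absD p x < 1 ∨ ∃ k, absD p (x - ω ^ k) < 1 := by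
  have hnt : Nontrivial (integers p D ⧸ maxIdeal p D) := Ideal.Quotient.nontrivial_iff.2 fun h => by
    have : (1 : integers p D) ∈ maxIdeal p D := h ▸ Submodule.mem_top
    rw [mem_maxIdeal, OneMemClass.coe_one, absD_one] at this
    exact lt_irrefl _ this
  have hu : ∀ a : integers p D ⧸ maxIdeal p D, IsUnit a ∨ a = 0 := by
    intro a
    obtain ⟨x, rfl⟩ := Ideal.Quotient.mk_surjective a
    by_cases hx : absD p (x : D) < 1
    · exact Or.inr (Ideal.Quotient.eq_zero_iff_mem.2 hx)
    · refine Or.inl (((isUnit_integers_iff p x).2 ?_).map (Ideal.Quotient.mk (maxIdeal p D)))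
      exact le_antisymm ((mem_integers_iff p _).1 x.2) (not_lt.1 hx)
  have hp0 : ((p : ℕ) : integers p D ⧸ maxIdeal p D) = 0 := by
    have : Ideal.Quotient.mk (maxIdeal p D) (p : integers p D) = 0 := by
      rw [Ideal.Quotient.eq_zero_iff_mem, mem_maxIdeal]
      exact_mod_cast absD_natCast_self_lt p
    rwa [map_natCast] at this
  obtain ⟨P, g, hdvd, hP, hg0, hpow, hgk, hgen⟩ := exists_generator_of_finite p hu hp0
  obtain ⟨x, rfl⟩ := Ideal.Quotient.mk_surjective g
  have mk_eq : ∀ (y z : integers p D), (Ideal.Quotient.mk (maxIdeal p D) y =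
      Ideal.Quotient.mk (maxIdeal p D) z ↔ absD p ((y : D) - z) < 1) :=
    fun y z => Ideal.Quotient.eq
  have hxP : absD p ((x : D) ^ P - x) < 1 := by
    rw [← SubmonoidClass.coe_pow, ← mk_eq, map_pow]
    exact hpow _
  obtain ⟨y, hy, hyx⟩ := exists_teichmuller p P hdvd (x : D)
    ((mem_integers_iff p _).1 x.2) hxP
  have hcard : P - 1 + 1 = P := by omega
  have hN : P - 1 ≠ 0 := by omega
  have hy0 : y ≠ 0 := by
    rintro rfl
    have h0 : Ideal.Quotient.mk (maxIdeal p D) x = 0 := by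
      rw [← map_zero (Ideal.Quotient.mk (maxIdeal p D))]
      exact ((mk_eq 0 x).2 hyx).symm
    exact hg0 h0
  have hyN : y ^ (P - 1) = 1 := by
    refine mul_right_cancel₀ hy0 ?_
    rw [← pow_succ, hcard, hy, one_mul]
  have hyi : y ∈ integers p D := by
    rw [mem_integers_iff, absD_eq_one_of_pow_eq_one p hN hyN]
  have hmy : Ideal.Quotient.mk (maxIdeal p D) ⟨y, hyi⟩ = Ideal.Quotient.mk (maxIdeal p D) x :=
    (mk_eq ⟨y, hyi⟩ x).2 hyx
  refine ⟨P - 1, y, hN, ?_, hyN, ?_, ?_⟩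
  · refine (Nat.Prime.coprime_iff_not_dvd Fact.out).2 fun h => ?_
    have := (Nat.dvd_add_right h).1 (hcard ▸ hdvd)
    exact (Fact.out : p.Prime).one_lt.ne' (Nat.dvd_one.1 this)
  · intro k hk
    refine hgk k ?_
    rw [← hmy, ← map_pow, ← map_one (Ideal.Quotient.mk (maxIdeal p D))]
    rw [mk_eq, SubmonoidClass.coe_pow, OneMemClass.coe_one]
    exact hk
  · intro z hz
    by_cases hz1 : absD p z < 1
    · exact Or.inl hz1
    right
    have hzi := (mem_integers_iff p z).2 hz
    obtain ⟨k, hk⟩ := hgen (Ideal.Quotient.mk (maxIdeal p D) ⟨z, hzi⟩)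
      fun h0 => hz1 (Ideal.Quotient.eq_zero_iff_mem.1 h0)
    rw [← hmy, ← map_pow, mk_eq, SubmonoidClass.coe_pow] at hk
    exact ⟨k, hk⟩

end Integers

end NormOne

/-! ### A uniformizer normalizing the roots of unity -/

namespace NormOne

/-- A uniformizer `ϖ` of `D` that normalizes a group of roots of unity representing the
residue field. -/
structure CyclicStructure (p : ℕ) [Fact p.Prime] (D : Type*) [DivisionRing D]
    [Algebra ℚ_[p] D] where
  N : ℕ
  [neZero : NeZero N]
  coprime : p.Coprime N
  ψ : AddChar (ZMod N) D
  sep : ∀ k, absD p (ψ k - 1) < 1 → k = 0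
  res : ∀ x : D, absD p x ≤ 1 → absD p x < 1 ∨ ∃ k, absD p (x - ψ k) < 1
  ϖ : D
  ϖ_ne_zero : ϖ ≠ 0
  absD_ϖ_lt : absD p ϖ < 1
  le_absD_ϖ : ∀ x : D, absD p x < 1 → absD p x ≤ absD p ϖ
  Q : (ZMod N)ˣ
  ϖ_mul : ∀ k, ϖ * ψ k = ψ (Q * k) * ϖ

attribute [instance] CyclicStructure.neZero

section Existence

variable (p : ℕ) [Fact p.Prime] {D : Type*} [DivisionRing D] [Algebra ℚ_[p] D]
  [FiniteDimensional ℚ_[p] D] [Algebra ℤ_[p] D] [IsScalarTower ℤ_[p] ℚ_[p] D]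

theorem absD_pow_sub_pow_lt {a b : D} (ha : absD p a ≤ 1) (hb : absD p b ≤ 1)
    (h : absD p (a - b) < 1) (k : ℕ) : absD p (a ^ k - b ^ k) < 1 := by
  induction k with
  | zero => simp [absD_zero]
  | succ k ih =>
    have e : a ^ (k + 1) - b ^ (k + 1) = a * (a ^ k - b ^ k) + (a - b) * b ^ k := by
      rw [pow_succ', pow_succ', mul_sub, sub_mul]; abel
    rw [e]
    refine absD_add_lt p ?_ ?_
    · rw [absD_mul]
      exact mul_lt_one_of_nonneg_of_lt_one_right ha (absD_nonneg p _) ih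
    · rw [absD_mul, absD_pow]
      exact mul_lt_one_of_nonneg_of_lt_one_left (absD_nonneg p _) h
        (pow_le_one₀ (absD_nonneg p b) hb)

/-- Conjugation by `π` raises residues of roots of unity to a fixed power `q`, but only modulo the
maximal ideal. Averaging `π` over the roots of unity, with the twist by `q`, makes the commutation
exact. The average is close to `N * π`, and `N` is prime to `p`, so it is still a uniformizer. -/
theorem exists_cyclicStructure (π : integers p D) (hπ : IsUniformizer π) :
    ∃ U : CyclicStructure p D, absD p U.ϖ = absD p (π : D) := by
  obtain ⟨N, ω, hN0, hN, hω, hsep, hres⟩ := exists_rootOfUnity p D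
  have : NeZero N := ⟨hN0⟩
  let ψ : AddChar (ZMod N) D :=
    { toFun := fun k => ω ^ k.val
      map_zero_eq_one' := by simp
      map_add_eq_mul' := fun a b => by
        rw [← pow_add, ZMod.val_add, ← pow_eq_pow_mod _ hω] }
  have hψ : ∀ k : ℕ, ψ (k : ZMod N) = ω ^ k := fun k => by
    change ω ^ (k : ZMod N).val = ω ^ k
    rw [ZMod.val_natCast, ← pow_eq_pow_mod _ hω]
  have habs : ∀ k, absD p (ψ k) = 1 := fun k => by
    change absD p (ω ^ k.val) = 1
    rw [absD_pow, absD_eq_one_of_pow_eq_one p hN0 hω, one_pow]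
  have hψ0 : ∀ k, ψ k ≠ 0 := fun k => by
    rw [ne_eq, ← absD_eq_zero_iff p, habs]
    exact one_ne_zero
  have hψsep : ∀ k, absD p (ψ k - 1) < 1 → k = 0 := fun k hk => by
    have := hsep k.val hk
    rw [← ZMod.natCast_zmod_val k]
    exact (ZMod.natCast_eq_zero_iff _ _).2 this
  have hψres : ∀ x, absD p x ≤ 1 → absD p x < 1 ∨ ∃ k, absD p (x - ψ k) < 1 := fun x hx => by
    rcases hres x hx with h | ⟨k, h⟩
    · exact Or.inl h
    · exact Or.inr ⟨k, by rwa [hψ]⟩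
  have hlt : ∀ x : integers p D, ¬ IsUnit x ↔ absD p (x : D) < 1 := fun x => by
    rw [isUnit_integers_iff, lt_iff_le_and_ne]
    exact ⟨fun h => ⟨(mem_integers_iff p _).1 x.2, h⟩, fun h => h.2⟩
  have hπ1 : absD p (π : D) < 1 := (hlt π).1 ((hπ π).2 dvd_rfl)
  have hle : ∀ x : D, absD p x < 1 → absD p x ≤ absD p (π : D) := by
    intro x hx
    obtain ⟨y, hy⟩ := (hπ ⟨x, (mem_integers_iff p x).2 hx.le⟩).1 ((hlt _).2 hx)
    have : x = π * y := congrArg Subtype.val hy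
    rw [this, absD_mul]
    exact mul_le_of_le_one_right (absD_nonneg p _) ((mem_integers_iff p _).1 y.2)
  have hπ0 : (π : D) ≠ 0 := by
    intro h0
    have := hle (p : D) (absD_natCast_self_lt p)
    rw [h0, absD_zero, absD_natCast_self] at this
    have hp : (0 : ℝ) < p := by exact_mod_cast (Fact.out : p.Prime).pos
    exact absurd this (not_le.2 (by positivity))
  obtain ⟨q, hq⟩ : ∃ q : ZMod N, absD p (π * ω * (π : D)⁻¹ - ψ q) < 1 := by
    have h1 : absD p (π * ω * (π : D)⁻¹) = 1 := by
      rw [absD_conj p _ _ hπ0, absD_eq_one_of_pow_eq_one p hN0 hω]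
    exact (hψres _ h1.le).resolve_left (by rw [h1]; exact lt_irrefl _)
  have hconj : ∀ k, absD p (π * ψ k * (π : D)⁻¹ - ψ (q * k)) < 1 := by
    intro k
    have h1 : absD p (π * ω * (π : D)⁻¹) = 1 := by
      rw [absD_conj p _ _ hπ0, absD_eq_one_of_pow_eq_one p hN0 hω]
    have := absD_pow_sub_pow_lt p h1.le (habs q).le hq k.val
    have hcp : ∀ n : ℕ, (π * ω * (π : D)⁻¹) ^ n = π * ω ^ n * (π : D)⁻¹ := fun n => by
      induction n with
      | zero => simp [hπ0]
      | succ n ih =>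
        rw [pow_succ, ih, pow_succ]
        simp [mul_assoc, hπ0]
    rw [hcp, ← AddChar.map_nsmul_eq_pow, nsmul_eq_mul, ZMod.natCast_zmod_val,
      mul_comm] at this
    exact this
  -- If `q * k = 0`, then the conjugate of `ψ k` is congruent to 1, hence so is `ψ k`, and `k = 0`.
  have hqu : IsUnit q := by
    rw [isUnit_iff_mem_nonZeroDivisors_of_finite, mem_nonZeroDivisors_iff_right]
    intro k hk
    have := hconj k
    rw [mul_comm, hk, AddChar.map_zero_eq_one] at this
    refine hψsep k ?_
    rw [← absD_conj p (π : D) (ψ k - 1) hπ0, mul_sub, sub_mul, mul_one, mul_inv_cancel₀ hπ0]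
    exact this
  have hNabs : absD p (N : D) = 1 := absD_natCast_eq_one p hN
  let ϖ : D := ∑ k, ψ (-(q * k)) * π * ψ k
  have hϖ : absD p (ϖ - N * π) < absD p (π : D) := by
    have : ϖ - N * π = ∑ k, ψ (-(q * k)) * (π * ψ k * (π : D)⁻¹ - ψ (q * k)) * π := by
      simp only [mul_sub, sub_mul, ← AddChar.map_add_eq_mul, neg_add_cancel,
        AddChar.map_zero_eq_one, Finset.sum_sub_distrib, Finset.sum_const, Finset.card_univ,
        ZMod.card, one_mul, nsmul_eq_mul, ϖ]
      congr 1
      refine Finset.sum_congr rfl fun k _ => ?_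
      rw [mul_assoc, mul_assoc, mul_assoc, inv_mul_cancel₀ hπ0, mul_one]
    rw [this]
    refine absD_sum_lt p _ _ _ (absD_pos p hπ0) fun k _ => ?_
    rw [absD_mul, absD_mul, habs, one_mul]
    exact mul_lt_of_lt_one_left (absD_pos p hπ0) (hconj k)
  have hϖabs : absD p ϖ = absD p (π : D) := by
    have h2 : absD p (N * π : D) = absD p (π : D) := by rw [absD_mul, hNabs, one_mul]
    have := absD_add_eq_right p (hϖ.trans_eq h2.symm)
    rwa [sub_add_cancel, h2] at this
  obtain ⟨Q, hQ⟩ := hqu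
  exact ⟨{  N := N
            coprime := hN
            ψ := ψ
            sep := hψsep
            res := hψres
            ϖ := ϖ
            ϖ_ne_zero := by
              rw [ne_eq, ← absD_eq_zero_iff p, hϖabs, absD_eq_zero_iff p]
              exact hπ0
            absD_ϖ_lt := hϖabs ▸ hπ1
            le_absD_ϖ := fun x hx => hϖabs ▸ hle x hx
            Q := Q
            ϖ_mul := fun l => by
              rw [hQ, Finset.sum_mul, Finset.mul_sum, ← Equiv.sum_comp (Equiv.subRight l)]
              refine Finset.sum_congr rfl fun k _ => ?_
              rw [Equiv.subRight_apply, mul_assoc, ← AddChar.map_add_eq_mul, sub_add_cancel,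
                ← mul_assoc, ← mul_assoc, ← AddChar.map_add_eq_mul]
              congr 3
              ring }, hϖabs⟩

end Existence

/-! ### Expansion in powers of the uniformizer -/

namespace CyclicStructure

variable {p : ℕ} [Fact p.Prime] {D : Type*} [DivisionRing D] [Algebra ℚ_[p] D]
  [FiniteDimensional ℚ_[p] D] (U : CyclicStructure p D)

/-- The order of conjugation by `ϖ`. -/
noncomputable def d : ℕ := orderOf U.Q

/-- The uniformizer `ϖ ^ d` of the center. -/
noncomputable def τ : D := U.ϖ ^ U.d

theorem d_pos : 0 < U.d := orderOf_pos U.Q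

instance : NeZero U.d := ⟨U.d_pos.ne'⟩

theorem τ_ne_zero : U.τ ≠ 0 := pow_ne_zero _ U.ϖ_ne_zero

theorem absD_τ_lt : absD p U.τ < 1 := by
  rw [τ, absD_pow]
  exact pow_lt_one₀ (absD_nonneg p _) U.absD_ϖ_lt U.d_pos.ne'

theorem absD_τ_pos : 0 < absD p U.τ := absD_pos p U.τ_ne_zero

theorem absD_ϖ_pos : 0 < absD p U.ϖ := absD_pos p U.ϖ_ne_zero

theorem ψ_pow (k : ZMod U.N) : U.ψ k ^ U.N = 1 := by
  rw [← AddChar.map_nsmul_eq_pow]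
  simp

theorem absD_ψ (k : ZMod U.N) : absD p (U.ψ k) = 1 :=
  absD_eq_one_of_pow_eq_one p (NeZero.ne U.N) (U.ψ_pow k)

theorem ψ_ne_zero (k : ZMod U.N) : U.ψ k ≠ 0 := by
  rw [ne_eq, ← absD_eq_zero_iff p, absD_ψ]
  exact one_ne_zero

theorem ψ_comm (k l : ZMod U.N) : U.ψ k * U.ψ l = U.ψ l * U.ψ k := by
  rw [← AddChar.map_add_eq_mul, add_comm, AddChar.map_add_eq_mul]

theorem eq_of_absD_sub_lt {k l : ZMod U.N} (h : absD p (U.ψ k - U.ψ l) < 1) : k = l := by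
  rw [← sub_eq_zero]
  refine U.sep _ ?_
  have e : U.ψ (k - l) - 1 = (U.ψ k - U.ψ l) * U.ψ (-l) := by
    rw [sub_mul, ← AddChar.map_add_eq_mul, ← AddChar.map_add_eq_mul, add_neg_cancel,
      AddChar.map_zero_eq_one, ← sub_eq_add_neg]
  rwa [e, absD_mul, absD_ψ, mul_one]

theorem ϖ_pow_mul (n : ℕ) (k : ZMod U.N) :
    U.ϖ ^ n * U.ψ k = U.ψ ((U.Q ^ n : (ZMod U.N)ˣ) * k) * U.ϖ ^ n := by
  induction n generalizing k with
  | zero => simp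
  | succ n ih =>
    rw [pow_succ, mul_assoc, ϖ_mul, ← mul_assoc, ih, mul_assoc, pow_succ, Units.val_mul, mul_assoc]

theorem ϖ_zpow_mul (n : ℤ) (k : ZMod U.N) :
    U.ϖ ^ n * U.ψ k = U.ψ ((U.Q ^ n : (ZMod U.N)ˣ) * k) * U.ϖ ^ n := by
  cases n with
  | ofNat n =>
    rw [Int.ofNat_eq_natCast, zpow_natCast, zpow_natCast]
    exact U.ϖ_pow_mul n k
  | negSucc n =>
    have h := U.ϖ_pow_mul (n + 1) (((U.Q ^ (n + 1))⁻¹ : (ZMod U.N)ˣ) * k)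
    rw [Units.mul_inv_cancel_left] at h
    rw [zpow_negSucc, zpow_negSucc, inv_mul_eq_iff_eq_mul₀ (pow_ne_zero _ U.ϖ_ne_zero),
      ← mul_assoc, h, mul_assoc, mul_inv_cancel₀ (pow_ne_zero _ U.ϖ_ne_zero), mul_one]

theorem τ_mul_ψ (k : ZMod U.N) : U.τ * U.ψ k = U.ψ k * U.τ := by
  rw [τ, ϖ_pow_mul, d, pow_orderOf_eq_one, Units.val_one, one_mul]

/-- No value lies strictly between `|ϖ|` and 1, so `|ϖ|` generates the value group. -/
theorem exists_zpow {x : D} (hx : x ≠ 0) : ∃ n : ℤ, absD p x = absD p U.ϖ ^ n := by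
  obtain ⟨n, h1, h2⟩ := exists_mem_Ico_zpow (y := (absD p U.ϖ)⁻¹)
    (inv_pos.2 (absD_pos p hx)) ((one_lt_inv₀ U.absD_ϖ_pos).2 U.absD_ϖ_lt)
  rw [inv_zpow, inv_le_inv₀ (zpow_pos U.absD_ϖ_pos _) (absD_pos p hx)] at h1
  rw [inv_zpow, inv_lt_inv₀ (absD_pos p hx) (zpow_pos U.absD_ϖ_pos _)] at h2
  refine ⟨n, le_antisymm h1 ?_⟩
  by_contra! h3
  have hpos := zpow_pos U.absD_ϖ_pos n
  have h4 : absD p (x * U.ϖ ^ (-n)) < 1 := by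
    rw [absD_mul, absD_zpow, zpow_neg, ← div_eq_mul_inv, div_lt_one hpos]
    exact h3
  have h5 := U.le_absD_ϖ _ h4
  rw [absD_mul, absD_zpow, zpow_neg, ← div_eq_mul_inv, div_le_iff₀ hpos,
    ← zpow_one_add₀ U.absD_ϖ_pos.ne', add_comm] at h5
  exact absurd h2 (not_lt.2 h5)

/-- The unit `x * ϖ ^ (-n)` is congruent to a root of unity, so conjugation by it fixes the residues
of the roots of unity, and these determine the roots of unity. Thus the way `x` normalizes them is
dictated by its valuation. -/
theorem eq_zpow_of_mul {x : D} {j : ZMod U.N}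
    (h : ∀ k, x * U.ψ k = U.ψ (j * k) * x) {n : ℤ} (hn : absD p x = absD p U.ϖ ^ n) :
    j = (U.Q ^ n : (ZMod U.N)ˣ) := by
  obtain ⟨u, hu⟩ : ∃ u, u = x * U.ϖ ^ (-n) := ⟨_, rfl⟩
  have hu1 : absD p u = 1 := by
    rw [hu, absD_mul, absD_zpow, hn, ← zpow_add₀ U.absD_ϖ_pos.ne', add_neg_cancel, zpow_zero]
  have huk : ∀ k, u * U.ψ k = U.ψ (j * (U.Q ^ (-n) : (ZMod U.N)ˣ) * k) * u := fun k => by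
    rw [hu, mul_assoc, ϖ_zpow_mul, ← mul_assoc, h, mul_assoc, mul_assoc]
  obtain ⟨m, hm⟩ := (U.res u hu1.le).resolve_left (by rw [hu1]; exact lt_irrefl _)
  have h1 := huk 1
  have h2 : absD p (U.ψ (j * (U.Q ^ (-n) : (ZMod U.N)ˣ) * 1) - U.ψ 1) < 1 := by
    have e : U.ψ (j * (U.Q ^ (-n) : (ZMod U.N)ˣ) * 1) - U.ψ 1 =
        ((u - U.ψ m) * U.ψ 1 - U.ψ 1 * (u - U.ψ m)) * u⁻¹ := by
      have hu0 : u ≠ 0 := by rw [ne_eq, ← absD_eq_zero_iff p, hu1]; exact one_ne_zero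
      rw [eq_mul_inv_iff_mul_eq₀ hu0, sub_mul, sub_mul, mul_sub, h1, ψ_comm]
      abel
    rw [e, absD_mul, absD_inv, hu1, inv_one, mul_one]
    refine absD_sub_lt p ?_ ?_ <;> rw [absD_mul, absD_ψ] <;> simpa using hm
  have h3 := U.eq_of_absD_sub_lt h2
  rw [mul_one, zpow_neg] at h3
  have := congrArg (· * ((U.Q ^ n : (ZMod U.N)ˣ) : ZMod U.N)) h3
  simpa using this

theorem absD_N : absD p (U.N : D) = 1 := absD_natCast_eq_one p U.coprime

theorem N_ne_zero : (U.N : D) ≠ 0 := by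
  rw [ne_eq, ← absD_eq_zero_iff p, absD_N]
  exact one_ne_zero

/-- The component of `x` on which conjugation by roots of unity acts through `j`. -/
noncomputable def proj (j : ZMod U.N) (x : D) : D :=
  (U.N : D)⁻¹ * ∑ k, U.ψ (-(j * k)) * x * U.ψ k

theorem natCast_inv_mul_comm (n : ℕ) (x : D) : (n : D)⁻¹ * x = x * (n : D)⁻¹ :=
  ((Nat.cast_commute n x).inv_left₀).eq

theorem absD_proj_le (j : ZMod U.N) (x : D) : absD p (U.proj j x) ≤ absD p x := by
  rw [proj, absD_mul, absD_inv, absD_N, inv_one, one_mul]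
  refine absD_sum_le p _ _ _ (absD_nonneg p x) fun k _ => ?_
  rw [absD_mul, absD_mul, absD_ψ, absD_ψ, one_mul, mul_one]

theorem proj_mul_ψ (j : ZMod U.N) (x : D) (l : ZMod U.N) :
    U.proj j x * U.ψ l = U.ψ (j * l) * U.proj j x := by
  rw [proj, ← mul_assoc, ← natCast_inv_mul_comm, mul_assoc, mul_assoc]
  congr 1
  rw [Finset.sum_mul, Finset.mul_sum, ← Equiv.sum_comp (Equiv.subRight l)]
  refine Finset.sum_congr rfl fun k _ => ?_
  rw [Equiv.subRight_apply, mul_assoc, ← AddChar.map_add_eq_mul, sub_add_cancel,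
    ← mul_assoc, ← mul_assoc, ← AddChar.map_add_eq_mul]
  congr 3
  ring

theorem sum_ψ (k : ZMod U.N) : ∑ j, U.ψ (j * k) = if k = 0 then (U.N : D) else 0 := by
  split_ifs with h
  · simp [h]
  · have h1 : U.ψ k * ∑ j, U.ψ (j * k) = ∑ j, U.ψ (j * k) := by
      rw [Finset.mul_sum]
      conv_rhs => rw [← Equiv.sum_comp (Equiv.addRight (1 : ZMod U.N))]
      refine Finset.sum_congr rfl fun j _ => ?_
      rw [← AddChar.map_add_eq_mul, Equiv.coe_addRight]
      congr 1
      ring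
    have h2 : (U.ψ k - 1) * ∑ j, U.ψ (j * k) = 0 := by rw [sub_mul, h1, one_mul, sub_self]
    refine (mul_eq_zero.1 h2).resolve_left fun h0 => h (U.sep k ?_)
    rw [h0, absD_zero]
    exact one_pos

theorem sum_proj (x : D) : ∑ j, U.proj j x = x := by
  simp only [proj]
  rw [← Finset.mul_sum, Finset.sum_comm]
  have : ∀ k, ∑ j, U.ψ (-(j * k)) * x * U.ψ k = if k = 0 then U.N * x else 0 := by
    intro k
    rw [← Finset.sum_mul, ← Finset.sum_mul]
    simp only [← mul_neg]
    rw [sum_ψ]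
    simp only [neg_eq_zero]
    split_ifs with h
    · simp [h]
    · simp
  rw [Finset.sum_congr rfl fun k _ => this k, Finset.sum_ite_eq' _ _ _]
  simp [U.N_ne_zero]

theorem proj_eq_self {j : ZMod U.N} {x : D} (h : ∀ k, x * U.ψ k = U.ψ (j * k) * x) :
    U.proj j x = x := by
  have : ∀ k, U.ψ (-(j * k)) * x * U.ψ k = x := fun k => by
    rw [mul_assoc, h, ← mul_assoc, ← AddChar.map_add_eq_mul, neg_add_cancel,
      AddChar.map_zero_eq_one, one_mul]
  rw [proj, Finset.sum_congr rfl fun k _ => this k]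
  simp [U.N_ne_zero]

/-- A nonzero component of index `j` has some valuation `n`, which forces `j = Q ^ n`; the other
components vanish. -/
theorem sum_proj_pow (x : D) :
    ∑ i ∈ Finset.range U.d, U.proj (U.Q ^ i : (ZMod U.N)ˣ) x = x := by
  classical
  conv_rhs => rw [← U.sum_proj x]
  have hinj : Set.InjOn (fun i => ((U.Q ^ i : (ZMod U.N)ˣ) : ZMod U.N))
      (Finset.range U.d : Set ℕ) := by
    intro i hi j hj hij
    exact pow_injOn_Iio_orderOf (by simpa [d] using hi) (by simpa [d] using hj) (Units.ext hij)
  rw [← Finset.sum_image (f := fun j => U.proj j x) hinj]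
  refine Finset.sum_subset (Finset.subset_univ _) fun j _ hj => ?_
  by_contra h0
  obtain ⟨n, hn⟩ := U.exists_zpow h0
  have h1 := U.eq_zpow_of_mul (U.proj_mul_ψ j x) hn
  apply hj
  rw [Finset.mem_image]
  have hd : (0 : ℤ) < U.d := by exact_mod_cast U.d_pos
  refine ⟨(n % U.d).toNat, ?_, ?_⟩
  · rw [Finset.mem_range]
    have := Int.emod_lt_of_pos n hd
    have := Int.emod_nonneg n hd.ne'
    omega
  · rw [h1, ← zpow_natCast, Int.toNat_of_nonneg (Int.emod_nonneg n hd.ne'), d, zpow_mod_orderOf]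

/-- The elements that commute with the roots of unity. -/
def Unram (x : D) : Prop := ∀ k, x * U.ψ k = U.ψ k * x

/-- The coefficient of `ϖ ^ i` in the expansion of `x`. -/
noncomputable def coeff (i : ℕ) (x : D) : D := U.proj (U.Q ^ i : (ZMod U.N)ˣ) x * (U.ϖ ^ i)⁻¹

theorem unram_coeff (i : ℕ) (x : D) : U.Unram (U.coeff i x) := by
  intro k
  have h := U.ϖ_zpow_mul (-i) k
  rw [zpow_neg, zpow_natCast] at h
  rw [coeff, mul_assoc, h, ← mul_assoc, proj_mul_ψ, zpow_neg, zpow_natCast,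
    Units.mul_inv_cancel_left, mul_assoc]

theorem sum_coeff (x : D) : ∑ i ∈ Finset.range U.d, U.coeff i x * U.ϖ ^ i = x := by
  conv_rhs => rw [← U.sum_proj_pow x]
  refine Finset.sum_congr rfl fun i _ => ?_
  rw [coeff, mul_assoc, inv_mul_cancel₀ (pow_ne_zero _ U.ϖ_ne_zero), mul_one]

variable {U}

/-- Commuting with the roots of unity is the index `j = 1`, so the valuation `n` satisfies `Q ^ n =
1` and is a multiple of `d`. -/
theorem Unram.absD_eq {x : D} (h : U.Unram x) (hx : x ≠ 0) :
    ∃ n : ℤ, absD p x = absD p U.τ ^ n := by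
  obtain ⟨n, hn⟩ := U.exists_zpow hx
  have := U.eq_zpow_of_mul (j := 1) (fun k => by rw [one_mul]; exact h k) hn
  obtain ⟨m, rfl⟩ := orderOf_dvd_iff_zpow_eq_one.2 (Units.ext this.symm : U.Q ^ n = 1)
  exact ⟨m, by rw [hn, τ, absD_pow, zpow_mul, zpow_natCast]; rfl⟩

/-- A bound on an element commuting with the roots of unity can be rounded to the next power of
`|τ|`, as its value is such a power. -/
theorem Unram.absD_le {x : D} (h : U.Unram x) {r : ℝ} {n : ℤ} (hr : absD p x ≤ r)
    (hn : r < absD p U.τ ^ (n - 1)) : absD p x ≤ absD p U.τ ^ n := by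
  by_cases hx : x = 0
  · rw [hx, absD_zero]
    exact (zpow_pos U.absD_τ_pos n).le
  obtain ⟨m, hm⟩ := h.absD_eq hx
  rw [hm] at hr ⊢
  have := hr.trans_lt hn
  rw [zpow_lt_zpow_iff_right_of_lt_one₀ U.absD_τ_pos U.absD_τ_lt] at this
  rw [zpow_le_zpow_iff_right_of_lt_one₀ U.absD_τ_pos U.absD_τ_lt]
  omega

theorem unram_ψ (k) : U.Unram (U.ψ k) := fun l => U.ψ_comm k l

theorem unram_τ : U.Unram U.τ := U.τ_mul_ψ

theorem Unram.add {x y : D} (hx : U.Unram x) (hy : U.Unram y) : U.Unram (x + y) := fun k => by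
  rw [add_mul, mul_add, hx, hy]

theorem Unram.neg {x : D} (hx : U.Unram x) : U.Unram (-x) := fun k => by
  rw [neg_mul, mul_neg, hx]

theorem Unram.sub {x y : D} (hx : U.Unram x) (hy : U.Unram y) : U.Unram (x - y) := by
  rw [sub_eq_add_neg]
  exact hx.add hy.neg

theorem Unram.mul {x y : D} (hx : U.Unram x) (hy : U.Unram y) : U.Unram (x * y) := fun k => by
  rw [mul_assoc, hy, ← mul_assoc, hx, mul_assoc]

theorem Unram.inv {x : D} (hx : U.Unram x) : U.Unram x⁻¹ := fun k =>
  (show Commute x (U.ψ k) from hx k).inv_left₀.eq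

theorem unram_one : U.Unram 1 := fun k => by rw [one_mul, mul_one]

theorem Unram.pow {x : D} (hx : U.Unram x) (n : ℕ) : U.Unram (x ^ n) := by
  induction n with
  | zero => rw [pow_zero]; exact unram_one
  | succ n ih => rw [pow_succ]; exact ih.mul hx

/-- Digits: an integral element commuting with the roots of unity is congruent to zero or to one of
them. -/
theorem Unram.exists_digit {x : D} (hx : U.Unram x) (h1 : absD p x ≤ 1) :
    ∃ t y, (t = 0 ∨ ∃ k, t = U.ψ k) ∧ U.Unram y ∧ absD p y ≤ 1 ∧ x = t + U.τ * y := by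
  obtain ⟨t, ht, htx⟩ : ∃ t, (t = 0 ∨ ∃ k, t = U.ψ k) ∧ absD p (x - t) < 1 := by
    rcases U.res x h1 with h | ⟨k, h⟩
    · exact ⟨0, Or.inl rfl, by rwa [sub_zero]⟩
    · exact ⟨_, Or.inr ⟨k, rfl⟩, h⟩
  have htu : U.Unram t := by
    rcases ht with rfl | ⟨k, rfl⟩
    · intro k; simp
    · exact unram_ψ k
  refine ⟨t, U.τ⁻¹ * (x - t), ht, unram_τ.inv.mul (hx.sub htu), ?_, ?_⟩
  · have := (hx.sub htu).absD_le (n := 1) le_rfl (by simpa using htx)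
    rw [zpow_one] at this
    rw [absD_mul, absD_inv]
    exact inv_mul_le_one_of_le₀ this (absD_nonneg p _)
  · rw [mul_inv_cancel_left₀ U.τ_ne_zero]; abel

end CyclicStructure

end NormOne

/-! ### The integers of the maximal unramified subfield -/

namespace NormOne

namespace CyclicStructure

open Polynomial

variable {p : ℕ} [Fact p.Prime] {D : Type*} [DivisionRing D] [Algebra ℚ_[p] D]
  [FiniteDimensional ℚ_[p] D] [Algebra ℤ_[p] D] [IsScalarTower ℤ_[p] ℚ_[p] D]
  (U : CyclicStructure p D)

theorem unram_algebraMap_int (a : ℤ_[p]) : U.Unram (algebraMap ℤ_[p] D a) := fun _ =>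
  Algebra.commutes a _

/-- The integral elements that commute with the roots of unity. -/
noncomputable def unramIntegers : Subalgebra ℤ_[p] D where
  carrier := {x | U.Unram x ∧ absD p x ≤ 1}
  mul_mem' := fun hx hy => ⟨hx.1.mul hy.1, by
    rw [absD_mul]; exact mul_le_one₀ hx.2 (absD_nonneg p _) hy.2⟩
  add_mem' := fun hx hy => ⟨hx.1.add hy.1, (absD_add_le p _ _).trans (max_le hx.2 hy.2)⟩
  algebraMap_mem' := fun a => ⟨U.unram_algebraMap_int a, by
    rw [absD_algebraMap_int]; exact PadicInt.norm_le_one a⟩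

instance : Module.Finite ℤ_[p] U.unramIntegers := by
  have h1 : Module.Finite ℤ_[p] (Subalgebra.toSubmodule (integers p D)) := finite_integers p D
  have h2 : IsNoetherian ℤ_[p] (Subalgebra.toSubmodule (integers p D)) :=
    isNoetherian_of_isNoetherianRing_of_finite _ _
  have h3 : Subalgebra.toSubmodule U.unramIntegers ≤ Subalgebra.toSubmodule (integers p D) :=
    fun x hx => (mem_integers_iff p x).2 hx.2
  exact Module.Finite.of_injective _ (Submodule.inclusion_injective h3)

variable {U}

theorem natCast_prime_ne_zero : (p : D) ≠ 0 := by
  rw [ne_eq, ← absD_eq_zero_iff p, absD_natCast_self]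
  exact inv_ne_zero (Nat.cast_ne_zero.2 (Fact.out : p.Prime).ne_zero)

theorem mem_unramIntegers {x : D} : x ∈ U.unramIntegers ↔ U.Unram x ∧ absD p x ≤ 1 := Iff.rfl

/-- Expanding in digits up to a power of `τ` divisible by `p` shows that roots of unity and `τ`
generate modulo `p`; Nakayama's lemma concludes, the module being finite over `ℤ_[p]`. -/
theorem Unram.mem_adjoin {x : D} (hx : U.Unram x) (h1 : absD p x ≤ 1) :
    x ∈ Algebra.adjoin ℤ_[p] {U.ψ 1, U.τ} := by
  set A := Algebra.adjoin ℤ_[p] {U.ψ 1, U.τ} with hA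
  have hτA : U.τ ∈ A := Algebra.subset_adjoin (by simp)
  have hψA : ∀ k, U.ψ k ∈ A := fun k => by
    have : U.ψ k = U.ψ 1 ^ k.val := by
      rw [← AddChar.map_nsmul_eq_pow, nsmul_eq_mul, mul_one, ZMod.natCast_zmod_val]
    rw [this]
    exact pow_mem (Algebra.subset_adjoin (by simp)) _
  have key : ∀ (m : ℕ) (x : D), U.Unram x → absD p x ≤ 1 →
      ∃ r ∈ A, ∃ y, U.Unram y ∧ absD p y ≤ 1 ∧ x = r + U.τ ^ m * y := by
    intro m
    induction m with
    | zero => exact fun x hx h => ⟨0, zero_mem _, x, hx, h, by simp⟩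
    | succ m ih =>
      intro x hx h
      obtain ⟨r, hr, y, hy, hy1, rfl⟩ := ih x hx h
      obtain ⟨t, z, ht, hz, hz1, rfl⟩ := hy.exists_digit hy1
      refine ⟨r + U.τ ^ m * t, add_mem hr (mul_mem (pow_mem hτA m) ?_), z, hz, hz1, ?_⟩
      · rcases ht with rfl | ⟨k, rfl⟩
        · exact zero_mem _
        · exact hψA k
      · rw [mul_add, pow_succ, mul_assoc, add_assoc]
  obtain ⟨m, hm⟩ := exists_pow_lt_of_lt_one (absD_pos p (x := (p : D)) natCast_prime_ne_zero) U.absD_τ_lt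
  have hfg : (Subalgebra.toSubmodule U.unramIntegers).FG :=
    Module.Finite.iff_fg.1 (inferInstanceAs (Module.Finite ℤ_[p] U.unramIntegers))
  have hle : Subalgebra.toSubmodule U.unramIntegers ≤ Subalgebra.toSubmodule A := by
    refine Submodule.le_of_le_smul_of_le_jacobson_bot (I := IsLocalRing.maximalIdeal ℤ_[p]) hfg
      (IsLocalRing.jacobson_eq_maximalIdeal ⊥ bot_ne_top).ge fun y hy => ?_
    obtain ⟨r, hr, z, hz, hz1, rfl⟩ := key m y hy.1 hy.2
    refine Submodule.add_mem_sup hr ?_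
    have hp0 : (p : D) ≠ 0 := natCast_prime_ne_zero
    have e : U.τ ^ m * z = (p : ℤ_[p]) • ((p : D)⁻¹ * (U.τ ^ m * z)) := by
      rw [Algebra.smul_def, map_natCast, mul_inv_cancel_left₀ hp0]
    rw [e]
    refine Submodule.smul_mem_smul ?_ ⟨?_, ?_⟩
    · rw [PadicInt.maximalIdeal_eq_span_p]
      exact Ideal.mem_span_singleton_self _
    · refine Unram.mul (Unram.inv ?_) ((unram_τ.pow m).mul hz)
      exact fun k => Nat.cast_commute p _
    · rw [absD_mul, absD_mul, absD_inv, absD_pow]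
      refine inv_mul_le_one_of_le₀ ?_ (absD_nonneg p _)
      exact (mul_le_of_le_one_right (pow_nonneg (absD_nonneg p _) _) hz1).trans hm.le
  exact hle ⟨hx, h1⟩

theorem exists_natCast_mul_integral (x : D) : ∃ m : ℕ, absD p ((p : D) ^ m * x) ≤ 1 := by
  obtain ⟨m, hm⟩ := pow_unbounded_of_one_lt (absD p x)
    (show (1 : ℝ) < p by exact_mod_cast (Fact.out : p.Prime).one_lt)
  refine ⟨m, ?_⟩
  have : (0 : ℝ) < p := by exact_mod_cast (Fact.out : p.Prime).pos
  rw [absD_mul, absD_pow, absD_natCast_self, inv_pow]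
  exact inv_mul_le_one_of_le₀ hm.le (by positivity)

/-- After multiplication by a power of `p`, both elements lie in an algebra generated by the two
commuting elements `ψ 1` and `τ`. -/
theorem Unram.comm {x y : D} (hx : U.Unram x) (hy : U.Unram y) : x * y = y * x := by
  have hpc : ∀ (m : ℕ) (z : D), Commute ((p : D) ^ m) z := fun m z =>
    (Nat.cast_commute p z).pow_left m
  have hpu : ∀ m, U.Unram ((p : D) ^ m) := fun m k => hpc m _
  have key : ∀ y : D, y ∈ Algebra.adjoin ℤ_[p] {U.ψ 1, U.τ} →
      ∀ x ∈ Algebra.adjoin ℤ_[p] {U.ψ 1, U.τ}, x * y = y * x := by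
    have h1 : ∀ z ∈ ({U.ψ 1, U.τ} : Set D), ∀ y ∈ Algebra.adjoin ℤ_[p] {U.ψ 1, U.τ},
        z * y = y * z := by
      intro z hz y hy
      have : Algebra.adjoin ℤ_[p] {U.ψ 1, U.τ} ≤ Subalgebra.centralizer ℤ_[p] {z} := by
        refine Algebra.adjoin_le fun g hg => ?_
        rw [SetLike.mem_coe, Subalgebra.mem_centralizer_iff]
        rintro _ rfl
        simp only [Set.mem_insert_iff, Set.mem_singleton_iff] at hg hz
        rcases hz with rfl | rfl <;> rcases hg with rfl | rfl
        · rfl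
        · exact (U.τ_mul_ψ 1).symm
        · exact U.τ_mul_ψ 1
        · rfl
      exact (Subalgebra.mem_centralizer_iff _).1 (this hy) z rfl
    intro y hy x hx
    have : Algebra.adjoin ℤ_[p] {U.ψ 1, U.τ} ≤ Subalgebra.centralizer ℤ_[p] {y} := by
      refine Algebra.adjoin_le fun g hg => ?_
      rw [SetLike.mem_coe, Subalgebra.mem_centralizer_iff]
      rintro _ rfl
      exact (h1 g hg _ hy).symm
    exact ((Subalgebra.mem_centralizer_iff _).1 (this hx) y rfl).symm
  obtain ⟨m, hm⟩ := exists_natCast_mul_integral (p := p) x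
  obtain ⟨n, hn⟩ := exists_natCast_mul_integral (p := p) y
  have h := key _ (((hpu n).mul hy).mem_adjoin hn) _ (((hpu m).mul hx).mem_adjoin hm)
  have h2 : (p : D) ^ m * (p : D) ^ n * (x * y) = (p : D) ^ m * (p : D) ^ n * (y * x) := by
    rw [mul_assoc, ← mul_assoc _ x, (hpc n x).eq, mul_assoc, ← mul_assoc ((p : D) ^ m), h,
      mul_assoc, ← mul_assoc y, ← (hpc m y).eq, mul_assoc, ← mul_assoc, ← mul_assoc,
      ← mul_assoc, ← pow_add, ← pow_add, add_comm n m]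
  exact mul_left_cancel₀ (mul_ne_zero (pow_ne_zero _ natCast_prime_ne_zero)
    (pow_ne_zero _ natCast_prime_ne_zero)) h2

variable (U)

/-- The powers of `ϖ` and the elements commuting with the roots of unity span `D`, and `τ` commutes
with both. -/
theorem τ_comm (x : D) : U.τ * x = x * U.τ := by
  rw [← U.sum_coeff x, Finset.mul_sum, Finset.sum_mul]
  refine Finset.sum_congr rfl fun i _ => ?_
  rw [← mul_assoc, unram_τ.comm (U.unram_coeff i x), mul_assoc, mul_assoc]
  congr 1
  exact ((Commute.refl U.ϖ).pow_pow _ _).eq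

noncomputable instance : CommRing U.unramIntegers :=
  { U.unramIntegers.toRing with
    mul_comm := fun x y => Subtype.ext (x.2.1.comm y.2.1) }

/-- The roots of unity, as integral elements. -/
noncomputable def ψC (k : ZMod U.N) : U.unramIntegers :=
  ⟨U.ψ k, unram_ψ k, (U.absD_ψ k).le⟩

/-- The uniformizer of the center, as an integral element. -/
noncomputable def τC : U.unramIntegers := ⟨U.τ, unram_τ, U.absD_τ_lt.le⟩

/-- Evaluation of polynomials in two variables at a root of unity and at `τ`. -/
noncomputable def ev : ℤ_[p][X][X] →+* U.unramIntegers :=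
  eval₂RingHom (aeval (U.ψC 1)).toRingHom U.τC

theorem ev_X : U.ev X = U.τC := eval₂_X _ _

theorem ev_C_X : U.ev (C X) = U.ψC 1 := by
  rw [ev, coe_eval₂RingHom, eval₂_C]
  exact aeval_X _

theorem ev_C_C (a : ℤ_[p]) : U.ev (C (C a)) = algebraMap ℤ_[p] U.unramIntegers a := by
  rw [ev, coe_eval₂RingHom, eval₂_C]
  exact aeval_C _ _

theorem ψC_eq_pow (k : ZMod U.N) : U.ψC k = U.ψC 1 ^ k.val := by
  apply Subtype.ext
  change U.ψ k = U.ψ 1 ^ k.val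
  rw [← AddChar.map_nsmul_eq_pow, nsmul_eq_mul, mul_one, ZMod.natCast_zmod_val]

theorem ev_surjective : Function.Surjective U.ev := by
  rintro ⟨x, hx⟩
  have h : ∀ x ∈ Algebra.adjoin ℤ_[p] {U.ψ 1, U.τ}, ∃ V, (U.ev V : D) = x := by
    intro x hx
    induction hx using Algebra.adjoin_induction with
    | mem x hx =>
      simp only [Set.mem_insert_iff, Set.mem_singleton_iff] at hx
      rcases hx with rfl | rfl
      · exact ⟨C X, by rw [ev_C_X]; rfl⟩
      · exact ⟨X, by rw [ev_X]; rfl⟩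
    | algebraMap a => exact ⟨C (C a), by rw [ev_C_C]; rfl⟩
    | add x y _ _ hx hy =>
      obtain ⟨V, rfl⟩ := hx
      obtain ⟨V', rfl⟩ := hy
      exact ⟨V + V', by rw [map_add]; rfl⟩
    | mul x y _ _ hx hy =>
      obtain ⟨V, rfl⟩ := hx
      obtain ⟨V', rfl⟩ := hy
      exact ⟨V * V', by rw [map_mul]; rfl⟩
  obtain ⟨V, hV⟩ := h x (hx.1.mem_adjoin hx.2)
  exact ⟨V, Subtype.ext hV⟩

/-! ### The equation of τ and its different -/

section Eisenstein

theorem X_mul_derivative_monomial {R : Type*} [CommRing R] (a : R) (l : ℕ) :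
    X * derivative (C a * X ^ l) = (l : R[X]) * (C a * X ^ l) := by
  rw [derivative_C_mul_X_pow]
  cases l with
  | zero => simp
  | succ l =>
    rw [Nat.add_sub_cancel, C_mul, map_natCast, pow_succ]
    ring

theorem X_mul_derivative_natCast_mul {R : Type*} [CommRing R] (c : ℕ) (Y : R[X]) :
    X * derivative ((c : R[X]) * Y) = (c : R[X]) * (X * derivative Y) := by
  rw [derivative_mul, derivative_natCast, zero_mul, zero_add, mul_left_comm]

theorem X_mul_derivative_sum {R : Type*} [CommRing R] (e m c : ℕ) (q : ℕ → R) (Y : R[X]) :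
    X * derivative (∑ l ∈ Finset.range e, C (q l) * X ^ l + (c : R[X]) ^ m * Y) =
      ∑ l ∈ Finset.range e, (l : R[X]) * (C (q l) * X ^ l) +
        (c : R[X]) ^ m * (X * derivative Y) := by
  rw [derivative_add, mul_add, derivative_sum, Finset.mul_sum, ← Nat.cast_pow,
    X_mul_derivative_natCast_mul,
    Finset.sum_congr rfl fun l _ => X_mul_derivative_monomial (q l) l]

theorem X_mul_derivative_X_pow_sub {R : Type*} [CommRing R] (e c : ℕ) (V G : R[X]) :
    X * (derivative (X ^ e - (c : R[X]) * V) * G) =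
      ((e : R[X]) * X ^ e - (c : R[X]) * (X * derivative V)) * G := by
  have h := X_mul_derivative_monomial (1 : R) e
  rw [C_1, one_mul] at h
  rw [derivative_sub, ← mul_assoc, mul_sub, h, X_mul_derivative_natCast_mul]

variable {U} {e : ℕ} (he : absD p (p : D) = absD p U.τ ^ e)

/-- Elements of the unramified part that are explicit polynomials in roots of unity and whose
absolute value is a power of that of `p`. -/
def IsDigitSum (s : U.unramIntegers) : Prop :=
  (∃ q, U.ev (C q) = s) ∧ ((s : D) = 0 ∨ ∃ k : ℕ, absD p (s : D) = absD p (p : D) ^ k)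

/-- A nonzero digit `t` is a unit and dominates `p * s`; a zero digit raises the exponent by one. -/
theorem IsDigitSum.step {s t : U.unramIntegers} (hs : IsDigitSum s)
    (ht : t = 0 ∨ ∃ k, t = U.ψC k) : IsDigitSum (t + (p : U.unramIntegers) * s) := by
  obtain ⟨⟨q, hq⟩, h⟩ := hs
  rcases ht with rfl | ⟨k, rfl⟩
  · refine ⟨⟨(p : ℤ_[p][X]) * q, by rw [map_mul, map_mul, hq, zero_add]; simp⟩, ?_⟩
    rw [zero_add]
    change (p : D) * s = 0 ∨ ∃ k : ℕ, absD p ((p : D) * s) = _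
    rcases h with h | ⟨k, h⟩
    · left; rw [h, mul_zero]
    · right; exact ⟨k + 1, by rw [absD_mul, h, pow_succ']⟩
  · refine ⟨⟨X ^ k.val + (p : ℤ_[p][X]) * q, ?_⟩, Or.inr ⟨0, ?_⟩⟩
    · rw [map_add, map_add, map_mul, map_mul, map_pow, map_pow, hq, ev_C_X, ← ψC_eq_pow]; simp
    · change absD p (U.ψ k + (p : D) * s) = _
      rw [pow_zero, add_comm, absD_add_eq_right, absD_ψ]
      rw [absD_ψ, absD_mul]
      exact mul_lt_one_of_nonneg_of_lt_one_left (absD_nonneg p _) (absD_natCast_self_lt p) s.2.2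

theorem exists_digits (x : U.unramIntegers) (m : ℕ) : ∃ (t : ℕ → U.unramIntegers) (y : _),
    (∀ l, t l = 0 ∨ ∃ k, t l = U.ψC k) ∧
    x = ∑ l ∈ Finset.range m, t l * U.τC ^ l + U.τC ^ m * y := by
  induction m with
  | zero => exact ⟨0, x, fun _ => Or.inl rfl, by simp⟩
  | succ m ih =>
    obtain ⟨t, y, ht, rfl⟩ := ih
    obtain ⟨t', z, ht', hz, hz1, e⟩ := y.2.1.exists_digit y.2.2
    obtain ⟨T, hT⟩ : ∃ T : U.unramIntegers, (T = 0 ∨ ∃ k, T = U.ψC k) ∧ (T : D) = t' := by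
      rcases ht' with rfl | ⟨k, rfl⟩
      · exact ⟨0, Or.inl rfl, rfl⟩
      · exact ⟨_, Or.inr ⟨k, rfl⟩, rfl⟩
    have e' : y = T + U.τC * ⟨z, mem_unramIntegers.2 ⟨hz, hz1⟩⟩ := Subtype.ext (by rw [e, ← hT.2]; rfl)
    refine ⟨fun l => if l = m then T else t l, ⟨z, mem_unramIntegers.2 ⟨hz, hz1⟩⟩, fun l => ?_, ?_⟩
    · dsimp only
      split_ifs
      · exact hT.1
      · exact ht l
    · dsimp only
      rw [Finset.sum_range_succ, if_pos rfl, e']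
      have : ∀ l ∈ Finset.range m, (if l = m then T else t l) * U.τC ^ l = t l * U.τC ^ l :=
        fun l hl => by rw [if_neg (Finset.mem_range.1 hl).ne]
      rw [Finset.sum_congr rfl this]
      ring

include he in
theorem exists_unit : ∃ v : U.unramIntegers, U.τC ^ e = p * v ∧ absD p (v : D) = 1 := by
  have h : absD p ((p : D)⁻¹ * U.τ ^ e) = 1 := by
    rw [absD_mul, absD_inv, absD_pow, he, inv_mul_cancel₀ (pow_ne_zero _ U.absD_τ_pos.ne')]
  refine ⟨⟨(p : D)⁻¹ * U.τ ^ e, mem_unramIntegers.2 ⟨Unram.mul (Unram.inv fun k =>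
    Nat.cast_commute p _) (unram_τ.pow e), h.le⟩⟩, Subtype.ext ?_, h⟩
  change U.τ ^ e = (p : D) * ((p : D)⁻¹ * U.τ ^ e)
  rw [mul_inv_cancel_left₀ natCast_prime_ne_zero]

include he in
-- The first `e` digits in `τ` leave a multiple of `τ ^ e`, that is of `p`, on which the process is
-- repeated; the digits are then collected according to their exponent modulo `e`.
theorem exists_digitSum (m : ℕ) (x : U.unramIntegers) :
    ∃ (s : ℕ → U.unramIntegers) (y : U.unramIntegers), (∀ l, IsDigitSum (s l)) ∧
    x = ∑ l ∈ Finset.range e, s l * U.τC ^ l + p ^ m * y := by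
  obtain ⟨v, hv, -⟩ := exists_unit he
  induction m generalizing x with
  | zero => exact ⟨0, x, fun _ => ⟨⟨0, by simp⟩, Or.inl rfl⟩, by simp⟩
  | succ m ih =>
    obtain ⟨t, y, ht, rfl⟩ := exists_digits x e
    obtain ⟨s, z, hs, hz⟩ := ih (v * y)
    refine ⟨fun l => t l + p * s l, z, fun l => IsDigitSum.step (hs l) (ht l), ?_⟩
    rw [hv, mul_assoc, hz]
    simp only [add_mul, Finset.sum_add_distrib, mul_add, Finset.mul_sum, mul_assoc, pow_succ']
    ring

/-- Sums of elements with absolute values in distinct classes modulo `e`. -/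
theorem sum_eq_zero_or (A : Finset ℕ) (hA : ∀ l ∈ A, l < e) (y : ℕ → D)
    (hy : ∀ l, y l = 0 ∨ ∃ k : ℕ, absD p (y l) = absD p U.τ ^ (l + e * k)) :
    ∑ l ∈ A, y l = 0 ∨
      ∃ l ∈ A, ∃ k : ℕ, absD p (∑ l ∈ A, y l) = absD p U.τ ^ (l + e * k) := by
  induction A using Finset.induction_on with
  | empty => left; simp
  | insert a A ha ih =>
    rw [Finset.sum_insert ha]
    rcases hy a with h | ⟨k, h⟩
    · rw [h, zero_add]
      rcases ih fun l hl => hA l (Finset.mem_insert_of_mem hl) with h' | ⟨l, hl, k, h'⟩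
      · exact Or.inl h'
      · exact Or.inr ⟨l, Finset.mem_insert_of_mem hl, k, h'⟩
    · right
      rcases ih fun l hl => hA l (Finset.mem_insert_of_mem hl) with h' | ⟨l, hl, k', h'⟩
      · rw [h', add_zero]
        exact ⟨a, Finset.mem_insert_self a A, k, h⟩
      · have hne : a + e * k ≠ l + e * k' := by
          intro h2
          have h3 := congrArg (· % e) h2
          simp only [Nat.add_mul_mod_self_left] at h3
          rw [Nat.mod_eq_of_lt (hA a (Finset.mem_insert_self a A)),
            Nat.mod_eq_of_lt (hA l (Finset.mem_insert_of_mem hl))] at h3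
          exact ha (h3 ▸ hl)
        rcases lt_or_gt_of_ne hne with hlt | hlt
        · have := pow_lt_pow_right_of_lt_one₀ U.absD_τ_pos U.absD_τ_lt hlt
          rw [← h, ← h'] at this
          refine ⟨a, Finset.mem_insert_self a A, k, ?_⟩
          rw [add_comm, absD_add_eq_right p this, h]
        · have := pow_lt_pow_right_of_lt_one₀ U.absD_τ_pos U.absD_τ_lt hlt
          rw [← h, ← h'] at this
          refine ⟨l, Finset.mem_insert_of_mem hl, k', ?_⟩
          rw [absD_add_eq_right p this, h']

include he in
theorem absD_natCast_class (n : ℕ) : (n : D) = 0 ∨ ∃ k : ℕ, absD p (n : D) = absD p U.τ ^ (e * k) := by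
  by_cases hn : n = 0
  · left; rw [hn, Nat.cast_zero]
  right
  obtain ⟨k, m, hm, rfl⟩ := Nat.exists_eq_pow_mul_and_not_dvd hn p (Fact.out : p.Prime).ne_one
  refine ⟨k, ?_⟩
  rw [Nat.cast_mul, absD_mul, absD_natCast_eq_one p ((Nat.Prime.coprime_iff_not_dvd Fact.out).2 hm),
    Nat.cast_pow, absD_pow, he, mul_one, pow_mul]

include he in
/-- The equation of the uniformizer and a bound for its different. -/
theorem exists_eisenstein (he0 : 0 < e) {w : ℕ} (hw : p ^ w ∣ e) (hw' : ¬ p ^ (w + 1) ∣ e) :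
    ∃ P G : ℤ_[p][X][X], U.ev P = 0 ∧
      U.ev (X * (derivative P * G)) = (p : U.unramIntegers) ^ (w + 1) := by
  obtain ⟨v, hv, hv1⟩ := exists_unit he
  obtain ⟨s, y, hs, hvs⟩ := exists_digitSum he (w + 1) v
  choose q hq using fun l => (hs l).1
  obtain ⟨Y, hY⟩ := U.ev_surjective y
  obtain ⟨e', hee⟩ := hw
  have he' : ¬ p ∣ e' := fun h => hw' (by rw [pow_succ, hee]; exact mul_dvd_mul_left _ h)
  have heabs : absD p (e : D) = absD p U.τ ^ (e * w) := by
    have : absD p (e : D) = absD p (p : D) ^ w := by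
      rw [hee, Nat.cast_mul, absD_mul, absD_natCast_eq_one p
        ((Nat.Prime.coprime_iff_not_dvd Fact.out).2 he'), Nat.cast_pow, absD_pow, mul_one]
    rw [this, he, pow_mul]
  -- The equation will be `X ^ e - p V`, with `V` a polynomial expression of the unit `v = τ ^ e /
  -- p`. Digit sums as coefficients make the derivative computable; the uncontrolled rest `Y` is
  -- pushed to order `p ^ (w + 1)`.
  obtain ⟨V, hVdef⟩ : ∃ V : ℤ_[p][X][X], V = ∑ l ∈ Finset.range e, C (q l) * X ^ l +
    (p : ℤ_[p][X][X]) ^ (w + 1) * Y := ⟨_, rfl⟩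
  have hV : U.ev V = v := by
    rw [hvs, hVdef]
    simp only [map_add, map_sum, map_mul, map_pow, map_natCast, hq, ev_X, hY]
  have hdV : U.ev (X * derivative V) = ∑ l ∈ Finset.range e, l * (s l * U.τC ^ l) +
      p ^ (w + 1) * (U.τC * U.ev (derivative Y)) := by
    have := X_mul_derivative_sum e (w + 1) p q Y
    rw [hVdef, this]
    simp only [map_add, map_sum, map_mul, map_pow, map_natCast, hq, ev_X]
  -- For this equation `τ P'(τ) = e τ ^ e - p τ V'(τ) = p z`.
  set z : U.unramIntegers := e * v - U.ev (X * derivative V) with hz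
  have hzeq : z = e * s 0 + ∑ l ∈ (Finset.range e).erase 0, ((e - l : ℕ) : U.unramIntegers) *
      (s l * U.τC ^ l) + p ^ (w + 1) * (e * y - U.τC * U.ev (derivative Y)) := by
    have h0 : (0 : ℕ) ∈ Finset.range e := Finset.mem_range.2 he0
    have h1 : (e : U.unramIntegers) * s 0 + ∑ l ∈ (Finset.range e).erase 0,
        ((e - l : ℕ) : U.unramIntegers) * (s l * U.τC ^ l) =
        ∑ l ∈ Finset.range e, ((e - l : ℕ) : U.unramIntegers) * (s l * U.τC ^ l) := by
      rw [← Finset.add_sum_erase _ _ h0]; simp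
    have h2 : ∑ l ∈ Finset.range e, ((e - l : ℕ) : U.unramIntegers) * (s l * U.τC ^ l) =
        e * ∑ l ∈ Finset.range e, s l * U.τC ^ l -
          ∑ l ∈ Finset.range e, l * (s l * U.τC ^ l) := by
      rw [Finset.mul_sum, ← Finset.sum_sub_distrib]
      refine Finset.sum_congr rfl fun l hl => ?_
      rw [Nat.cast_sub (Finset.mem_range.1 hl).le, sub_mul]
    rw [h1, h2, hz, hdV]
    conv_lhs => rw [hvs]
    ring
  -- Integers and digit sums have values that are powers of `|τ| ^ e`, so the class modulo `e` of
  -- the valuation of the term of index `l` is that of `l`. No cancellation can occur between terms.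
  have hcls : ∀ l, ((((e - l : ℕ) : U.unramIntegers) * (s l * U.τC ^ l) : U.unramIntegers) : D) = 0 ∨
      ∃ k : ℕ, absD p ((((e - l : ℕ) : U.unramIntegers) * (s l * U.τC ^ l) : U.unramIntegers) : D) =
        absD p U.τ ^ (l + e * k) := by
    intro l
    have e1 : ((((e - l : ℕ) : U.unramIntegers) * (s l * U.τC ^ l) : U.unramIntegers) : D) =
      ((e - l : ℕ) : D) * ((s l : D) * U.τ ^ l) := rfl
    rw [e1]
    rcases absD_natCast_class he (e - l) with h | ⟨k, h⟩
    · left; rw [h, zero_mul]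
    rcases (hs l).2 with h' | ⟨k', h'⟩
    · left; rw [h', zero_mul, mul_zero]
    · right
      refine ⟨k + k', ?_⟩
      rw [absD_mul, absD_mul, h, h', he, absD_pow, ← pow_mul, ← pow_add, ← pow_add]
      congr 1
      ring
  have hτl : ∀ l, l ≠ 0 → absD p (((s l * U.τC ^ l : U.unramIntegers)) : D) < 1 := by
    intro l hl
    change absD p ((s l : D) * U.τ ^ l) < 1
    rw [absD_mul, absD_pow]
    exact mul_lt_one_of_nonneg_of_lt_one_right (s l).2.2 (pow_nonneg (absD_nonneg p _) _)
      (pow_lt_one₀ (absD_nonneg p _) U.absD_τ_lt hl)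
  have hs0 : absD p (s 0 : D) = 1 := by
    have h0 : (0 : ℕ) ∈ Finset.range e := Finset.mem_range.2 he0
    have h1 : (s 0 : D) = -(∑ l ∈ (Finset.range e).erase 0, ((s l * U.τC ^ l : U.unramIntegers) : D)
        + (p : D) ^ (w + 1) * y) + v := by
      have := congrArg Subtype.val hvs
      rw [← Finset.add_sum_erase _ _ h0] at this
      rw [this]
      simp only [pow_zero, mul_one, AddMemClass.coe_add, AddSubmonoidClass.coe_finsetSum,
        MulMemClass.coe_mul, SubmonoidClass.coe_pow]
      have : ((p : U.unramIntegers) : D) = p := rfl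
      rw [this]
      abel
    rw [h1, absD_add_eq_right, hv1]
    rw [hv1, absD_neg]
    refine absD_add_lt p (absD_sum_lt p _ _ _ one_pos fun l hl => hτl l (Finset.ne_of_mem_erase hl)) ?_
    rw [absD_mul, absD_pow]
    exact mul_lt_one_of_nonneg_of_lt_one_left (pow_nonneg (absD_nonneg p _) _)
      (pow_lt_one₀ (absD_nonneg p _) (absD_natCast_self_lt p) (Nat.succ_ne_zero _)) y.2.2
  -- The term of index 0 is `e * s 0` with `s 0` a unit, of value exactly `|p| ^ w`; the other terms
  -- cannot cancel it, and the rest is of strictly smaller value.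
  have hzabs : absD p U.τ ^ (e * w) ≤ absD p (z : D) := by
    obtain ⟨R, hR⟩ : ∃ R : D, R = ∑ l ∈ (Finset.range e).erase 0,
      ((((e - l : ℕ) : U.unramIntegers) * (s l * U.τC ^ l) : U.unramIntegers) : D) := ⟨_, rfl⟩
    obtain ⟨E, hE⟩ : ∃ E : U.unramIntegers, E = e * y - U.τC * U.ev (derivative Y) := ⟨_, rfl⟩
    have hzD : (z : D) = (p : D) ^ (w + 1) * E + (e * s 0 + R) := by
      rw [hzeq, hR, ← hE, add_comm]
      simp only [AddMemClass.coe_add, AddSubmonoidClass.coe_finsetSum]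
      rfl
    have h1 : absD p ((e : D) * s 0) = absD p U.τ ^ (e * w) := by
      rw [absD_mul, heabs, hs0, mul_one]
    have h2 : absD p U.τ ^ (e * w) ≤ absD p ((e : D) * s 0 + R) := by
      rcases sum_eq_zero_or ((Finset.range e).erase 0)
        (fun l hl => Finset.mem_range.1 (Finset.mem_of_mem_erase hl)) _ hcls with h | ⟨l, hl, k, h⟩
      · rw [← hR] at h
        rw [h, add_zero, h1]
      · rw [← hR] at h
        have hne : e * w ≠ l + e * k := by
          intro h2
          have h3 := congrArg (· % e) h2
          simp only [Nat.add_mul_mod_self_left, Nat.mul_mod_right] at h3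
          rw [Nat.mod_eq_of_lt (Finset.mem_range.1 (Finset.mem_of_mem_erase hl))] at h3
          exact Finset.ne_of_mem_erase hl h3.symm
        rcases lt_or_gt_of_ne hne with hlt | hlt
        · have := pow_lt_pow_right_of_lt_one₀ U.absD_τ_pos U.absD_τ_lt hlt
          rw [← h, ← h1] at this
          rw [add_comm, absD_add_eq_right p this, h1]
        · have := pow_lt_pow_right_of_lt_one₀ U.absD_τ_pos U.absD_τ_lt hlt
          rw [← h, ← h1] at this
          rw [absD_add_eq_right p this, ← h1]
          exact this.le
    have h3 : absD p ((p : D) ^ (w + 1) * E) < absD p U.τ ^ (e * w) := by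
      rw [absD_mul, absD_pow, he, ← pow_mul]
      refine (mul_le_of_le_one_right (pow_nonneg (absD_nonneg p _) _) E.2.2).trans_lt ?_
      refine pow_lt_pow_right_of_lt_one₀ U.absD_τ_pos U.absD_τ_lt ?_
      exact Nat.mul_lt_mul_of_pos_left (Nat.lt_succ_self w) he0
    rw [hzD, absD_add_eq_right p (h3.trans_le h2)]
    exact h2
  have hz0 : (z : D) ≠ 0 := fun h0 => by
    rw [h0, absD_zero] at hzabs
    exact absurd hzabs (not_le.2 (pow_pos U.absD_τ_pos _))
  obtain ⟨g, hg⟩ : ∃ g : U.unramIntegers, z * g = p ^ w := by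
    refine ⟨⟨(z : D)⁻¹ * (p : D) ^ w, z.2.1.inv.mul (Unram.pow (fun k => Nat.cast_commute p _) w), ?_⟩,
      Subtype.ext (mul_inv_cancel_left₀ hz0 _)⟩
    rw [absD_mul, absD_inv, absD_pow, he, ← pow_mul]
    exact inv_mul_le_one_of_le₀ hzabs (absD_nonneg p _)
  obtain ⟨G, rfl⟩ := U.ev_surjective g
  refine ⟨X ^ e - (p : ℤ_[p][X][X]) * V, G, ?_, ?_⟩
  · rw [map_sub, map_pow, map_mul, map_natCast, ev_X, hV, hv, sub_self]
  · have h1 : X * (derivative (X ^ e - (p : ℤ_[p][X][X]) * V) * G) =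
        ((e : ℤ_[p][X][X]) * X ^ e - (p : ℤ_[p][X][X]) * (X * derivative V)) * G := by
      exact X_mul_derivative_X_pow_sub e p V G
    rw [h1, map_mul, map_sub, map_mul, map_mul, map_pow, map_natCast, map_natCast, ev_X, hv,
      pow_succ', ← hg, hz]
    ring

include he in
theorem exists_quotient (he0 : 0 < e) : ∃ c : ℤ_[p][X][X], U.ev (X * c) = p := by
  have h : absD p (U.τ⁻¹ * p) ≤ 1 := by
    rw [absD_mul, absD_inv, he]
    refine inv_mul_le_one_of_le₀ ?_ (absD_nonneg p _)
    exact pow_le_of_le_one (absD_nonneg p _) U.absD_τ_lt.le he0.ne'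
  obtain ⟨c, hc⟩ := U.ev_surjective ⟨U.τ⁻¹ * p, unram_τ.inv.mul fun k => Nat.cast_commute p _, h⟩
  refine ⟨c, ?_⟩
  rw [map_mul, hc, ev_X]
  exact Subtype.ext (mul_inv_cancel_left₀ U.τ_ne_zero _)

end Eisenstein

end CyclicStructure

end NormOne

namespace NormOne

namespace CyclicStructure

/-! ### The center and the trace of the unramified subfield -/

section Center

variable {p : ℕ} [Fact p.Prime] {F : Type*} [Field F]
  {D : Type*} [DivisionRing D] [Algebra F D] [Algebra ℚ_[p] D]
  [FiniteDimensional ℚ_[p] D] [Algebra ℤ_[p] D] [IsScalarTower ℤ_[p] ℚ_[p] D]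
  (U : CyclicStructure p D)

theorem unram_algebraMap_center (a : F) : U.Unram (algebraMap F D a) := fun _ =>
  Algebra.commutes a _

/-- Such an element commutes with every term of the expansion in powers of `ϖ`, hence lies in the
center, which is `F`. -/
theorem exists_algebraMap_eq [Algebra.IsCentral F D] {x : D} (hx : U.Unram x)
    (h : U.ϖ * x = x * U.ϖ) : ∃ t : F, algebraMap F D t = x := by
  have : x ∈ Subalgebra.center F D := by
    rw [Subalgebra.mem_center_iff]
    intro y
    rw [← U.sum_coeff y, Finset.sum_mul, Finset.mul_sum]
    refine Finset.sum_congr rfl fun i _ => ?_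
    rw [mul_assoc, ((show Commute U.ϖ x from h).pow_left i).eq, ← mul_assoc,
      (U.unram_coeff i y).comm hx, mul_assoc]
  rw [Algebra.IsCentral.center_eq_bot] at this
  exact Algebra.mem_bot.1 this

/-- Conjugation by a power of `ϖ`. -/
theorem Unram.conj {U : CyclicStructure p D} {x : D} (hx : U.Unram x) (i : ℤ) :
    U.Unram (U.ϖ ^ i * x * (U.ϖ ^ i)⁻¹) := fun k => by
  have h := U.ϖ_zpow_mul (-i) k
  rw [zpow_neg] at h
  rw [mul_assoc, h, ← mul_assoc, mul_assoc (U.ϖ ^ i), hx, ← mul_assoc, ϖ_zpow_mul,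
    ← mul_assoc, ← Units.val_mul, zpow_neg, mul_inv_cancel, Units.val_one, one_mul, mul_assoc,
    mul_assoc, mul_assoc]

/-- The sum of the conjugates under the powers of `ϖ`. -/
noncomputable def tr (x : D) : D := ∑ i ∈ Finset.range U.d, U.ϖ ^ i * x * (U.ϖ ^ i)⁻¹

theorem ϖ_mul_tr (x : D) : U.ϖ * U.tr x = U.tr x * U.ϖ := by
  have h1 : U.ϖ * U.tr x * U.ϖ⁻¹ = U.tr x := by
    rw [tr, Finset.mul_sum, Finset.sum_mul]
    have h2 : ∀ i ∈ Finset.range U.d, U.ϖ * (U.ϖ ^ i * x * (U.ϖ ^ i)⁻¹) * U.ϖ⁻¹ =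
        U.ϖ ^ (i + 1) * x * (U.ϖ ^ (i + 1))⁻¹ := fun i _ => by
      rw [pow_succ', mul_inv_rev]
      simp only [mul_assoc]
    rw [Finset.sum_congr rfl h2]
    have h3 := Finset.sum_range_succ' (fun i => U.ϖ ^ i * x * (U.ϖ ^ i)⁻¹) U.d
    rw [Finset.sum_range_succ] at h3
    have h4 : U.ϖ ^ U.d * x * (U.ϖ ^ U.d)⁻¹ = x := by
      change U.τ * x * U.τ⁻¹ = x
      rw [τ_comm, mul_assoc, mul_inv_cancel₀ U.τ_ne_zero, mul_one]
    rw [h4, pow_zero, one_mul, inv_one, mul_one] at h3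
    exact (add_right_cancel h3).symm
  nth_rewrite 2 [← h1]
  rw [inv_mul_cancel_right₀ U.ϖ_ne_zero]

/-- By orthogonality only the identity conjugation contributes. As `N` is prime to `p`, it follows
that some root of unity has a unit as trace. -/
theorem sum_mul_tr_ψ : ∑ k, U.ψ (-k) * U.tr (U.ψ k) = U.N := by
  have h1 : ∀ k, U.ψ (-k) * U.tr (U.ψ k) =
      ∑ i ∈ Finset.range U.d, U.ψ (k * (((U.Q ^ i : (ZMod U.N)ˣ) : ZMod U.N) - 1)) := by
    intro k
    rw [tr, Finset.mul_sum]
    refine Finset.sum_congr rfl fun i _ => ?_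
    rw [ϖ_pow_mul, mul_inv_cancel_right₀ (pow_ne_zero _ U.ϖ_ne_zero), ← AddChar.map_add_eq_mul]
    congr 1
    ring
  rw [Finset.sum_congr rfl fun k _ => h1 k, Finset.sum_comm, Finset.sum_eq_single 0]
  · rw [sum_ψ, if_pos (by simp)]
  · intro i hi hi0
    rw [sum_ψ, if_neg]
    intro h
    rw [sub_eq_zero, Units.val_eq_one] at h
    exact hi0 (Nat.eq_zero_of_dvd_of_lt (orderOf_dvd_of_pow_eq_one h) (Finset.mem_range.1 hi))
  · intro h
    exact absurd (Finset.mem_range.2 U.d_pos) h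

theorem absD_tr_le (x : D) : absD p (U.tr x) ≤ absD p x := by
  refine absD_sum_le p _ _ _ (absD_nonneg p x) fun i _ => ?_
  rw [absD_conj p _ _ (pow_ne_zero _ U.ϖ_ne_zero)]

theorem unram_tr {U : CyclicStructure p D} {x : D} (hx : U.Unram x) : U.Unram (U.tr x) := by
  rw [tr]
  induction Finset.range U.d using Finset.induction_on with
  | empty => rw [Finset.sum_empty]; exact fun k => by rw [zero_mul, mul_zero]
  | insert a s ha ih =>
    rw [Finset.sum_insert ha]
    refine Unram.add ?_ ih
    have := hx.conj a
    rwa [zpow_natCast] at this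

/-- Unramified integral elements of trace zero are sums of `σ^i z - z`. -/
theorem exists_sum_conj_sub {x : D} (hx : U.Unram x) (h1 : absD p x ≤ absD p U.τ)
    (h0 : U.tr x = 0) : ∃ y : ℕ → U.unramIntegers, x = ∑ i ∈ Finset.range U.d,
      (U.ϖ ^ i * (U.τ * y i) * (U.ϖ ^ i)⁻¹ - U.τ * y i) := by
  obtain ⟨k, hk⟩ : ∃ k, absD p (U.tr (U.ψ k)) = 1 := by
    by_contra! h
    have : absD p (U.N : D) < 1 := by
      rw [← U.sum_mul_tr_ψ]
      refine absD_sum_lt p _ _ _ one_pos fun k _ => ?_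
      rw [absD_mul, absD_ψ, one_mul]
      exact lt_of_le_of_ne ((U.absD_tr_le _).trans_eq (U.absD_ψ k)) (h k)
    exact this.ne U.absD_N
  obtain ⟨t, ht⟩ : ∃ t, t = U.tr (U.ψ k) := ⟨_, rfl⟩
  have ht0 : t ≠ 0 := by
    rw [ne_eq, ← absD_eq_zero_iff p, ht, hk]
    exact one_ne_zero
  have htϖ : Commute U.ϖ t := by rw [ht]; exact U.ϖ_mul_tr _
  have htu : U.Unram t := by rw [ht]; exact unram_tr (unram_ψ k)
  have hu : ∀ i : ℕ, U.Unram ((U.ϖ ^ i)⁻¹ * x * U.ϖ ^ i) := fun i => by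
    have := hx.conj (-i)
    rwa [zpow_neg, zpow_natCast, inv_inv] at this
  -- An additive Hilbert 90. With `θ = t⁻¹ * ψ k` of trace 1 and `σ` the conjugation by `ϖ`, take `τ
  -- y_i = θ σ^(-i)(x)`: the sum of the `σ^i(τ y_i)` is `tr θ * x = x`, and the sum of the `τ y_i`
  -- is `θ * tr x = 0`. The assumption `|x| ≤ |τ|` makes `y_i` integral.
  let y : ℕ → D := fun i => U.τ⁻¹ * (t⁻¹ * U.ψ k * ((U.ϖ ^ i)⁻¹ * x * U.ϖ ^ i))
  have hτy : ∀ i, U.τ * y i = t⁻¹ * U.ψ k * ((U.ϖ ^ i)⁻¹ * x * U.ϖ ^ i) := fun i =>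
    mul_inv_cancel_left₀ U.τ_ne_zero _
  have hy : ∀ i, y i ∈ U.unramIntegers := fun i => by
    refine mem_unramIntegers.2 ⟨unram_τ.inv.mul ((htu.inv.mul (unram_ψ k)).mul (hu i)), ?_⟩
    have h2 := absD_conj p ((U.ϖ ^ i)⁻¹) x (inv_ne_zero (pow_ne_zero _ U.ϖ_ne_zero))
    rw [inv_inv] at h2
    rw [absD_mul, absD_mul, absD_mul, absD_inv, absD_inv, h2, absD_ψ, ht, hk, inv_one, one_mul,
      one_mul]
    exact inv_mul_le_one_of_le₀ h1 (absD_nonneg p _)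
  refine ⟨fun i => ⟨y i, hy i⟩, ?_⟩
  change x = ∑ i ∈ Finset.range U.d, (U.ϖ ^ i * (U.τ * y i) * (U.ϖ ^ i)⁻¹ - U.τ * y i)
  rw [Finset.sum_sub_distrib]
  have e1 : ∀ i, U.ϖ ^ i * (U.τ * y i) * (U.ϖ ^ i)⁻¹ =
      t⁻¹ * ((U.ϖ ^ i * U.ψ k * (U.ϖ ^ i)⁻¹) * x) := fun i => by
    have := pow_ne_zero i U.ϖ_ne_zero
    rw [hτy, ← mul_assoc, ← mul_assoc (U.ϖ ^ i), (htϖ.pow_left i).inv_right₀.eq]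
    simp only [mul_assoc]
    rw [mul_inv_cancel₀ this, mul_one]
  have e2 : ∑ i ∈ Finset.range U.d, U.τ * y i = 0 := by
    simp only [hτy]
    rw [← Finset.mul_sum]
    have h3 : U.ϖ ^ (U.d - 1) * (∑ i ∈ Finset.range U.d, (U.ϖ ^ i)⁻¹ * x * U.ϖ ^ i) *
        (U.ϖ ^ (U.d - 1))⁻¹ = 0 := by
      rw [← h0, tr, Finset.mul_sum, Finset.sum_mul, ← Finset.sum_range_reflect]
      refine Finset.sum_congr rfl fun i hi => ?_
      have hi := Finset.mem_range.1 hi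
      have h4 : U.ϖ ^ (U.d - 1) = U.ϖ ^ i * U.ϖ ^ (U.d - 1 - i) := by
        rw [← pow_add]
        congr 1
        omega
      have := pow_ne_zero (U.d - 1 - i) U.ϖ_ne_zero
      rw [h4, mul_inv_rev]
      simp only [mul_assoc]
      rw [mul_inv_cancel_left₀ this, mul_inv_cancel_left₀ this]
    have hne := pow_ne_zero (U.d - 1) U.ϖ_ne_zero
    rw [mul_eq_zero, mul_eq_zero] at h3
    rcases h3 with (h3 | h3) | h3
    · exact absurd h3 hne
    · rw [h3, mul_zero]
    · exact absurd h3 (inv_ne_zero hne)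
  rw [e2, sub_zero, Finset.sum_congr rfl fun i _ => e1 i, ← Finset.mul_sum, ← Finset.sum_mul]
  change x = t⁻¹ * (U.tr (U.ψ k) * x)
  rw [← ht, inv_mul_cancel_left₀ ht0]

end Center

/-! ### Elements of reduced trace zero -/

section ReducedTrace

variable {p : ℕ} [Fact p.Prime] {F : Type*} [Field F] [Algebra ℚ_[p] F]
  {D : Type*} [DivisionRing D] [Algebra F D] [Algebra.IsCentral F D] [FiniteDimensional F D]
  [Algebra ℚ_[p] D] [FiniteDimensional ℚ_[p] D] [Algebra ℤ_[p] D] [IsScalarTower ℤ_[p] ℚ_[p] D]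
  (U : CyclicStructure p D)

theorem reducedTrace_conj (x y : D) (hx : x ≠ 0) :
    reducedTrace F (x * y * x⁻¹) = reducedTrace F y := by
  rw [reducedTrace_mul_comm, inv_mul_cancel_left₀ hx]

theorem reducedTrace_algebraMap (t : F) : reducedTrace F (algebraMap F D t) =
    (degree F D : AlgebraicClosure F) * algebraMap F (AlgebraicClosure F) t := by
  have h1 : (1 ⊗ₜ[F] algebraMap F D t : AlgebraicClosure F ⊗[F] D) =
      algebraMap (AlgebraicClosure F) _ (algebraMap F (AlgebraicClosure F) t) := by
    rw [Algebra.TensorProduct.algebraMap_apply, Algebra.algebraMap_self_apply,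
      Algebra.algebraMap_eq_smul_one, Algebra.algebraMap_eq_smul_one,
      TensorProduct.tmul_smul, TensorProduct.smul_tmul']
  change (splitting F D (1 ⊗ₜ[F] algebraMap F D t)).trace = _
  rw [h1, AlgEquiv.commutes, Matrix.algebraMap_eq_diagonal, Matrix.trace_diagonal]
  simp

theorem degree_ne_zero : degree F D ≠ 0 := by
  exact (Nat.sqrt_pos.2 Module.finrank_pos).ne'

/-- Conjugation by `ψ 1` multiplies the element by a root of unity different from 1 that commutes
with the coefficient, and the trace is invariant under conjugation. -/
theorem reducedTrace_mul_ϖ_pow {a : D} (ha : U.Unram a) {m : ℕ} (hm : ¬ U.d ∣ m) :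
    reducedTrace F (a * U.ϖ ^ m) = 0 := by
  obtain ⟨z, hz⟩ : ∃ z, z = U.ψ (1 - (U.Q ^ m : (ZMod U.N)ˣ)) - 1 := ⟨_, rfl⟩
  have hz0 : z ≠ 0 := by
    intro h0
    rw [hz, sub_eq_zero] at h0
    have h1 := U.sep (1 - (U.Q ^ m : (ZMod U.N)ˣ)) (by rw [h0, sub_self, absD_zero]; exact one_pos)
    rw [sub_eq_zero, eq_comm, Units.val_eq_one] at h1
    exact hm (orderOf_dvd_of_pow_eq_one h1)
  have hzu : U.Unram z := by rw [hz]; exact (unram_ψ _).sub unram_one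
  have key : ∀ b, U.Unram b → reducedTrace F (z * b * U.ϖ ^ m) = 0 := by
    intro b hb
    have h1 := reducedTrace_conj (F := F) (U.ψ 1) (b * U.ϖ ^ m) (U.ψ_ne_zero 1)
    have h2 : U.ψ 1 * (b * U.ϖ ^ m) * (U.ψ 1)⁻¹ =
        U.ψ (1 - (U.Q ^ m : (ZMod U.N)ˣ)) * b * U.ϖ ^ m := by
      have h3 : (U.ψ 1)⁻¹ = U.ψ (-1) := by
        refine inv_eq_of_mul_eq_one_right ?_
        rw [← AddChar.map_add_eq_mul, add_neg_cancel, AddChar.map_zero_eq_one]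
      rw [h3, mul_assoc, mul_assoc, ϖ_pow_mul, ← mul_assoc b, hb, mul_assoc, ← mul_assoc (U.ψ 1),
        ← AddChar.map_add_eq_mul, mul_neg_one, ← sub_eq_add_neg, mul_assoc]
    rw [h2] at h1
    rw [hz, sub_mul, sub_mul, one_mul, map_sub, h1, sub_self]
  have := key (z⁻¹ * a) (hzu.inv.mul ha)
  rwa [mul_inv_cancel_left₀ hz0] at this

/-- The trace over the conjugates is a scalar `t` in `F`. Its reduced trace is on the one hand a sum
of zeros, on the other `degree F D` times `t`. -/
theorem tr_eq_zero {x : D} (hx : U.Unram x) (h : reducedTrace F x = 0) : U.tr x = 0 := by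
  obtain ⟨t, ht⟩ := U.exists_algebraMap_eq (F := F) (unram_tr hx) (U.ϖ_mul_tr x)
  have h1 : reducedTrace F (U.tr x) = 0 := by
    rw [tr, map_sum]
    refine Finset.sum_eq_zero fun i _ => ?_
    rw [reducedTrace_conj _ _ (pow_ne_zero _ U.ϖ_ne_zero), h]
  rw [← ht, reducedTrace_algebraMap, mul_eq_zero] at h1
  have : CharZero F := charZero_of_injective_algebraMap (algebraMap ℚ_[p] F).injective
  have : CharZero (AlgebraicClosure F) :=
    charZero_of_injective_algebraMap (algebraMap F (AlgebraicClosure F)).injective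
  rcases h1 with h1 | h1
  · exact absurd (Nat.cast_eq_zero.1 h1) degree_ne_zero
  · rw [map_eq_zero] at h1
    rw [← ht, h1, map_zero]

/-- The shape of the integral elements of reduced trace zero. -/
theorem exists_decomposition {x : D} (h : absD p x ≤ absD p U.ϖ) (hx : reducedTrace F x = 0) :
    ∃ a y : ℕ → U.unramIntegers,
      x = ∑ i ∈ (Finset.range U.d).erase 0, (a i : D) * U.ϖ ^ i + ∑ i ∈ Finset.range U.d,
        (U.ϖ ^ i * (U.τ * y i) * (U.ϖ ^ i)⁻¹ - U.τ * y i) := by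
  have h0 : (0 : ℕ) ∈ Finset.range U.d := Finset.mem_range.2 U.d_pos
  have hsum := U.sum_coeff x
  rw [← Finset.add_sum_erase _ _ h0, pow_zero, mul_one] at hsum
  have hr : reducedTrace F (U.coeff 0 x) = 0 := by
    rw [← hsum, map_add, map_sum, Finset.sum_eq_zero, add_zero] at hx
    · exact hx
    · intro i hi
      refine U.reducedTrace_mul_ϖ_pow (U.unram_coeff i x) fun hd => ?_
      rw [Finset.mem_erase, Finset.mem_range] at hi
      exact hi.1 (Nat.eq_zero_of_dvd_of_lt hd hi.2)
  -- The coefficient of `ϖ ^ i` has valuation at least `1 - i` in units of `ϖ`, and a multiple of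
  -- `d`. For `i < d` it is therefore integral, and for `i = 0` divisible by `τ`.
  have habs : ∀ i, absD p (U.coeff i x) ≤ absD p U.ϖ ^ (1 - i : ℤ) := fun i => by
    rw [coeff, absD_mul, absD_inv, absD_pow, zpow_sub₀ U.absD_ϖ_pos.ne', zpow_one, zpow_natCast,
      div_eq_mul_inv]
    exact mul_le_mul_of_nonneg_right ((U.absD_proj_le _ x).trans h)
      (inv_nonneg.2 (pow_nonneg (absD_nonneg p _) _))
  have hτ : ∀ n : ℤ, absD p U.τ ^ n = absD p U.ϖ ^ (U.d * n) := fun n => by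
    rw [τ, absD_pow, zpow_mul, zpow_natCast]
  have ha : ∀ i ∈ (Finset.range U.d), absD p (U.coeff i x) ≤ 1 := fun i hi => by
    have := (U.unram_coeff i x).absD_le (n := 0) (habs i) (by
      rw [hτ]
      refine zpow_lt_zpow_right_of_lt_one₀ U.absD_ϖ_pos U.absD_ϖ_lt ?_
      have := Finset.mem_range.1 hi
      omega)
    rwa [zpow_zero] at this
  have ha0 : absD p (U.coeff 0 x) ≤ absD p U.τ := by
    have := (U.unram_coeff 0 x).absD_le (n := 1) (habs 0) (by
      rw [hτ]
      exact zpow_lt_zpow_right_of_lt_one₀ U.absD_ϖ_pos U.absD_ϖ_lt (by simp))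
    rwa [zpow_one] at this
  obtain ⟨y, hy⟩ := U.exists_sum_conj_sub (U.unram_coeff 0 x) ha0
    (U.tr_eq_zero (U.unram_coeff 0 x) hr)
  refine ⟨fun i => if hi : i ∈ Finset.range U.d then
    ⟨U.coeff i x, mem_unramIntegers.2 ⟨U.unram_coeff i x, ha i hi⟩⟩ else 0, y, ?_⟩
  rw [← hy]
  conv_lhs => rw [← hsum]
  rw [add_comm]
  congr 1
  refine Finset.sum_congr rfl fun i hi => ?_
  dsimp only
  rw [dif_pos (Finset.mem_of_mem_erase hi)]

end ReducedTrace

/-! ### The degree of D equals the order of conjugation by ϖ -/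

section Degree

variable {p : ℕ} [Fact p.Prime] (F : Type*) [Field F]
  {D : Type*} [DivisionRing D] [Algebra F D]
  [Algebra ℚ_[p] D] [FiniteDimensional ℚ_[p] D] [Algebra ℤ_[p] D] [IsScalarTower ℤ_[p] ℚ_[p] D]
  (U : CyclicStructure p D)

/-- The maximal unramified subfield. -/
def unramField : Subalgebra F D where
  carrier := {x | U.Unram x}
  mul_mem' := Unram.mul
  add_mem' := Unram.add
  algebraMap_mem' := fun a _ => Algebra.commutes a _

noncomputable instance : Field (U.unramField F) :=
  { (U.unramField F).toRing with
    mul_comm := fun x y => Subtype.ext (Unram.comm (U := U) x.2 y.2)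
    inv := fun x => ⟨(x : D)⁻¹, Unram.inv x.2⟩
    exists_pair_ne := ⟨0, 1, fun h => zero_ne_one (congrArg Subtype.val h)⟩
    mul_inv_cancel := fun _ ha => Subtype.ext
      (mul_inv_cancel₀ fun h => ha (Subtype.ext h))
    inv_zero := Subtype.ext inv_zero
    nnqsmul := _
    nnqsmul_def := fun _ _ => rfl
    qsmul := _
    qsmul_def := fun _ _ => rfl }

/-- Conjugation by the uniformizer. -/
noncomputable def frob : U.unramField F ≃ₐ[F] U.unramField F where
  toFun x := ⟨U.ϖ * x * U.ϖ⁻¹, by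
    have := Unram.conj (U := U) x.2 1
    rwa [zpow_one] at this⟩
  invFun x := ⟨U.ϖ⁻¹ * x * U.ϖ, by
    have := Unram.conj (U := U) x.2 (-1)
    rwa [zpow_neg, zpow_one, inv_inv] at this⟩
  left_inv x := Subtype.ext (by
    change U.ϖ⁻¹ * (U.ϖ * (x : D) * U.ϖ⁻¹) * U.ϖ = x
    rw [mul_assoc, inv_mul_cancel_right₀ U.ϖ_ne_zero, inv_mul_cancel_left₀ U.ϖ_ne_zero])
  right_inv x := Subtype.ext (by
    change U.ϖ * (U.ϖ⁻¹ * (x : D) * U.ϖ) * U.ϖ⁻¹ = x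
    rw [mul_assoc, mul_inv_cancel_right₀ U.ϖ_ne_zero, mul_inv_cancel_left₀ U.ϖ_ne_zero])
  map_mul' x y := Subtype.ext (by
    change U.ϖ * ((x : D) * y) * U.ϖ⁻¹ = U.ϖ * x * U.ϖ⁻¹ * (U.ϖ * y * U.ϖ⁻¹)
    simp only [mul_assoc]
    rw [inv_mul_cancel_left₀ U.ϖ_ne_zero])
  map_add' x y := Subtype.ext (by
    change U.ϖ * ((x : D) + y) * U.ϖ⁻¹ = U.ϖ * x * U.ϖ⁻¹ + U.ϖ * y * U.ϖ⁻¹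
    rw [mul_add, add_mul])
  commutes' a := Subtype.ext (by
    change U.ϖ * algebraMap F D a * U.ϖ⁻¹ = algebraMap F D a
    rw [← Algebra.commutes, mul_inv_cancel_right₀ U.ϖ_ne_zero])

theorem frob_pow_apply (k : ℕ) (x : U.unramField F) :
    ((U.frob F ^ k) x : D) = U.ϖ ^ k * x * (U.ϖ ^ k)⁻¹ := by
  induction k generalizing x with
  | zero => simp
  | succ k ih =>
    rw [pow_succ, AlgEquiv.mul_apply, ih]
    change U.ϖ ^ k * (U.ϖ * x * U.ϖ⁻¹) * (U.ϖ ^ k)⁻¹ = _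
    rw [pow_succ, mul_inv_rev]
    simp only [mul_assoc]

theorem orderOf_frob : orderOf (U.frob F) = U.d := by
  rw [d]
  refine orderOf_eq_orderOf_iff.2 fun k => ⟨fun h => ?_, fun h => ?_⟩
  · have h1 := congrArg Subtype.val (DFunLike.congr_fun h (⟨U.ψ 1, unram_ψ 1⟩ : U.unramField F))
    rw [frob_pow_apply] at h1
    change U.ϖ ^ k * U.ψ 1 * (U.ϖ ^ k)⁻¹ = U.ψ 1 at h1
    rw [ϖ_pow_mul, mul_inv_cancel_right₀ (pow_ne_zero _ U.ϖ_ne_zero), mul_one] at h1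
    exact Units.ext (U.eq_of_absD_sub_lt (by
      rw [h1, Units.val_one, sub_self, absD_zero]; exact one_pos))
  · refine AlgEquiv.ext fun x => Subtype.ext ?_
    rw [frob_pow_apply]
    obtain ⟨m, rfl⟩ := orderOf_dvd_of_pow_eq_one h
    have h1 : Commute (U.ϖ ^ (orderOf U.Q * m)) (x : D) := by
      rw [pow_mul]
      exact Commute.pow_left (U.τ_comm x) m
    rw [h1.eq, mul_inv_cancel_right₀ (pow_ne_zero _ U.ϖ_ne_zero)]
    rfl

/-- Artin's theorem: conjugation by `ϖ` has order `d` on this field, and its fixed elements are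
central, hence in `F`. -/
theorem finrank_unramField [Algebra.IsCentral F D] [FiniteDimensional F D] :
    Module.finrank F (U.unramField F) = U.d := by
  have hfin : FiniteDimensional F (U.unramField F) :=
    FiniteDimensional.finiteDimensional_subalgebra _
  have h := IntermediateField.finrank_fixedField_eq_card (F := F) (E := U.unramField F)
    (Subgroup.zpowers (U.frob F))
  rw [Nat.card_zpowers, orderOf_frob] at h
  have hbot : IntermediateField.fixedField (Subgroup.zpowers (U.frob F)) = ⊥ := by
    rw [eq_bot_iff]
    intro x hx
    have h1 : U.frob F x = x := hx ⟨U.frob F, Subgroup.mem_zpowers _⟩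
    have h2 : U.ϖ * (x : D) * U.ϖ⁻¹ = x := congrArg Subtype.val h1
    obtain ⟨t, ht⟩ := U.exists_algebraMap_eq (F := F) (x := x) x.2 (by
      conv_rhs => rw [← h2]
      rw [inv_mul_cancel_right₀ U.ϖ_ne_zero])
    rw [IntermediateField.mem_bot]
    exact ⟨t, Subtype.ext ht⟩
  rw [hbot, IntermediateField.finrank_bot'] at h
  exact h

theorem proj_eq_zero {j j' : ZMod U.N} (hj : j ≠ j') {x : D}
    (h : ∀ k, x * U.ψ k = U.ψ (j' * k) * x) : U.proj j x = 0 := by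
  have h1 : ∀ k, U.ψ (-(j * k)) * x * U.ψ k = U.ψ (k * (j' - j)) * x := fun k => by
    rw [mul_assoc, h, ← mul_assoc, ← AddChar.map_add_eq_mul]
    congr 2
    ring
  rw [proj, Finset.sum_congr rfl fun k _ => h1 k, ← Finset.sum_mul, sum_ψ,
    if_neg (sub_ne_zero.2 hj.symm), zero_mul, mul_zero]

theorem proj_sum (j : ZMod U.N) {ι : Type*} (s : Finset ι) (f : ι → D) :
    U.proj j (∑ i ∈ s, f i) = ∑ i ∈ s, U.proj j (f i) := by
  simp only [proj, Finset.mul_sum, Finset.sum_mul]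
  rw [Finset.sum_comm]

theorem mul_ϖ_pow_mul_ψ {U : CyclicStructure p D} {a : D} (ha : U.Unram a) (i : ℕ)
    (k : ZMod U.N) : a * U.ϖ ^ i * U.ψ k = U.ψ ((U.Q ^ i : (ZMod U.N)ˣ) * k) * (a * U.ϖ ^ i) := by
  rw [mul_assoc, ϖ_pow_mul, ← mul_assoc, ha, mul_assoc]

/-- The expansion of elements in powers of the uniformizer. -/
noncomputable def expansion : (Fin U.d → U.unramField F) ≃ₗ[F] D :=
  LinearEquiv.ofBijective
    ({ toFun := fun a => ∑ i, (a i : D) * U.ϖ ^ (i : ℕ)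
       map_add' := fun a b => by
        rw [← Finset.sum_add_distrib]
        exact Finset.sum_congr rfl fun i _ => add_mul _ _ _
       map_smul' := fun c a => by
        rw [RingHom.id_apply, Finset.smul_sum]
        exact Finset.sum_congr rfl fun i _ => smul_mul_assoc _ _ _ } :
      (Fin U.d → U.unramField F) →ₗ[F] D) ⟨by
    rw [← LinearMap.ker_eq_bot, LinearMap.ker_eq_bot']
    intro a ha
    change ∑ i, (a i : D) * U.ϖ ^ (i : ℕ) = 0 at ha
    funext j
    have h1 := congrArg (U.proj ((U.Q ^ (j : ℕ) : (ZMod U.N)ˣ) : ZMod U.N)) ha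
    rw [proj_sum, Finset.sum_eq_single j] at h1
    · rw [proj_eq_self _ (mul_ϖ_pow_mul_ψ (a j).2 j)] at h1
      have h2 : U.proj ((U.Q ^ (j : ℕ) : (ZMod U.N)ˣ) : ZMod U.N) 0 = 0 := by simp [proj]
      rw [h2] at h1
      exact Subtype.ext ((mul_eq_zero.1 h1).resolve_right (pow_ne_zero _ U.ϖ_ne_zero))
    · intro i _ hij
      refine U.proj_eq_zero (fun h => hij ?_) (mul_ϖ_pow_mul_ψ (a i).2 i)
      exact Fin.ext (pow_injOn_Iio_orderOf i.2 j.2 (Units.ext h).symm)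
    · exact fun h => absurd (Finset.mem_univ j) h, fun x =>
    ⟨fun i => ⟨U.coeff i x, U.unram_coeff i x⟩, by
      conv_rhs => rw [← U.sum_coeff x]
      exact Fin.sum_univ_eq_sum_range (fun i => U.coeff i x * U.ϖ ^ i) U.d⟩⟩

/-- The expansion in powers of `ϖ` has `d` coefficients in a field of degree `d` over `F`, so `D`
has dimension `d ^ 2`. -/
theorem degree_eq [Algebra.IsCentral F D] [FiniteDimensional F D] : degree F D = U.d := by
  have hfin : FiniteDimensional F (U.unramField F) :=
    FiniteDimensional.finiteDimensional_subalgebra _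
  rw [degree, ← (U.expansion F).finrank_eq, Module.finrank_pi_fintype]
  simp only [finrank_unramField, Finset.sum_const, Finset.card_univ, Fintype.card_fin, smul_eq_mul,
    Nat.sqrt_eq]

end Degree

/-! ### Ramification and multiplication by p -/

section Ramification

variable (p : ℕ) [Fact p.Prime] {F : Type*} [Field F] [Algebra ℚ_[p] F] [FiniteDimensional ℚ_[p] F]
  [Algebra ℤ_[p] F] [IsScalarTower ℤ_[p] ℚ_[p] F]
  {D : Type*} [DivisionRing D] [Algebra F D] [Algebra.IsCentral F D] [FiniteDimensional F D]
  [Algebra ℚ_[p] D] [IsScalarTower ℚ_[p] F D] [FiniteDimensional ℚ_[p] D]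
  [Algebra ℤ_[p] D] [IsScalarTower ℤ_[p] ℚ_[p] D]

theorem absD_algebraMap_center (x : F) : absD p (algebraMap F D x) = absD p x := by
  have h1 := absD_map p (IsScalarTower.toAlgHom ℚ_[p] F D) x
  have h2 := absD_map p (AlgHom.id ℚ_[p] F) x
  rw [AlgHom.id_apply] at h2
  rw [h2]
  exact h1

variable {p} (U : CyclicStructure p D)

/-- The element `τ` is central, so it comes from `F`, and the values of elements of `F` are powers
of `|τ|`; it is therefore a uniformizer of `F`. -/
theorem absD_natCast_eq_pow {e : ℕ} (he : Ideal.span {(p : integers p F)} =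
    IsLocalRing.maximalIdeal (integers p F) ^ e) : absD p (p : D) = absD p U.τ ^ e := by
  obtain ⟨t, ht⟩ := U.exists_algebraMap_eq (F := F) (unram_τ (U := U)) (U.τ_comm U.ϖ).symm
  have ht' : absD p t = absD p U.τ := by rw [← ht, absD_algebraMap_center]
  have htm : t ∈ integers p F := (mem_integers_iff p t).2 (ht'.trans_le U.absD_τ_lt.le)
  have hmax : IsLocalRing.maximalIdeal (integers p F) = Ideal.span {⟨t, htm⟩} := by
    ext x
    rw [IsLocalRing.mem_maximalIdeal, mem_nonunits_iff, isUnit_integers_iff,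
      Ideal.mem_span_singleton]
    constructor
    · intro hx
      have hx1 : absD p (x : F) < 1 := lt_of_le_of_ne ((mem_integers_iff p _).1 x.2) hx
      have hx2 : absD p (x : F) ≤ absD p U.τ := by
        have h1 := (U.unram_algebraMap_center (x : F)).absD_le (n := 1) le_rfl (by
          rw [absD_algebraMap_center, sub_self, zpow_zero]
          exact hx1)
        rwa [absD_algebraMap_center, zpow_one] at h1
      have ht0 : t ≠ 0 := fun h0 => U.τ_ne_zero (by rw [← ht, h0, map_zero])
      refine ⟨⟨t⁻¹ * x, (mem_integers_iff p _).2 ?_⟩, Subtype.ext (mul_inv_cancel_left₀ ht0 _).symm⟩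
      rw [absD_mul, absD_inv, ht']
      exact inv_mul_le_one_of_le₀ hx2 (absD_nonneg p _)
    · rintro ⟨y, rfl⟩
      refine ne_of_lt ?_
      rw [MulMemClass.coe_mul, absD_mul]
      refine (mul_le_of_le_one_right (absD_nonneg p _) ((mem_integers_iff p _).1 y.2)).trans_lt ?_
      exact ht'.trans_lt U.absD_τ_lt
  rw [hmax, Ideal.span_singleton_pow, Ideal.span_singleton_eq_span_singleton] at he
  obtain ⟨u, hu⟩ := he
  have h1 := congrArg (fun z : integers p F => absD p (z : F)) hu
  change absD p ((p : F) * ((u : integers p F) : F)) = absD p (t ^ e) at h1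
  rw [absD_mul, (isUnit_integers_iff p _).1 u.isUnit, mul_one, absD_pow, ht'] at h1
  rw [← h1, ← absD_algebraMap_center p (D := D), map_natCast]

theorem mem_sl1_iff {π : integers p D} (hπ : absD p (π : D) = absD p U.ϖ) (n : ℕ) (x : D) :
    x ∈ sl1 p F π n ↔ absD p x ≤ absD p U.ϖ ^ n ∧ reducedTrace F x = 0 := by
  refine and_congr_left fun _ => ⟨?_, fun h => ?_⟩
  · rintro ⟨y, hy, rfl⟩
    rw [absD_mul, absD_pow, hπ]
    exact mul_le_of_le_one_right (pow_nonneg (absD_nonneg p _) _) ((mem_integers_iff p _).1 hy)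
  · have h0 : (π : D) ^ n ≠ 0 := pow_ne_zero _ fun h0 => by
      rw [h0, absD_zero] at hπ
      exact U.absD_ϖ_pos.ne hπ
    refine ⟨((π : D) ^ n)⁻¹ * x, (mem_integers_iff p _).2 ?_, (mul_inv_cancel_left₀ h0 _).symm⟩
    rw [absD_mul, absD_inv, absD_pow, hπ]
    exact inv_mul_le_one_of_le₀ h (pow_nonneg (absD_nonneg p _) _)

/-- Both lattices are defined by an absolute value bound on the elements of reduced trace zero, and
`|p| |ϖ| = |ϖ| ^ (d e + 1)`. -/
theorem exists_prime_smul {e : ℕ} (he : absD p (p : D) = absD p U.τ ^ e) {π : integers p D}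
    (hπ : absD p (π : D) = absD p U.ϖ) {n : ℕ} (hn : n = U.d * e + 1) :
    ∃ g : sl1 p F π 1 ≃ₗ[ℤ_[p]] sl1 p F π n, ∀ x, (g x : D) = (p : ℤ_[p]) • (x : D) := by
  have h1 : absD p U.ϖ ^ n = absD p (p : D) * absD p U.ϖ := by
    rw [hn, pow_succ, pow_mul, he, τ, absD_pow]
  have h2 : ∀ x : D, (p : ℤ_[p]) • x = (p : D) * x := fun x => by
    rw [Algebra.smul_def, map_natCast]
  have h3 : ∀ x : D, reducedTrace F ((p : D) * x) = (p : AlgebraicClosure F) * reducedTrace F x :=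
    fun x => by
      have : (p : D) * x = (p : F) • x := by rw [Algebra.smul_def, map_natCast]
      rw [this, map_smul, Algebra.smul_def, map_natCast]
  have h4 : 0 < absD p (p : D) := absD_pos p natCast_prime_ne_zero
  have : CharZero F := charZero_of_injective_algebraMap (algebraMap ℚ_[p] F).injective
  have : CharZero (AlgebraicClosure F) :=
    charZero_of_injective_algebraMap (algebraMap F (AlgebraicClosure F)).injective
  have h5 : (p : AlgebraicClosure F) ≠ 0 := Nat.cast_ne_zero.2 (Fact.out : p.Prime).ne_zero
  let f : sl1 p F π 1 →ₗ[ℤ_[p]] sl1 p F π n := LinearMap.codRestrict (sl1 p F π n).toSubmodule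
    ((p : ℤ_[p]) • (sl1 p F π 1).toSubmodule.subtype) fun x => by
      obtain ⟨x, hx⟩ := x
      have hx' := (U.mem_sl1_iff hπ 1 x).1 hx
      refine (U.mem_sl1_iff hπ n _).2 ?_
      change absD p ((p : ℤ_[p]) • x) ≤ _ ∧ reducedTrace F ((p : ℤ_[p]) • x) = 0
      rw [h2, h3, hx'.2, mul_zero, absD_mul, h1]
      rw [pow_one] at hx'
      exact ⟨mul_le_mul_of_nonneg_left hx'.1 h4.le, rfl⟩
  refine ⟨LinearEquiv.ofBijective f ⟨fun x y h => ?_, fun y => ?_⟩, fun x => rfl⟩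
  · have h6 : (p : ℤ_[p]) • (x : D) = (p : ℤ_[p]) • (y : D) := congrArg Subtype.val h
    rw [h2, h2] at h6
    exact Subtype.ext (mul_left_cancel₀ natCast_prime_ne_zero h6)
  · obtain ⟨y, hy⟩ := y
    have hy' := (U.mem_sl1_iff hπ n y).1 hy
    have h7 : (p : D) * ((p : D)⁻¹ * y) = y := mul_inv_cancel_left₀ natCast_prime_ne_zero y
    refine ⟨⟨(p : D)⁻¹ * y, (U.mem_sl1_iff hπ 1 _).2 ⟨?_, ?_⟩⟩, Subtype.ext ((h2 _).trans h7)⟩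
    · rw [pow_one, absD_mul, absD_inv, inv_mul_le_iff₀ h4, ← h1]
      exact hy'.1
    · have h8 := h3 ((p : D)⁻¹ * y)
      rw [h7, hy'.2] at h8
      exact (mul_eq_zero.1 h8.symm).resolve_left h5

end Ramification

end CyclicStructure

end NormOne

/-! ### Extension of scalars and idempotents -/

namespace NormOne

open Polynomial

/-- Extension of scalars of an algebra, with its structure of an associative algebra. -/
def ScalarExt (p : ℕ) [Fact p.Prime] (S D : Type*) [CommRing S] [Algebra ℤ_[p] S] [Ring D]
    [Algebra ℤ_[p] D] : Type _ := S ⊗[ℤ_[p]] D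

namespace ScalarExt

variable (p : ℕ) [Fact p.Prime] (S D : Type*) [CommRing S] [Algebra ℤ_[p] S] [Ring D]
    [Algebra ℤ_[p] D]

noncomputable instance : Ring (ScalarExt p S D) := inferInstanceAs (Ring (S ⊗[ℤ_[p]] D))

noncomputable instance : Algebra S (ScalarExt p S D) :=
  inferInstanceAs (Algebra S (S ⊗[ℤ_[p]] D))

variable {D}

/-- The inclusion of the original algebra. -/
noncomputable def inc : D →+* ScalarExt p S D :=
  (Algebra.TensorProduct.includeRight : D →ₐ[ℤ_[p]] S ⊗[ℤ_[p]] D).toRingHom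

theorem inc_smul (a : ℤ_[p]) (x : D) : inc p S (a • x) = algebraMap ℤ_[p] S a • inc p S x := by
  change (1 : S) ⊗ₜ[ℤ_[p]] (a • x) = algebraMap ℤ_[p] S a • ((1 : S) ⊗ₜ[ℤ_[p]] x)
  rw [TensorProduct.tmul_smul, TensorProduct.smul_tmul', TensorProduct.smul_tmul',
    Algebra.smul_def, smul_eq_mul]

variable {p S}

theorem induction_on {P : ScalarExt p S D → Prop} (b : ScalarExt p S D) (h0 : P 0)
    (h1 : ∀ (s : S) (x : D), P (s • inc p S x)) (h2 : ∀ b c, P b → P c → P (b + c)) : P b := by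
  refine TensorProduct.induction_on b h0 (fun s x => ?_) h2
  have : s ⊗ₜ[ℤ_[p]] x = s • ((1 : S) ⊗ₜ[ℤ_[p]] x) := by
    rw [TensorProduct.smul_tmul', smul_eq_mul, mul_one]
  rw [this]
  exact h1 s x

/-- The extension of scalars of a Lie subalgebra. -/
noncomputable def lieExt (S : Type*) [CommRing S] [Algebra ℤ_[p] S] (g : LieSubalgebra ℤ_[p] D) :
    LieSubalgebra S (ScalarExt p S D) where
  __ := Submodule.span S (inc p S '' (g : Set D))
  lie_mem' := by
    intro x y hx hy
    change x ∈ Submodule.span S (inc p S '' (g : Set D)) at hx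
    change y ∈ Submodule.span S (inc p S '' (g : Set D)) at hy
    change ⁅x, y⁆ ∈ Submodule.span S (inc p S '' (g : Set D))
    induction hx using Submodule.span_induction with
    | zero => rw [zero_lie]; exact zero_mem _
    | add x x' _ _ hx hx' => rw [add_lie]; exact add_mem hx hx'
    | smul r x _ hx => rw [smul_lie]; exact Submodule.smul_mem _ _ hx
    | mem x hx =>
      obtain ⟨x, hx, rfl⟩ := hx
      induction hy using Submodule.span_induction with
      | zero => rw [lie_zero]; exact zero_mem _
      | add y y' _ _ hy hy' => rw [lie_add]; exact add_mem hy hy'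
      | smul r y _ hy => rw [lie_smul]; exact Submodule.smul_mem _ _ hy
      | mem y hy =>
        obtain ⟨y, hy, rfl⟩ := hy
        refine Submodule.subset_span ⟨⁅x, y⁆, g.lie_mem hx hy, ?_⟩
        rw [Ring.lie_def, Ring.lie_def, map_sub, map_mul, map_mul]

theorem mem_lieExt {g : LieSubalgebra ℤ_[p] D} {b : ScalarExt p S D} :
    b ∈ lieExt S g ↔ b ∈ Submodule.span S (inc p S '' (g : Set D)) := Iff.rfl

end ScalarExt

namespace CyclicStructure

open ScalarExt

variable {p : ℕ} [Fact p.Prime] {D : Type*} [DivisionRing D] [Algebra ℚ_[p] D]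
  [FiniteDimensional ℚ_[p] D] [Algebra ℤ_[p] D] [IsScalarTower ℤ_[p] ℚ_[p] D]
  (U : CyclicStructure p D) {S : Type*} [CommRing S] [Algebra ℤ_[p] S]
  (χ : AddChar (ZMod U.N) S)

/-- The idempotent cut out by the character `k ↦ χ (j * k)`. -/
noncomputable def idem (j : ZMod U.N) : ScalarExt p S D :=
  ∑ k, χ (-(j * k)) • inc p S ((U.N : D)⁻¹ * U.ψ k)

/-- Evaluation of polynomials at `τ`. -/
noncomputable def evτ : S[X] →ₐ[S] ScalarExt p S D := aeval (inc p S U.τ)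

theorem evτ_comm (a : S[X]) (b : ScalarExt p S D) : U.evτ a * b = b * U.evτ a := by
  have h : Commute (inc p S U.τ) b := by
    refine ScalarExt.induction_on b (Commute.zero_right _) (fun s x => ?_)
      fun b c hb hc => hb.add_right hc
    refine Commute.smul_right ?_ s
    change inc p S U.τ * inc p S x = inc p S x * inc p S U.τ
    rw [← map_mul, ← map_mul, τ_comm]
  induction a using Polynomial.induction_on' with
  | add a b ha hb => rw [map_add, add_mul, mul_add, ha, hb]
  | monomial n a =>
    rw [evτ, aeval_monomial]
    exact ((Algebra.commute_algebraMap_left a b).mul_left (h.pow_left n)).eq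

theorem inc_ψ_mul_idem (l j : ZMod U.N) :
    inc p S (U.ψ l) * U.idem χ j = χ (j * l) • U.idem χ j := by
  rw [idem, Finset.mul_sum, Finset.smul_sum, ← Equiv.sum_comp (Equiv.subRight l)]
  refine Finset.sum_congr rfl fun k _ => ?_
  rw [Equiv.subRight_apply, mul_smul_comm, smul_smul, ← map_mul, ← AddChar.map_add_eq_mul,
    ← mul_assoc, ← natCast_inv_mul_comm, mul_assoc, ← AddChar.map_add_eq_mul]
  congr 3
  · ring
  · rw [add_sub_cancel]

/-- Conjugation by `ϖ` permutes the roots of unity, hence their characters and the idempotents that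
these cut out. -/
theorem inc_mul_smul_idem (n : ℤ) (j : ZMod U.N) :
    inc p S (U.ϖ ^ n) * U.idem χ j =
      U.idem χ (j * (U.Q ^ (-n) : (ZMod U.N)ˣ)) * inc p S (U.ϖ ^ n) := by
  rw [idem, idem, Finset.mul_sum, Finset.sum_mul,
    ← Equiv.sum_comp (Units.mulLeft (U.Q ^ n))
      (fun k => χ (-(j * (U.Q ^ (-n) : (ZMod U.N)ˣ) * k)) • inc p S ((U.N : D)⁻¹ * U.ψ k) *
        inc p S (U.ϖ ^ n))]
  refine Finset.sum_congr rfl fun k _ => ?_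
  rw [Units.mulLeft_apply, mul_smul_comm, smul_mul_assoc, ← map_mul, ← map_mul, ← mul_assoc,
    ← natCast_inv_mul_comm, mul_assoc, ϖ_zpow_mul, mul_assoc, zpow_neg]
  dsimp only
  rw [Units.inv_mul_cancel_left, mul_assoc]

variable {χ}

theorem idem_mul_idem (hχ : ∀ m, m ≠ 0 → ∑ k, χ (k * m) = 0) (i j : ZMod U.N) :
    U.idem χ i * U.idem χ j = if i = j then U.idem χ j else 0 := by
  have h1 : U.idem χ i * U.idem χ j =
      inc p S (U.N : D)⁻¹ * (∑ k, χ (k * (j - i))) • U.idem χ j := by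
    nth_rewrite 1 [idem]
    rw [Finset.sum_mul, Finset.sum_smul, Finset.mul_sum]
    refine Finset.sum_congr rfl fun k _ => ?_
    rw [smul_mul_assoc, map_mul, mul_assoc, inc_ψ_mul_idem, mul_smul_comm, smul_smul,
      ← AddChar.map_add_eq_mul, mul_smul_comm]
    congr 2
    ring
  rw [h1]
  split_ifs with h
  · subst h
    simp only [sub_self, mul_zero, AddChar.map_zero_eq_one, Finset.sum_const, Finset.card_univ,
      ZMod.card]
    rw [nsmul_eq_mul, mul_one, Nat.cast_smul_eq_nsmul, nsmul_eq_mul, ← map_natCast (inc p S),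
      ← mul_assoc, ← map_mul, inv_mul_cancel₀ U.N_ne_zero, map_one, one_mul]
  · rw [hχ _ (sub_ne_zero.2 (Ne.symm h)), zero_smul, mul_zero]

theorem sum_idem (hχ : ∀ m, m ≠ 0 → ∑ k, χ (k * m) = 0) : ∑ j, U.idem χ j = 1 := by
  simp only [idem]
  rw [Finset.sum_comm, Finset.sum_eq_single 0]
  · simp only [mul_zero, neg_zero, AddChar.map_zero_eq_one, one_smul, mul_one, Finset.sum_const,
      Finset.card_univ, ZMod.card]
    rw [← map_nsmul, nsmul_eq_mul, mul_inv_cancel₀ U.N_ne_zero, map_one]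
  · intro k _ hk
    rw [← Finset.sum_smul]
    have : ∑ j, χ (-(j * k)) = ∑ j, χ (j * (-k)) :=
      Finset.sum_congr rfl fun j _ => by rw [mul_neg]
    rw [this, hχ _ (neg_ne_zero.2 hk), zero_smul]
  · exact fun h => absurd (Finset.mem_univ _) h

/-- If `j * k = 0` with `k ≠ 0`, then `ψ k` acts as 1 on the idempotent; but `ψ k - 1` is invertible
in `D`. -/
theorem idem_eq_zero {j : ZMod U.N} (hj : ¬ IsUnit j) : U.idem χ j = 0 := by
  obtain ⟨k, hk, hjk⟩ : ∃ k, k ≠ 0 ∧ j * k = 0 := by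
    by_contra! h
    refine hj ?_
    have : Function.Injective (fun k => j * k) := fun a b hab => by
      by_contra hne
      exact h (a - b) (sub_ne_zero.2 hne) (by rw [mul_sub, sub_eq_zero]; exact hab)
    obtain ⟨k, hk⟩ := (Finite.injective_iff_surjective.1 this) 1
    exact IsUnit.of_mul_eq_one k hk
  have h1 := U.inc_ψ_mul_idem χ k j
  rw [hjk, AddChar.map_zero_eq_one, one_smul] at h1
  have h2 : U.ψ k - 1 ≠ 0 := fun h0 => hk (U.sep k (by rw [h0, absD_zero]; exact one_pos))
  have h3 : inc p S (U.ψ k - 1) * U.idem χ j = 0 := by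
    rw [map_sub, map_one, sub_mul, one_mul, h1, sub_self]
  calc U.idem χ j = inc p S ((U.ψ k - 1)⁻¹ * (U.ψ k - 1)) * U.idem χ j := by
        rw [inv_mul_cancel₀ h2, map_one, one_mul]
    _ = 0 := by rw [map_mul, mul_assoc, h3, mul_zero]

variable (χ)

/-- The specialization of a polynomial in two variables at a root of unity. -/
noncomputable def specialize (j : ZMod U.N) : ℤ_[p][X][X] →+* S[X] :=
  mapRingHom (aeval (χ j)).toRingHom

theorem inc_coe_add (x y : U.unramIntegers) :
    inc p S ((x + y : U.unramIntegers) : D) = inc p S (x : D) + inc p S (y : D) := map_add _ _ _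

theorem inc_ev_C_mul_idem (q : ℤ_[p][X]) (j : ZMod U.N) :
    inc p S (U.ev (C q) : D) * U.idem χ j = aeval (χ j) q • U.idem χ j := by
  induction q using Polynomial.induction_on' with
  | add q r hq hr => rw [C_add, map_add, map_add, add_smul, ← hq, ← hr, inc_coe_add, add_mul]
  | monomial k a =>
    have h4 : (U.ev (C (monomial k a)) : D) = a • U.ψ k := by
      rw [← C_mul_X_pow_eq_monomial, C_mul, C_pow, map_mul, map_pow, ev_C_C, ev_C_X]
      have : U.ψ (k : ZMod U.N) = U.ψ 1 ^ k := by
        rw [← AddChar.map_nsmul_eq_pow, nsmul_eq_mul, mul_one]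
      rw [this, Algebra.smul_def]
      rfl
    rw [h4, inc_smul, smul_mul_assoc, inc_ψ_mul_idem, aeval_monomial, smul_smul,
      ← AddChar.map_nsmul_eq_pow, nsmul_eq_mul, mul_comm j]

/-- On the idempotent of index `j` the root of unity `ψ 1` is the scalar `χ j`, so an unramified
element becomes a polynomial in `τ` over `S`. -/
theorem inc_ev_mul_idem (V : ℤ_[p][X][X]) (j : ZMod U.N) :
    inc p S (U.ev V : D) * U.idem χ j = U.evτ (U.specialize χ j V) * U.idem χ j := by
  induction V using Polynomial.induction_on' with
  | add V W hV hW => rw [map_add, map_add, map_add, add_mul, ← hV, ← hW, inc_coe_add, add_mul]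
  | monomial n q =>
    have h1 : (U.ev (monomial n q) : D) = U.τ ^ n * (U.ev (C q) : D) := by
      rw [← C_mul_X_pow_eq_monomial, mul_comm, map_mul, map_pow, ev_X]
      rfl
    have h2 : U.evτ (U.specialize χ j (monomial n q)) = aeval (χ j) q • inc p S U.τ ^ n := by
      rw [specialize, coe_mapRingHom, map_monomial, evτ, aeval_monomial, Algebra.smul_def]
      rfl
    rw [h1, h2, map_mul, map_pow, mul_assoc, inc_ev_C_mul_idem, mul_smul_comm, smul_mul_assoc]

theorem idem_mul_inc_ev (V : ℤ_[p][X][X]) (j : ZMod U.N) :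
    U.idem χ j * inc p S (U.ev V : D) = U.evτ (U.specialize χ j V) * U.idem χ j := by
  rw [← inc_ev_mul_idem, idem, Finset.mul_sum, Finset.sum_mul]
  refine Finset.sum_congr rfl fun k _ => ?_
  rw [mul_smul_comm, smul_mul_assoc, ← map_mul, ← map_mul, ← mul_assoc,
    ← natCast_inv_mul_comm, mul_assoc, mul_assoc, (U.ev V).2.1 k]

end CyclicStructure

end NormOne

/-! ### Matrix units indexed by the orbits of Q -/

namespace NormOne

namespace CyclicStructure

open Polynomial ScalarExt

variable {p : ℕ} [Fact p.Prime] {D : Type*} [DivisionRing D] [Algebra ℚ_[p] D]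
  [FiniteDimensional ℚ_[p] D] [Algebra ℤ_[p] D] [IsScalarTower ℤ_[p] ℚ_[p] D]
  (U : CyclicStructure p D)

/-- The orbits of the units modulo `N` under multiplication by `Q`. -/
abbrev Block : Type := (ZMod U.N)ˣ ⧸ Subgroup.zpowers U.Q

/-- A representative of an orbit. -/
noncomputable def base (ν : U.Block) : (ZMod U.N)ˣ := Quotient.out ν

theorem exists_base (u : (ZMod U.N)ˣ) : ∃ ν, ∃ i : Fin U.d, u = U.base ν * U.Q ^ (i : ℕ) := by
  have h : (QuotientGroup.mk (U.base (QuotientGroup.mk u)) : U.Block) = QuotientGroup.mk u :=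
    Quotient.out_eq _
  rw [QuotientGroup.eq, mem_zpowers_iff_mem_range_orderOf] at h
  obtain ⟨i, hi, h⟩ := Finset.mem_image.1 h
  refine ⟨QuotientGroup.mk u, ⟨i, Finset.mem_range.1 hi⟩, ?_⟩
  change u = U.base (QuotientGroup.mk u) * U.Q ^ i
  rw [h, mul_inv_cancel_left]

theorem base_mul_zpow_eq {ν μ : U.Block} {m n : ℤ}
    (h : U.base ν * U.Q ^ m = U.base μ * U.Q ^ n) : ν = μ ∧ (U.d : ℤ) ∣ n - m := by
  have h1 : U.base ν = U.base μ * U.Q ^ (n - m) := by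
    rw [zpow_sub, ← mul_assoc, ← h, mul_inv_cancel_right]
  have h2 : ν = μ := by
    have h3 : (QuotientGroup.mk (U.base ν) : U.Block) = QuotientGroup.mk (U.base μ) := by
      rw [eq_comm, QuotientGroup.eq, h1, inv_mul_cancel_left]
      exact Subgroup.zpow_mem_zpowers _ _
    have h4 : ∀ ν : U.Block, (QuotientGroup.mk (U.base ν) : U.Block) = ν := Quotient.out_eq
    rwa [h4, h4] at h3
  subst h2
  exact ⟨rfl, orderOf_dvd_iff_zpow_eq_one.2 (mul_eq_left.1 h1.symm)⟩

/-- This explains the factor `τ` below the diagonal: positions off the diagonal correspond exactly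
to the powers `ϖ ^ m` with `0 < m < d`, the negative differences `j - i` being raised by `d`. -/
theorem exists_shift {i j : Fin U.d} (h : i ≠ j) : ∃ m : ℕ, 0 < m ∧ m < U.d ∧
    U.τ ^ (if j < i then 1 else 0) * U.ϖ ^ ((j : ℤ) - i) = U.ϖ ^ m := by
  have hi := i.2
  have hj := j.2
  have hne : (i : ℕ) ≠ j := fun h' => h (Fin.ext h')
  split_ifs with hlt
  · have hlt : (j : ℕ) < i := hlt
    refine ⟨U.d + j - i, by omega, by omega, ?_⟩
    rw [pow_one, τ, ← zpow_natCast, ← zpow_natCast, ← zpow_add₀ U.ϖ_ne_zero]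
    congr 1
    omega
  · have hlt : ¬ (j : ℕ) < i := hlt
    refine ⟨j - i, by omega, by omega, ?_⟩
    rw [pow_zero, one_mul, ← zpow_natCast]
    congr 1
    omega

theorem exists_shift_eq (i : Fin U.d) {m : ℕ} (h0 : 0 < m) (hm : m < U.d) :
    ∃ j : Fin U.d, i ≠ j ∧ U.ϖ ^ m = U.τ ^ (if j < i then 1 else 0) * U.ϖ ^ ((j : ℤ) - i) := by
  have hi := i.2
  by_cases hlt : i + m < U.d
  · refine ⟨⟨i + m, hlt⟩, fun h => ?_, ?_⟩
    · have := congrArg Fin.val h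
      simp at this
      omega
    · rw [if_neg (by simp [Fin.lt_def]), pow_zero, one_mul, ← zpow_natCast]
      congr 1
      simp
  · refine ⟨⟨i + m - U.d, by omega⟩, fun h => ?_, ?_⟩
    · have := congrArg Fin.val h
      simp at this
      omega
    · rw [if_pos (by rw [Fin.lt_def]; simp; omega), pow_one, τ, ← zpow_natCast, ← zpow_natCast,
        ← zpow_add₀ U.ϖ_ne_zero]
      congr 1
      simp
      omega

variable {S : Type*} [CommRing S] [Algebra ℤ_[p] S] (χ : AddChar (ZMod U.N) S)

/-- The matrix units of the extension of scalars. -/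
noncomputable def unit (ν : U.Block) (i j : Fin U.d) : ScalarExt p S D :=
  U.idem χ (U.base ν * U.Q ^ (i : ℕ) : (ZMod U.N)ˣ) * inc p S (U.ϖ ^ ((j : ℤ) - i))

/-- All matrix units of a block pass through the idempotent of its base point, so one equation for
`τ` serves the whole block. -/
theorem unit_eq (ν : U.Block) (i j : Fin U.d) : U.unit χ ν i j =
    inc p S (U.ϖ ^ (-(i : ℤ))) * U.idem χ (U.base ν) * inc p S (U.ϖ ^ (j : ℤ)) := by
  rw [inc_mul_smul_idem, neg_neg, mul_assoc, ← map_mul, ← zpow_add₀ U.ϖ_ne_zero, unit,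
    neg_add_eq_sub, zpow_natCast, Units.val_mul]

variable {χ}

open Classical in
theorem unit_mul_unit (hχ : ∀ m, m ≠ 0 → ∑ k, χ (k * m) = 0) (ν μ : U.Block)
    (i j k l : Fin U.d) : U.unit χ ν i j * U.unit χ μ k l =
      if ν = μ ∧ j = k then U.unit χ ν i l else 0 := by
  have h1 : U.unit χ ν i j * U.unit χ μ k l =
      U.idem χ (U.base ν * U.Q ^ (i : ℕ) : (ZMod U.N)ˣ) *
      U.idem χ (U.base μ * U.Q ^ ((k : ℤ) + i - j) : (ZMod U.N)ˣ) *
        (inc p S (U.ϖ ^ ((j : ℤ) - i)) * inc p S (U.ϖ ^ ((l : ℤ) - k))) := by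
    have h2 : U.base μ * U.Q ^ ((k : ℤ) + i - j) =
        U.base μ * U.Q ^ (k : ℕ) * U.Q ^ (-((j : ℤ) - i)) := by
      rw [mul_assoc, ← zpow_natCast, ← zpow_add]
      congr 2
      ring
    rw [unit, unit, mul_assoc, ← mul_assoc (inc p S _), inc_mul_smul_idem, h2,
      Units.val_mul (U.base μ * _)]
    simp only [mul_assoc]
  rw [h1, idem_mul_idem _ hχ]
  by_cases h : ν = μ ∧ j = k
  · obtain ⟨rfl, rfl⟩ := h
    rw [if_pos (c := ν = ν ∧ j = j) ⟨rfl, rfl⟩, add_sub_cancel_left, zpow_natCast, if_pos rfl,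
      unit, ← map_mul, ← zpow_add₀ U.ϖ_ne_zero]
    congr 3
    ring
  · rw [if_neg h, if_neg, zero_mul]
    intro h2
    have h3 := Units.ext h2
    rw [← zpow_natCast] at h3
    obtain ⟨h4, h5⟩ := U.base_mul_zpow_eq h3
    refine h ⟨h4, Fin.ext ?_⟩
    have hj := j.2
    have hk := k.2
    have h6 : (k : ℤ) + i - j - i = k - j := by ring
    rw [h6] at h5
    have := Int.eq_zero_of_abs_lt_dvd h5 (by rw [abs_lt]; omega)
    omega

theorem unit_mul_unit_self (hχ : ∀ m, m ≠ 0 → ∑ k, χ (k * m) = 0) (ν : U.Block)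
    (i j k : Fin U.d) : U.unit χ ν i j * U.unit χ ν j k = U.unit χ ν i k := by
  classical
  rw [unit_mul_unit _ hχ, if_pos ⟨rfl, rfl⟩]

theorem unit_mul_unit_of_ne (hχ : ∀ m, m ≠ 0 → ∑ k, χ (k * m) = 0) {ν μ : U.Block}
    {j k : Fin U.d} (h : ν = μ → j ≠ k) (i l : Fin U.d) :
    U.unit χ ν i j * U.unit χ μ k l = 0 := by
  classical
  rw [unit_mul_unit _ hχ, if_neg fun h' => h h'.1 h'.2]

variable (χ)

/-- The matrix with a single entry off the diagonal. -/
noncomputable def entry (ν : U.Block) (i j : Fin U.d) : S[X] →ₗ[S] ScalarExt p S D :=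
  -- The value zero on the diagonal makes membership in the extended Lie algebra hold for all
  -- indices.
  if i = j then 0 else LinearMap.mulRight S (U.unit χ ν i j) ∘ₗ U.evτ.toLinearMap ∘ₗ
    LinearMap.mulLeft S (X ^ (if j < i then 1 else 0))

/-- The diagonal matrix with two opposite entries. -/
noncomputable def diag (ν : U.Block) (i j : Fin U.d) : S[X] →ₗ[S] ScalarExt p S D :=
  LinearMap.mulRight S (U.unit χ ν i i - U.unit χ ν j j) ∘ₗ U.evτ.toLinearMap ∘ₗ
    LinearMap.mulLeft S X

variable {χ}

theorem entry_apply {ν : U.Block} {i j : Fin U.d} (h : i ≠ j) (a : S[X]) :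
    U.entry χ ν i j a = U.evτ (X ^ (if j < i then 1 else 0) * a) * U.unit χ ν i j := by
  rw [entry, if_neg h]
  rfl

theorem entry_self (ν : U.Block) (i : Fin U.d) : U.entry χ ν i i = 0 := by
  rw [entry, if_pos rfl]

theorem diag_apply (ν : U.Block) (i j : Fin U.d) (a : S[X]) :
    U.diag χ ν i j a = U.evτ (X * a) * (U.unit χ ν i i - U.unit χ ν j j) := rfl

theorem diag_self (ν : U.Block) (i : Fin U.d) : U.diag χ ν i i = 0 := by
  refine LinearMap.ext fun a => ?_
  rw [diag_apply, sub_self, mul_zero, LinearMap.zero_apply]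

theorem evτ_mul_mul (a b : S[X]) (x y : ScalarExt p S D) :
    U.evτ a * x * (U.evτ b * y) = U.evτ (a * b) * (x * y) := by
  rw [mul_assoc, ← mul_assoc x, ← U.evτ_comm b x, map_mul]
  simp only [mul_assoc]

section Relations

variable (hχ : ∀ m, m ≠ 0 → ∑ k, χ (k * m) = 0)
include hχ

theorem lie_entry_opp (ν : U.Block) (i j : Fin U.d) (a b : S[X]) (h : i ≠ j) :
    ⁅U.entry χ ν i j a, U.entry χ ν j i b⁆ = U.diag χ ν i j (a * b) := by
  rw [Ring.lie_def, entry_apply _ h, entry_apply _ h.symm, evτ_mul_mul, evτ_mul_mul,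
    unit_mul_unit_self _ hχ, unit_mul_unit_self _ hχ, diag_apply, mul_sub]
  have h1 : ∀ a b : S[X], X ^ (if j < i then 1 else 0) * a * (X ^ (if i < j then 1 else 0) * b) =
      X * (a * b) := fun a b => by
    rw [mul_mul_mul_comm, ← pow_add]
    rcases lt_or_gt_of_ne h with h | h
    · rw [if_neg h.not_gt, if_pos h, zero_add, pow_one]
    · rw [if_pos h, if_neg h.not_gt, add_zero, pow_one]
  rw [h1, mul_comm (_ * b), h1]

theorem lie_entry_mul (ν : U.Block) (i j k : Fin U.d) (a b : S[X]) (hij : i ≠ j) (hjk : j ≠ k)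
    (hik : i ≠ k) : ⁅U.entry χ ν i j a, U.entry χ ν j k b⁆ = U.entry χ ν i k
      (X ^ ((if j < i then 1 else 0) + (if k < j then 1 else 0) - (if k < i then 1 else 0)) *
        (a * b)) := by
  rw [Ring.lie_def, entry_apply _ hij, entry_apply _ hjk, evτ_mul_mul, evτ_mul_mul,
    unit_mul_unit_self _ hχ, unit_mul_unit_of_ne _ hχ fun _ => hik.symm, mul_zero, sub_zero, entry_apply _ hik, mul_mul_mul_comm, ← pow_add,
    ← mul_assoc (X ^ (if k < i then 1 else 0)), ← pow_add]
  congr 4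
  -- The subtraction of exponents is not truncated: a step down from `i` to `k` through `j` contains
  -- a step down.
  have : (if k < i then 1 else 0) ≤ (if j < i then 1 else 0) + (if k < j then 1 else 0) := by
    split_ifs <;> omega
  omega

theorem lie_entry_zero (ν : U.Block) (i j : Fin U.d) (μ : U.Block) (k l : Fin U.d) (a b : S[X])
    (hij : i ≠ j) (hkl : k ≠ l) (h : ν = μ → j ≠ k ∧ i ≠ l) :
    ⁅U.entry χ ν i j a, U.entry χ μ k l b⁆ = 0 := by
  rw [Ring.lie_def, entry_apply _ hij, entry_apply _ hkl, evτ_mul_mul, evτ_mul_mul,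
    unit_mul_unit_of_ne _ hχ fun h' => (h h').1,
    unit_mul_unit_of_ne _ hχ fun h' => (h h'.symm).2.symm, mul_zero, mul_zero, sub_zero]

open Classical in
theorem lie_diag_entry (ν : U.Block) (i j : Fin U.d) (μ : U.Block) (k l : Fin U.d) (a b : S[X])
    (hkl : k ≠ l) : ⁅U.diag χ ν i j a, U.entry χ μ k l b⁆ =
      (if ν = μ then (if i = k then 1 else 0) + (if j = l then 1 else 0) -
        (if i = l then 1 else 0) - (if j = k then 1 else 0) else 0 : ℤ) •
        U.entry χ μ k l (X * (a * b)) := by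
  rw [Ring.lie_def, diag_apply, entry_apply _ hkl, evτ_mul_mul, evτ_mul_mul, entry_apply _ hkl]
  have h1 : X ^ (if l < k then 1 else 0) * b * (X * a) =
      X ^ (if l < k then 1 else 0) * (X * (a * b)) := by ring
  have h2 : X * a * (X ^ (if l < k then 1 else 0) * b) =
      X ^ (if l < k then 1 else 0) * (X * (a * b)) := by ring
  rw [h1, h2, ← mul_sub, ← mul_smul_comm]
  congr 1
  rw [mul_sub, sub_mul, unit_mul_unit _ hχ, unit_mul_unit _ hχ, unit_mul_unit _ hχ,
    unit_mul_unit _ hχ]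
  by_cases hν : ν = μ
  · subst hν
    simp only [true_and, if_true, eq_comm (a := l)]
    have h3 : ∀ (q : Prop) [Decidable q] (x y : ScalarExt p S D), (q → x = y) →
        (if q then x else 0) = (if q then (1 : ℤ) else 0) • y := fun q _ x y h => by
      split_ifs with hq
      · rw [one_smul, h hq]
      · rw [zero_smul]
    rw [h3 (i = k) _ (U.unit χ ν k l) fun h => by rw [h], h3 (j = k) _ (U.unit χ ν k l)
      fun h => by rw [h], h3 (i = l) _ (U.unit χ ν k l) fun h => by rw [h], h3 (j = l) _
      (U.unit χ ν k l) fun h => by rw [h], sub_smul, sub_smul, add_smul]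
    abel
  · simp only [hν, Ne.symm hν, false_and, if_false, zero_smul, sub_zero]

omit hχ in
-- Polynomials in `τ` are central, so the unramified element acts at the base idempotent, between
-- the two powers of `ϖ`. Relations between unramified integers thus become relations between
-- coefficients of a block.
theorem evτ_specialize_mul_unit (ν : U.Block) (i j : Fin U.d) (V : ℤ_[p][X][X]) :
    U.evτ (U.specialize χ (U.base ν : ZMod U.N) V) * U.unit χ ν i j =
      inc p S (U.ϖ ^ (-(i : ℤ))) * (inc p S (U.ev V : D) * U.idem χ (U.base ν)) *
        inc p S (U.ϖ ^ (j : ℤ)) := by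
  rw [unit_eq, inc_ev_mul_idem, ← mul_assoc, ← mul_assoc, evτ_comm _ _ (inc p S _)]
  simp only [mul_assoc]

omit hχ in
theorem entry_mul_eq_zero (ν : U.Block) (i j : Fin U.d) {P : ℤ_[p][X][X]} (hP : U.ev P = 0)
    (a : S[X]) : U.entry χ ν i j (U.specialize χ (U.base ν : ZMod U.N) P * a) = 0 := by
  by_cases h : i = j
  · subst h
    rw [entry_self, LinearMap.zero_apply]
  · have h0 : inc p S ((0 : U.unramIntegers) : D) = 0 := map_zero _
    rw [entry_apply _ h, ← mul_assoc, mul_right_comm, map_mul, mul_assoc,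
      evτ_specialize_mul_unit, hP, h0, zero_mul, mul_zero, zero_mul, mul_zero]

omit hχ in
theorem entry_mul_eq_smul (ν : U.Block) (i j : Fin U.d) {V : ℤ_[p][X][X]} {m : ℕ}
    (hV : U.ev V = m) (a : S[X]) :
    U.entry χ ν i j (U.specialize χ (U.base ν : ZMod U.N) V * a) = (m : S) • U.entry χ ν i j a := by
  have h := U.entry_mul_eq_zero (χ := χ) ν i j (P := V - m) (by rw [map_sub, hV, map_natCast, sub_self]) a
  rw [map_sub, map_natCast, sub_mul, map_sub, sub_eq_zero] at h
  rw [h, ← nsmul_eq_mul, map_nsmul, Nat.cast_smul_eq_nsmul]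

end Relations

/-! ### Generators of the extended Lie algebra -/

variable {g : LieSubalgebra ℤ_[p] D}

theorem entry_mem (hg : ∀ (a : U.unramIntegers) (m : ℕ), 0 < m → m < U.d → (a : D) * U.ϖ ^ m ∈ g)
    (ν : U.Block) (i j : Fin U.d) (a : S[X]) : U.entry χ ν i j a ∈ lieExt S g := by
  by_cases h : i = j
  · subst h
    rw [entry_self]
    exact zero_mem _
  obtain ⟨m, h0, hm, hshift⟩ := U.exists_shift h
  induction a using Polynomial.induction_on' with
  | add a b ha hb => rw [map_add]; exact add_mem ha hb
  | monomial n c =>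
    have h1 : U.evτ (X ^ (if j < i then 1 else 0) * monomial n c) =
        c • inc p S (U.τ ^ n * U.τ ^ (if j < i then 1 else 0)) := by
      rw [mul_comm, map_mul, evτ, aeval_monomial, map_pow, aeval_X, map_mul, map_pow, map_pow,
        ← Algebra.smul_def, smul_mul_assoc]
    rw [entry_apply _ h, h1, unit, idem, Finset.sum_mul, Finset.mul_sum]
    refine sum_mem fun k _ => ?_
    rw [smul_mul_assoc, smul_mul_assoc, mul_smul_comm, ← map_mul, ← map_mul]
    refine (lieExt S g).smul_mem _ ((lieExt S g).smul_mem _ (mem_lieExt.2 (Submodule.subset_span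
      ⟨_, ?_, rfl⟩)))
    have h2 : U.τ ^ n * U.τ ^ (if j < i then 1 else 0) *
        ((U.N : D)⁻¹ * U.ψ k * U.ϖ ^ ((j : ℤ) - i)) =
        U.τ ^ n * ((U.N : D)⁻¹ * U.ψ k) * U.ϖ ^ m := by
      have h3 : Commute (U.τ ^ (if j < i then 1 else 0)) ((U.N : D)⁻¹ * U.ψ k) :=
        Commute.pow_left (U.τ_comm _) _
      rw [mul_assoc, ← mul_assoc _ (_ * _) (U.ϖ ^ _), h3.eq, mul_assoc _ _ (U.ϖ ^ ((j : ℤ) - i)),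
        hshift]
      simp only [mul_assoc]
    rw [h2]
    have h4 : U.τ ^ n * ((U.N : D)⁻¹ * U.ψ k) ∈ U.unramIntegers := by
      refine mul_mem (pow_mem U.τC.2 n) (mem_unramIntegers.2 ⟨Unram.mul (Unram.inv
        fun k => Nat.cast_commute _ _) (unram_ψ k), ?_⟩)
      rw [absD_mul, absD_inv, absD_N, absD_ψ, inv_one, one_mul]
    exact hg ⟨_, h4⟩ m h0 hm

theorem diag_mem (hχ : ∀ m, m ≠ 0 → ∑ k, χ (k * m) = 0)
    (hg : ∀ (a : U.unramIntegers) (m : ℕ), 0 < m → m < U.d → (a : D) * U.ϖ ^ m ∈ g)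
    (ν : U.Block) (i j : Fin U.d) (a : S[X]) : U.diag χ ν i j a ∈ lieExt S g := by
  by_cases h : i = j
  · subst h
    rw [diag_self]
    exact zero_mem _
  · rw [← mul_one a, ← U.lie_entry_opp hχ ν i j a 1 h]
    exact (lieExt S g).lie_mem (U.entry_mem hg _ _ _ _) (U.entry_mem hg _ _ _ _)

variable (χ) in
/-- The span of the matrices with entries off the diagonal and of the diagonal matrices. -/
noncomputable def genSpan : Submodule S (ScalarExt p S D) := Submodule.span S
    ({y | ∃ ν i j a, i ≠ j ∧ y = U.entry χ ν i j a} ∪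
      {y | ∃ ν i j a, i ≠ j ∧ y = U.diag χ ν i j a})

theorem entry_mem_genSpan (ν : U.Block) {i j : Fin U.d} (h : i ≠ j) (a : S[X]) :
    U.entry χ ν i j a ∈ U.genSpan χ := Submodule.subset_span (Or.inl ⟨ν, i, j, a, h, rfl⟩)

theorem diag_mem_genSpan (ν : U.Block) (i j : Fin U.d) (a : S[X]) :
    U.diag χ ν i j a ∈ U.genSpan χ := by
  by_cases h : i = j
  · subst h
    rw [diag_self]
    exact zero_mem _
  · exact Submodule.subset_span (Or.inr ⟨ν, i, j, a, h, rfl⟩)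

variable (χ) in
theorem mem_of_idem_mul_mem (hχ : ∀ m, m ≠ 0 → ∑ k, χ (k * m) = 0)
    {T : Submodule S (ScalarExt p S D)} {b : ScalarExt p S D}
    (h : ∀ ν (i : Fin U.d), U.idem χ (U.base ν * U.Q ^ (i : ℕ) : (ZMod U.N)ˣ) * b ∈ T) : b ∈ T := by
  rw [← one_mul b, ← U.sum_idem hχ, Finset.sum_mul]
  refine sum_mem fun j _ => ?_
  by_cases hj : IsUnit j
  · obtain ⟨u, rfl⟩ := hj
    obtain ⟨ν, i, rfl⟩ := U.exists_base u
    exact h ν i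
  · rw [U.idem_eq_zero hj, zero_mul]
    exact zero_mem _

/-- Cut by the idempotent of row `i`, the element has a single nonzero entry, in the column
congruent to `i + m` modulo `d`. -/
theorem inc_mem_genSpan (hχ : ∀ m, m ≠ 0 → ∑ k, χ (k * m) = 0) (a : U.unramIntegers) {m : ℕ}
    (h0 : 0 < m) (hm : m < U.d) : inc p S ((a : D) * U.ϖ ^ m) ∈ U.genSpan χ := by
  obtain ⟨V, rfl⟩ := U.ev_surjective a
  refine U.mem_of_idem_mul_mem χ hχ fun ν i => ?_
  obtain ⟨j, hij, hj⟩ := U.exists_shift_eq i h0 hm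
  have : U.idem χ (U.base ν * U.Q ^ (i : ℕ) : (ZMod U.N)ˣ) * inc p S ((U.ev V : D) * U.ϖ ^ m) =
      U.entry χ ν i j (U.specialize χ (U.base ν * U.Q ^ (i : ℕ) : (ZMod U.N)ˣ) V) := by
    have h1 : U.evτ (X ^ (if j < i then 1 else 0) : S[X]) =
        inc p S (U.τ ^ (if j < i then 1 else 0)) := by
      rw [evτ, map_pow, aeval_X, map_pow]
    rw [entry_apply _ hij, map_mul, ← mul_assoc, idem_mul_inc_ev, hj, map_mul, ← h1, mul_assoc,
      ← mul_assoc _ (U.evτ _), ← evτ_comm, unit,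
      mul_assoc (U.evτ (X ^ (if j < i then 1 else 0) : S[X])) (U.idem _ _), ← mul_assoc,
      ← map_mul, mul_comm (X ^ _)]
  rw [this]
  exact U.entry_mem_genSpan ν hij _

theorem unit_self (ν : U.Block) (i : Fin U.d) :
    U.unit χ ν i i = U.idem χ (U.base ν * U.Q ^ (i : ℕ) : (ZMod U.N)ˣ) := by
  rw [unit, sub_self, zpow_zero, map_one, mul_one]

/-- Conjugation by `ϖ ^ m` shifts the diagonal entries cyclically within each block. After
reindexing, the difference is a sum of multiples of differences of two diagonal idempotents of one
block, with coefficients divisible by `X`. -/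
theorem inc_conj_mem_genSpan (hχ : ∀ m, m ≠ 0 → ∑ k, χ (k * m) = 0) (y : U.unramIntegers)
    (m : ℕ) : inc p S (U.ϖ ^ m * (U.τ * y) * (U.ϖ ^ m)⁻¹ - U.τ * y) ∈ U.genSpan χ := by
  obtain ⟨V', rfl⟩ := U.ev_surjective y
  obtain ⟨V, hVdef⟩ : ∃ V : ℤ_[p][X][X], V = X * V' := ⟨_, rfl⟩
  have hV' : U.τ * (U.ev V' : D) = U.ev V := by rw [hVdef, map_mul, ev_X]; rfl
  have hVj : ∀ j, U.specialize χ j V = X * U.specialize χ j V' := fun j => by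
    rw [hVdef, map_mul, specialize, coe_mapRingHom, map_X]
  have h1 : ∀ j : ZMod U.N, U.idem χ j * inc p S (U.ϖ ^ m * (U.τ * U.ev V') * (U.ϖ ^ m)⁻¹) =
      U.evτ (U.specialize χ (j * (U.Q ^ m : (ZMod U.N)ˣ)) V) * U.idem χ j := by
    intro j
    have h2 : U.idem χ j = inc p S (U.ϖ ^ m) * U.idem χ (j * (U.Q ^ m : (ZMod U.N)ˣ)) *
        inc p S (U.ϖ ^ m)⁻¹ := by
      have := U.inc_mul_smul_idem χ m (j * (U.Q ^ m : (ZMod U.N)ˣ))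
      rw [zpow_natCast, zpow_neg, zpow_natCast, Units.mul_inv_cancel_right] at this
      rw [this, mul_assoc, ← map_mul, mul_inv_cancel₀ (pow_ne_zero _ U.ϖ_ne_zero), map_one,
        mul_one]
    have h3 : inc p S (U.ϖ ^ m)⁻¹ * inc p S (U.ϖ ^ m * (U.τ * U.ev V') * (U.ϖ ^ m)⁻¹) =
        inc p S (U.τ * U.ev V') * inc p S (U.ϖ ^ m)⁻¹ := by
      rw [← map_mul, mul_assoc, inv_mul_cancel_left₀ (pow_ne_zero _ U.ϖ_ne_zero), map_mul]
    nth_rewrite 1 [h2]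
    rw [mul_assoc, h3, hV', ← mul_assoc, mul_assoc (inc p S _), idem_mul_inc_ev,
      ← mul_assoc, ← evτ_comm, h2]
    simp only [mul_assoc]
  have h4 : inc p S (U.ϖ ^ m * (U.τ * U.ev V') * (U.ϖ ^ m)⁻¹ - U.τ * U.ev V') =
      ∑ j, U.evτ (U.specialize χ j V) *
        (U.idem χ (j * ((U.Q ^ m)⁻¹ : (ZMod U.N)ˣ)) - U.idem χ j) := by
    rw [← one_mul (inc p S _), ← U.sum_idem hχ, Finset.sum_mul]
    simp only [map_sub, mul_sub, h1]
    rw [Finset.sum_sub_distrib, Finset.sum_sub_distrib,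
      ← Equiv.sum_comp (Units.mulRight (U.Q ^ m)) (fun j => U.evτ (U.specialize χ j V) *
        U.idem χ (j * ((U.Q ^ m)⁻¹ : (ZMod U.N)ˣ)))]
    congr 1
    · refine Finset.sum_congr rfl fun j _ => ?_
      rw [Units.mulRight_apply, Units.mul_inv_cancel_right]
    · refine Finset.sum_congr rfl fun j _ => ?_
      rw [hV', idem_mul_inc_ev]
  rw [h4]
  refine sum_mem fun j _ => ?_
  by_cases hj : IsUnit j
  · obtain ⟨u, rfl⟩ := hj
    obtain ⟨ν, i, hu⟩ := U.exists_base u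
    obtain ⟨μ, k, hk⟩ := U.exists_base (u * (U.Q ^ m)⁻¹)
    have hμ : μ = ν := by
      rw [hu, mul_assoc, ← zpow_natCast, ← zpow_natCast, ← zpow_neg, ← zpow_add,
        ← zpow_natCast] at hk
      exact (U.base_mul_zpow_eq hk).1.symm
    subst hμ
    rw [← Units.val_mul, hk]
    nth_rewrite 2 [hu]
    rw [← unit_self, ← unit_self, hVj, ← diag_apply]
    exact U.diag_mem_genSpan _ _ _ _
  · rw [U.idem_eq_zero hj, U.idem_eq_zero, sub_zero, mul_zero]
    · exact zero_mem _
    · rwa [Units.isUnit_mul_units]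

end CyclicStructure

end NormOne

/-! ### The frame of the extended Lie algebra -/

namespace NormOne

namespace CyclicStructure

open Polynomial ScalarExt

variable {p : ℕ} [Fact p.Prime] {D : Type*} [DivisionRing D] [Algebra ℚ_[p] D]
  [FiniteDimensional ℚ_[p] D] [Algebra ℤ_[p] D] [IsScalarTower ℤ_[p] ℚ_[p] D]
  (U : CyclicStructure p D) {S : Type*} [CommRing S] [Algebra ℤ_[p] S]
  {χ : AddChar (ZMod U.N) S} {g : LieSubalgebra ℤ_[p] D}

theorem mem_genSpan (hχ : ∀ m, m ≠ 0 → ∑ k, χ (k * m) = 0)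
    (hg' : ∀ x ∈ g, ∃ a y : ℕ → U.unramIntegers,
      x = ∑ i ∈ (Finset.range U.d).erase 0, (a i : D) * U.ϖ ^ i + ∑ i ∈ Finset.range U.d,
        (U.ϖ ^ i * (U.τ * y i) * (U.ϖ ^ i)⁻¹ - U.τ * y i)) {x : ScalarExt p S D}
    (hx : x ∈ lieExt S g) : x ∈ U.genSpan χ := by
  rw [mem_lieExt] at hx
  refine (Submodule.span_le (p := U.genSpan χ)).2 ?_ hx
  rintro _ ⟨x, hx, rfl⟩
  obtain ⟨a, y, rfl⟩ := hg' x hx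
  rw [SetLike.mem_coe, map_add, map_sum, map_sum]
  refine add_mem (sum_mem fun i hi => ?_) (sum_mem fun i _ => U.inc_conj_mem_genSpan hχ _ _)
  rw [Finset.mem_erase, Finset.mem_range] at hi
  exact U.inc_mem_genSpan hχ _ (Nat.pos_of_ne_zero hi.1) hi.2

/-- Used to restrict the coordinate maps, which are given by multiplication in the whole algebra, to
the extended Lie algebra. -/
theorem map_mem_lieExt (hχ : ∀ m, m ≠ 0 → ∑ k, χ (k * m) = 0)
    (hg' : ∀ x ∈ g, ∃ a y : ℕ → U.unramIntegers,
      x = ∑ i ∈ (Finset.range U.d).erase 0, (a i : D) * U.ϖ ^ i + ∑ i ∈ Finset.range U.d,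
        (U.ϖ ^ i * (U.τ * y i) * (U.ϖ ^ i)⁻¹ - U.τ * y i))
    (f : ScalarExt p S D →ₗ[S] ScalarExt p S D)
    (he : ∀ ν i j a, i ≠ j → f (U.entry χ ν i j a) ∈ lieExt S g)
    (hh : ∀ ν i j a, i ≠ j → f (U.diag χ ν i j a) ∈ lieExt S g) (x : ScalarExt p S D)
    (hx : x ∈ (lieExt S g).toSubmodule) : f x ∈ (lieExt S g).toSubmodule := by
  have h := U.mem_genSpan hχ hg' hx
  rw [genSpan] at h
  refine (Submodule.span_le (p := (lieExt S g).toSubmodule.comap f)).2 ?_ h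
  rintro _ (⟨ν, i, j, a, hij, rfl⟩ | ⟨ν, i, j, a, hij, rfl⟩)
  · exact he ν i j a hij
  · exact hh ν i j a hij

theorem mem_span_of_coe {B : Type*} [AddCommGroup B] [Module S B] (L : Submodule S B) (T : Set L)
    (x : L) (h : (x : B) ∈ Submodule.span S (Subtype.val '' T)) : x ∈ Submodule.span S T := by
  have h' : (x : B) ∈ Submodule.span S (L.subtype '' T) := h
  rw [← Submodule.map_span] at h'
  obtain ⟨y, hy, hyx⟩ := h'
  rwa [← Subtype.ext hyx]

variable (χ)

theorem specialize_X (j : ZMod U.N) : U.specialize χ j X = X := map_X _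

theorem derivative_specialize (j : ZMod U.N) (P : ℤ_[p][X][X]) :
    derivative (U.specialize χ j P) = U.specialize χ j (derivative P) := derivative_map _ _

/-- The projection to an off-diagonal entry. -/
noncomputable def projEntry (ν : U.Block) (i j : Fin U.d) :
    ScalarExt p S D →ₗ[S] ScalarExt p S D :=
  if i = j then 0 else LinearMap.mulLeft S (U.unit χ ν i i) ∘ₗ LinearMap.mulRight S (U.unit χ ν j j)

/-- The map that moves a diagonal entry to the first column. -/
noncomputable def moveDiag (ν : U.Block) (i : Fin U.d) :
    ScalarExt p S D →ₗ[S] ScalarExt p S D :=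
  if i = 0 then 0 else LinearMap.mulLeft S (U.unit χ ν i i) ∘ₗ LinearMap.mulRight S (U.unit χ ν i 0)

variable {χ}

theorem unit_mul_evτ_mul (a : S[X]) (x y z : ScalarExt p S D) :
    x * (U.evτ a * y * z) = U.evτ a * (x * y * z) := by
  rw [← mul_assoc, ← mul_assoc, ← evτ_comm]
  simp only [mul_assoc]

section

variable (hχ : ∀ m, m ≠ 0 → ∑ k, χ (k * m) = 0)
include hχ

open Classical in
theorem projEntry_entry (ν : U.Block) (i j : Fin U.d) (μ : U.Block) (k l : Fin U.d) (a : S[X])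
    (hij : i ≠ j) (hkl : k ≠ l) : U.projEntry χ ν i j (U.entry χ μ k l a) =
      if ν = μ ∧ i = k ∧ j = l then U.entry χ μ k l a else 0 := by
  rw [projEntry, if_neg hij, entry_apply _ hkl]
  change U.unit χ ν i i * (U.evτ _ * U.unit χ μ k l * U.unit χ ν j j) = _
  rw [unit_mul_evτ_mul]
  by_cases h : ν = μ ∧ i = k ∧ j = l
  · rw [if_pos h]
    obtain ⟨rfl, rfl, rfl⟩ := h
    rw [unit_mul_unit_self _ hχ, unit_mul_unit_self _ hχ]
  · rw [if_neg h]
    by_cases h1 : ν = μ ∧ i = k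
    · obtain ⟨rfl, rfl⟩ := h1
      rw [unit_mul_unit_self _ hχ, unit_mul_unit_of_ne _ hχ fun _ h2 => h ⟨rfl, rfl, h2.symm⟩,
        mul_zero]
    · rw [unit_mul_unit_of_ne _ hχ fun h2 h3 => h1 ⟨h2, h3⟩, zero_mul, mul_zero]

theorem projEntry_diag (ν : U.Block) (i j : Fin U.d) (μ : U.Block) (k l : Fin U.d) (a : S[X]) :
    U.projEntry χ ν i j (U.diag χ μ k l a) = 0 := by
  by_cases hij : i = j
  · rw [projEntry, if_pos hij, LinearMap.zero_apply]
  rw [projEntry, if_neg hij, diag_apply]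
  change U.unit χ ν i i * (U.evτ _ * (U.unit χ μ k k - U.unit χ μ l l) * U.unit χ ν j j) = _
  have h : ∀ k, U.unit χ ν i i * U.unit χ μ k k * U.unit χ ν j j = 0 := fun k => by
    by_cases h1 : ν = μ ∧ i = k
    · obtain ⟨rfl, rfl⟩ := h1
      rw [unit_mul_unit_self _ hχ, unit_mul_unit_of_ne _ hχ fun _ => hij]
    · rw [unit_mul_unit_of_ne _ hχ fun h2 h3 => h1 ⟨h2, h3⟩, zero_mul]
  rw [unit_mul_evτ_mul, mul_sub, sub_mul, h, h, sub_zero, mul_zero]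

theorem moveDiag_entry (ν : U.Block) (i : Fin U.d) (μ : U.Block) (k l : Fin U.d) (a : S[X])
    (hkl : k ≠ l) : U.moveDiag χ ν i (U.entry χ μ k l a) = 0 := by
  by_cases hi : i = 0
  · rw [moveDiag, if_pos hi, LinearMap.zero_apply]
  rw [moveDiag, if_neg hi, entry_apply _ hkl]
  change U.unit χ ν i i * (U.evτ _ * U.unit χ μ k l * U.unit χ ν i 0) = _
  rw [unit_mul_evτ_mul]
  by_cases h1 : ν = μ ∧ i = k
  · obtain ⟨rfl, rfl⟩ := h1
    rw [unit_mul_unit_self _ hχ, unit_mul_unit_of_ne _ hχ fun _ => hkl.symm, mul_zero]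
  · rw [unit_mul_unit_of_ne _ hχ fun h2 h3 => h1 ⟨h2, h3⟩, zero_mul, mul_zero]

open Classical in
theorem moveDiag_diag (ν : U.Block) (i : Fin U.d) (μ : U.Block) (k l : Fin U.d) (a : S[X])
    (hi : i ≠ 0) : U.moveDiag χ ν i (U.diag χ μ k l a) =
      (if ν = μ then (if i = k then 1 else 0) - (if i = l then 1 else 0) else 0 : ℤ) •
        U.entry χ ν i 0 a := by
  -- As `0 < i`, the entry at `(i, 0)` has the factor `X`, which matches that of the diagonal
  -- element.
  rw [moveDiag, if_neg hi, diag_apply, entry_apply _ hi, if_pos (Fin.pos_iff_ne_zero.2 hi), pow_one]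
  change U.unit χ ν i i * (U.evτ _ * (U.unit χ μ k k - U.unit χ μ l l) * U.unit χ ν i 0) = _
  have h : ∀ k, U.unit χ ν i i * U.unit χ μ k k * U.unit χ ν i 0 =
      (if ν = μ then (if i = k then 1 else 0) else 0 : ℤ) • U.unit χ ν i 0 := fun k => by
    by_cases h1 : ν = μ
    · subst h1
      by_cases h2 : i = k
      · subst h2
        rw [unit_mul_unit_self _ hχ, unit_mul_unit_self _ hχ, if_pos rfl, if_pos rfl, one_smul]
      · rw [unit_mul_unit_of_ne _ hχ fun _ => h2, zero_mul, if_pos rfl, if_neg h2, zero_smul]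
    · rw [unit_mul_unit_of_ne _ hχ fun h2 => absurd h2 h1, zero_mul, if_neg h1, zero_smul]
  rw [unit_mul_evτ_mul, mul_sub, sub_mul, h, h, ← sub_smul, mul_smul_comm]
  congr 2
  split_ifs <;> rfl

open Classical in
/-- The coordinates on the extension of scalars of the Lie algebra. -/
noncomputable def frame
    (hg : ∀ (a : U.unramIntegers) (m : ℕ), 0 < m → m < U.d → (a : D) * U.ϖ ^ m ∈ g)
    (hg' : ∀ x ∈ g, ∃ a y : ℕ → U.unramIntegers,
      x = ∑ i ∈ (Finset.range U.d).erase 0, (a i : D) * U.ϖ ^ i + ∑ i ∈ Finset.range U.d,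
        (U.ϖ ^ i * (U.τ * y i) * (U.ϖ ^ i)⁻¹ - U.τ * y i))
    {P G c : ℤ_[p][X][X]} (hP : U.ev P = 0) {q : ℕ}
    (hG : U.ev (X * (derivative P * G)) = q) (hc : U.ev (X * c) = p) :
    Frame S (lieExt (p := p) S g) U.Block U.d p q where
  e ν i j := LinearMap.codRestrict (lieExt S g).toSubmodule (U.entry χ ν i j) (U.entry_mem hg ν i j)
  h ν i j := LinearMap.codRestrict (lieExt S g).toSubmodule (U.diag χ ν i j)
    (U.diag_mem hχ hg ν i j)
  P ν i j := (U.projEntry χ ν i j).restrict (p := (lieExt S g).toSubmodule)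
    (q := (lieExt S g).toSubmodule) (U.map_mem_lieExt hχ hg' _ (fun μ k l a hkl => by
      by_cases hij : i = j
      · rw [projEntry, if_pos hij, LinearMap.zero_apply]
        exact zero_mem _
      rw [U.projEntry_entry hχ _ _ _ _ _ _ _ hij hkl]
      split_ifs
      · exact U.entry_mem hg _ _ _ _
      · exact zero_mem _) fun μ k l a _ => by
      rw [U.projEntry_diag hχ]
      exact zero_mem _)
  κ ν i := (U.moveDiag χ ν i).restrict (p := (lieExt S g).toSubmodule)
    (q := (lieExt S g).toSubmodule) (U.map_mem_lieExt hχ hg' _ (fun μ k l a hkl => by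
      rw [U.moveDiag_entry hχ _ _ _ _ _ _ hkl]
      exact zero_mem _) fun μ k l a _ => by
      by_cases hi : i = 0
      · rw [moveDiag, if_pos hi, LinearMap.zero_apply]
        exact zero_mem _
      rw [U.moveDiag_diag hχ _ _ _ _ _ _ hi]
      exact zsmul_mem (U.entry_mem hg _ _ _ _) _)
  lie_opp ν i j a b h := Subtype.ext (U.lie_entry_opp hχ ν i j a b h)
  lie_mul ν i j k a b h1 h2 h3 := Subtype.ext (U.lie_entry_mul hχ ν i j k a b h1 h2 h3)
  lie_zero ν i j μ k l a b h1 h2 h3 := Subtype.ext (U.lie_entry_zero hχ ν i j μ k l a b h1 h2 h3)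
  lie_diag ν i j μ k l a b _ h2 := Subtype.ext (U.lie_diag_entry hχ ν i j μ k l a b h2)
  P_e ν i j μ k l a h1 h2 := Subtype.ext (by
    refine (U.projEntry_entry hχ ν i j μ k l a h1 h2).trans ?_
    split_ifs <;> rfl)
  P_h ν i j μ k l a _ _ := Subtype.ext (U.projEntry_diag hχ ν i j μ k l a)
  κ_e ν i μ k l a _ h2 := Subtype.ext (U.moveDiag_entry hχ ν i μ k l a h2)
  κ_h ν i μ k l a h1 _ := Subtype.ext (U.moveDiag_diag hχ ν i μ k l a h1)
  span x := by
    have h := U.mem_genSpan hχ hg' x.2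
    refine mem_span_of_coe (lieExt S g).toSubmodule _ x (Submodule.span_mono ?_ h)
    rintro _ (⟨ν, i, j, a, hij, rfl⟩ | ⟨ν, i, j, a, hij, rfl⟩)
    · exact ⟨⟨_, U.entry_mem hg ν i j a⟩, Or.inl ⟨ν, i, j, a, hij, rfl⟩, rfl⟩
    · exact ⟨⟨_, U.diag_mem hχ hg ν i j a⟩, Or.inr ⟨ν, i, j, a, hij, rfl⟩, rfl⟩
  pol ν := U.specialize χ (U.base ν : ZMod U.N) P
  quo ν := U.specialize χ (U.base ν : ZMod U.N) c
  inv ν := U.specialize χ (U.base ν : ZMod U.N) G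
  e_pol ν i j a _ := Subtype.ext (U.entry_mul_eq_zero ν i j hP a)
  e_quo ν i j a _ := Subtype.ext (by
    have h := U.entry_mul_eq_smul (χ := χ) ν i j hc a
    rw [(U.specialize χ _).map_mul, mul_assoc, specialize_X] at h
    exact h)
  e_inv ν i j a _ := Subtype.ext (by
    have h := U.entry_mul_eq_smul (χ := χ) ν i j hG a
    rw [(U.specialize χ _).map_mul, (U.specialize χ _).map_mul, mul_assoc, specialize_X,
      ← derivative_specialize] at h
    exact h)

end

end CyclicStructure

end NormOne

namespace NormOne

/-! ### Descent from S to ℤ_p -/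

section Descent

open ScalarExt

variable {p : ℕ} [Fact p.Prime] {D : Type*} [Ring D] [Algebra ℤ_[p] D]
  {S : Type*} [CommRing S] [Algebra ℤ_[p] S] {g : LieSubalgebra ℤ_[p] D}

variable (S) in
/-- The inclusion of a Lie algebra in its extension of scalars. -/
noncomputable def incLie (x : g) : lieExt (p := p) S g :=
  ⟨inc p S (x : D), mem_lieExt.2 (Submodule.subset_span ⟨x, x.2, rfl⟩)⟩

theorem incLie_add (x y : g) : incLie S (x + y) = incLie S x + incLie S y :=
  Subtype.ext (map_add (inc p S) (x : D) y)

theorem incLie_smul (a : ℤ_[p]) (x : g) : incLie S (a • x) = algebraMap ℤ_[p] S a • incLie S x :=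
  Subtype.ext (inc_smul p S a (x : D))

theorem incLie_lie (x y : g) : incLie S ⁅x, y⁆ = ⁅incLie S x, incLie S y⁆ := by
  apply Subtype.ext
  change inc p S ⁅(x : D), (y : D)⁆ = ⁅inc p S (x : D), inc p S (y : D)⁆
  rw [Ring.lie_def, Ring.lie_def, map_sub, map_mul, map_mul]

theorem lieExt_induction {P : lieExt (p := p) S g → Prop} (x : lieExt (p := p) S g) (h0 : P 0)
    (h1 : ∀ x : g, P (incLie S x)) (h2 : ∀ x y, P x → P y → P (x + y))
    (h3 : ∀ (s : S) x, P x → P (s • x)) : P x := by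
  obtain ⟨x, hx⟩ := x
  have hx' : x ∈ Submodule.span S (inc p S '' (g : Set D)) := hx
  induction hx' using Submodule.span_induction with
  | zero => exact h0
  | add a b ha hb iha ihb => exact h2 ⟨a, ha⟩ ⟨b, hb⟩ (iha ha) (ihb hb)
  | smul s a ha iha => exact h3 s ⟨a, ha⟩ (iha ha)
  | mem a ha =>
    obtain ⟨b, hb, rfl⟩ := ha
    exact h1 ⟨b, hb⟩

/-- Bilinear maps extend along an extension of scalars. -/
theorem exists_bilin_ext [Module.Flat ℤ_[p] S] {M : Type*} [AddCommGroup M] [Module ℤ_[p] M]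
    (f : g →ₗ[ℤ_[p]] g →ₗ[ℤ_[p]] M) :
    ∃ F : lieExt (p := p) S g →ₗ[S] lieExt (p := p) S g →ₗ[S] (S ⊗[ℤ_[p]] M),
      ∀ x y, F (incLie S x) (incLie S y) = 1 ⊗ₜ f x y := by
  let i : S ⊗[ℤ_[p]] g →ₗ[S] S ⊗[ℤ_[p]] D := g.toSubmodule.subtype.baseChange S
  -- Flatness identifies `S ⊗ g` with the span of `g` in `S ⊗ D`, so the base change of `f` is
  -- defined on that span.
  have hi : Function.Injective i :=
    Module.Flat.lTensor_preserves_injective_linearMap (M := S) g.toSubmodule.subtype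
      (Submodule.injective_subtype _)
  have hr : LinearMap.range i = (lieExt (p := p) S g).toSubmodule := by
    exact Submodule.baseChange_eq_span S g.toSubmodule
  let E : S ⊗[ℤ_[p]] g ≃ₗ[S] lieExt (p := p) S g :=
    (LinearEquiv.ofInjective i hi).trans (LinearEquiv.ofEq _ _ hr)
  have hE : ∀ x, E.symm (incLie S x) = 1 ⊗ₜ x := fun x => by
    rw [LinearEquiv.symm_apply_eq]
    rfl
  refine ⟨(LinearMap.BilinMap.baseChange S f).compl₁₂ E.symm.toLinearMap E.symm.toLinearMap,
    fun x y => ?_⟩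
  rw [LinearMap.compl₁₂_apply]
  change LinearMap.BilinMap.baseChange S f (E.symm (incLie S x)) (E.symm (incLie S y)) = _
  rw [hE, hE, LinearMap.BilinMap.baseChange_tmul, mul_one]

/-- The cocycle extends to `S`, is trivialized there by the frame, and the trivialization is brought
back by `ρ`, which fixes the values `1 ⊗ m`. -/
theorem exists_functional_of_frame [Module.Flat ℤ_[p] S] {M : Type*} [AddCommGroup M]
    [Module ℤ_[p] M] (f : g →ₗ[ℤ_[p]] g →ₗ[ℤ_[p]] M) (hs : ∀ x y, f x y = - f y x)
    (hJ : ∀ x y z, f ⁅x, y⁆ z + f ⁅y, z⁆ x + f ⁅z, x⁆ y = 0)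
    {I : Type*} [Fintype I] [DecidableEq I] {d : ℕ} [NeZero d] {q Q' : ℕ}
    (Φ : Frame S (lieExt (p := p) S g) I d q (q * Q')) (h2 : IsUnit (2 : S)) (v : S)
    (hv : 12 * v = q) (ρ : S →ₗ[ℤ_[p]] ℤ_[p]) (hρ : ρ 1 = 1) :
    ∃ u : g →ₗ[ℤ_[p]] M, ∀ x y, (q * (q * Q')) • f x y = u ⁅x, y⁆ := by
  obtain ⟨F, hF⟩ := exists_bilin_ext (S := S) f
  have hFs : ∀ x y, F x y = - F y x := fun x y => by
    induction x using lieExt_induction with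
    | h0 => simp
    | h2 a b ha hb => rw [map_add, LinearMap.add_apply, ha, hb, map_add, neg_add]
    | h3 s a ha => rw [map_smul, LinearMap.smul_apply, ha, map_smul, smul_neg]
    | h1 x =>
      induction y using lieExt_induction with
      | h0 => simp
      | h2 a b ha hb => rw [map_add, map_add, LinearMap.add_apply, ha, hb, neg_add]
      | h3 s a ha => rw [map_smul, map_smul, LinearMap.smul_apply, ha, smul_neg]
      | h1 y => rw [hF, hF, hs, TensorProduct.tmul_neg]
  have hFJ : ∀ x y z, F ⁅x, y⁆ z + F ⁅y, z⁆ x + F ⁅z, x⁆ y = 0 := fun x y z => by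
    induction x using lieExt_induction with
    | h0 => simp
    | h2 a b ha hb =>
      have := congrArg₂ (· + ·) ha hb
      simp only [add_zero] at this
      rw [← this, add_lie, lie_add, map_add, map_add, map_add, LinearMap.add_apply,
        LinearMap.add_apply]
      abel
    | h3 s a ha =>
      rw [smul_lie, lie_smul, map_smul, map_smul, map_smul, LinearMap.smul_apply,
        LinearMap.smul_apply, ← smul_add, ← smul_add, ha, smul_zero]
    | h1 x =>
      induction y using lieExt_induction with
      | h0 => simp
      | h2 a b ha hb =>
        have := congrArg₂ (· + ·) ha hb
        simp only [add_zero] at this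
        rw [← this, add_lie, lie_add, map_add, map_add, map_add, LinearMap.add_apply,
          LinearMap.add_apply]
        abel
      | h3 s a ha =>
        rw [smul_lie, lie_smul, map_smul, map_smul, map_smul, LinearMap.smul_apply,
          LinearMap.smul_apply, ← smul_add, ← smul_add, ha, smul_zero]
      | h1 y =>
        induction z using lieExt_induction with
        | h0 => simp
        | h2 a b ha hb =>
          have := congrArg₂ (· + ·) ha hb
          simp only [add_zero] at this
          rw [← this, add_lie, lie_add, map_add, map_add, map_add, LinearMap.add_apply,
            LinearMap.add_apply]
          abel
        | h3 s a ha =>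
          rw [smul_lie, lie_smul, map_smul, map_smul, map_smul, LinearMap.smul_apply,
            LinearMap.smul_apply, ← smul_add, ← smul_add, ha, smul_zero]
        | h1 z =>
          rw [← incLie_lie, ← incLie_lie, ← incLie_lie, hF, hF, hF, ← TensorProduct.tmul_add,
            ← TensorProduct.tmul_add, hJ, TensorProduct.tmul_zero]
  obtain ⟨u, hu⟩ := Frame.exists_functional hFs hFJ Φ h2 v hv Q' rfl
  let r : S ⊗[ℤ_[p]] M →ₗ[ℤ_[p]] M :=
    (TensorProduct.lid ℤ_[p] M).toLinearMap ∘ₗ LinearMap.rTensor M ρ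
  have hr : ∀ m, r (1 ⊗ₜ m) = m := fun m => by
    change TensorProduct.lid ℤ_[p] M (ρ 1 ⊗ₜ m) = m
    rw [hρ, TensorProduct.lid_tmul, one_smul]
  refine ⟨{ toFun := fun x => r (u (incLie S x))
            map_add' := fun x y => by rw [incLie_add, map_add, map_add]
            map_smul' := fun a x => by
              rw [incLie_smul, map_smul, algebraMap_smul, map_smul, RingHom.id_apply] },
    fun x y => ?_⟩
  change _ = r (u (incLie S ⁅x, y⁆))
  rw [incLie_lie, ← hu, hF, Nat.cast_smul_eq_nsmul, map_nsmul, hr]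

end Descent

/-! ### The coefficient ring and the constant 12 -/

namespace CyclicStructure

variable {p : ℕ} [Fact p.Prime] {D : Type*} [DivisionRing D] [Algebra ℚ_[p] D]
  [FiniteDimensional ℚ_[p] D] [Algebra ℤ_[p] D] [IsScalarTower ℤ_[p] ℚ_[p] D]
  (U : CyclicStructure p D)

/-- The roots of unity, as a character with values in the integral elements. -/
noncomputable def ψChar : AddChar (ZMod U.N) U.unramIntegers where
  toFun := U.ψC
  map_zero_eq_one' := Subtype.ext U.ψ.map_zero_eq_one
  map_add_eq_mul' a b := Subtype.ext (U.ψ.map_add_eq_mul a b)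

theorem sum_ψChar (m : ZMod U.N) (hm : m ≠ 0) : ∑ k, U.ψChar (k * m) = 0 := by
  apply Subtype.ext
  rw [AddSubmonoidClass.coe_finsetSum]
  have := U.sum_ψ m
  rw [if_neg hm] at this
  exact this

instance : Module.IsTorsionFree ℤ_[p] U.unramIntegers :=
  Module.IsTorsionFree.of_smul_eq_zero fun a x h => by
    have h1 : absD p (a • (x : D)) = 0 := by
      rw [show a • (x : D) = 0 from congrArg Subtype.val h, absD_zero]
    rw [Algebra.smul_def, absD_mul, absD_algebraMap_int, mul_eq_zero, norm_eq_zero,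
      absD_eq_zero_iff] at h1
    exact h1.imp_right fun h2 => Subtype.ext h2

instance : Module.Free ℤ_[p] U.unramIntegers := inferInstance

/-- The element 1 is not divisible by `p`, so one of its coordinates in a basis is a unit; that
coordinate, rescaled, is the retraction. -/
theorem exists_retraction : ∃ ρ : U.unramIntegers →ₗ[ℤ_[p]] ℤ_[p], ρ 1 = 1 := by
  let b := Module.Free.chooseBasis ℤ_[p] U.unramIntegers
  obtain ⟨i, hi⟩ : ∃ i, IsUnit (b.repr 1 i) := by
    by_contra! h
    have h1 : ∀ i, ∃ c : ℤ_[p], b.repr 1 i = p * c := fun i => by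
      have := (IsLocalRing.mem_maximalIdeal _).2 (h i)
      rw [PadicInt.maximalIdeal_eq_span_p, Ideal.mem_span_singleton] at this
      exact this
    choose c hc using h1
    have h2 : (1 : U.unramIntegers) = (p : ℤ_[p]) • ∑ i, c i • b i := by
      rw [Finset.smul_sum]
      conv_lhs => rw [← b.sum_repr 1]
      exact Finset.sum_congr rfl fun i _ => by rw [hc, mul_smul]
    have h3 := congrArg (fun z : U.unramIntegers => absD p (z : D)) h2
    rw [Algebra.smul_def] at h3
    change absD p (1 : D) = absD p (algebraMap ℤ_[p] D p * _) at h3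
    rw [absD_one, absD_mul, absD_algebraMap_int] at h3
    refine absurd h3 (ne_of_gt ?_)
    exact mul_lt_one_of_nonneg_of_lt_one_left (norm_nonneg _) (by
      rw [PadicInt.norm_p]
      exact inv_lt_one_of_one_lt₀ (by exact_mod_cast (Fact.out : p.Prime).one_lt))
      (Subtype.prop (∑ i, c i • b i)).2
  refine ⟨(↑(hi.unit⁻¹) : ℤ_[p]) • b.coord i, ?_⟩
  rw [LinearMap.smul_apply, Module.Basis.coord_apply, smul_eq_mul]
  exact hi.val_inv_mul

end CyclicStructure

theorem isUnit_natCast_padicInt {p : ℕ} [Fact p.Prime] {n : ℕ} (h : p.Coprime n) :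
    IsUnit (n : ℤ_[p]) := by
  rw [PadicInt.isUnit_iff]
  have := Padic.norm_natCast_eq_one_iff.2 h
  exact_mod_cast this

/-- The number 4 is a unit because `p` is odd; the factor 3 is a unit or equals `p`. -/
theorem exists_twelve_mul_eq {p : ℕ} [Fact p.Prime] (hp : 3 ≤ p) : ∃ v : ℤ_[p], 12 * v = p := by
  have hp' : p.Prime := Fact.out
  have h2 : p.Coprime 2 := (Nat.coprime_primes hp' Nat.prime_two).2 (by omega)
  have h4 : p.Coprime 4 := Nat.Coprime.pow_right 2 h2
  obtain ⟨a, ha⟩ := (isUnit_natCast_padicInt h4).exists_right_inv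
  rcases hp.eq_or_lt with rfl | hlt
  · refine ⟨a, ?_⟩
    have : (12 : ℤ_[3]) = 3 * (4 : ℕ) := by norm_num
    rw [this, mul_assoc, ha]
    norm_num
  · have h3 : p.Coprime 3 := (Nat.coprime_primes hp' Nat.prime_three).2 (by omega)
    obtain ⟨b, hb⟩ := (isUnit_natCast_padicInt h3).exists_right_inv
    refine ⟨a * b * p, ?_⟩
    have : (12 : ℤ_[p]) * (a * b * p) = ((4 : ℕ) * a) * ((3 : ℕ) * b) * p := by push_cast; ring
    rw [this, ha, hb, one_mul, one_mul]

/-! ### The bound on the exponent -/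

section Main

open CyclicStructure

variable {p : ℕ} [Fact p.Prime] {F : Type*} [Field F] [Algebra ℚ_[p] F] [FiniteDimensional ℚ_[p] F]
  [Algebra ℤ_[p] F] [IsScalarTower ℤ_[p] ℚ_[p] F]
  {D : Type*} [DivisionRing D] [Algebra F D] [Algebra.IsCentral F D] [FiniteDimensional F D]
  [Algebra ℚ_[p] D] [IsScalarTower ℚ_[p] F D] [FiniteDimensional ℚ_[p] D]
  [Algebra ℤ_[p] D] [IsScalarTower ℤ_[p] ℚ_[p] D]

/-- Cocycles on the Lie algebra of integral elements of positive valuation are coboundaries up to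
a bounded power of `p`. -/
theorem exists_functional_sl1 (U : CyclicStructure p D) (hp : 3 ≤ p) {π : integers p D}
    (hπ : absD p U.ϖ = absD p (π : D)) {e w : ℕ} (he : absD p (p : D) = absD p U.τ ^ e)
    (hw : p ^ w ∣ e) (hw' : ¬ p ^ (w + 1) ∣ e) {M : Type*} [AddCommGroup M] [Module ℤ_[p] M]
    (f : sl1 p F π 1 →ₗ[ℤ_[p]] sl1 p F π 1 →ₗ[ℤ_[p]] M) (hs : ∀ x y, f x y = - f y x)
    (hJ : ∀ x y z, f ⁅x, y⁆ z + f ⁅y, z⁆ x + f ⁅z, x⁆ y = 0) :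
    ∃ u : sl1 p F π 1 →ₗ[ℤ_[p]] M, ∀ x y, p ^ (w + 2) • f x y = u ⁅x, y⁆ := by
  classical
  have he0 : 0 < e := Nat.pos_of_ne_zero fun h => hw' (h ▸ dvd_zero _)
  obtain ⟨P, G, hP, hG⟩ := exists_eisenstein he he0 hw hw'
  obtain ⟨c, hc⟩ := exists_quotient he he0
  obtain ⟨ρ, hρ⟩ := U.exists_retraction
  obtain ⟨v, hv⟩ := exists_twelve_mul_eq (p := p) hp
  have h2 : IsUnit (2 : U.unramIntegers) := by
    have h := (isUnit_natCast_padicInt ((Nat.coprime_primes (Fact.out : p.Prime)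
      Nat.prime_two).2 (by omega))).map (algebraMap ℤ_[p] U.unramIntegers)
    rwa [map_natCast, Nat.cast_ofNat] at h
  have hg : ∀ (a : U.unramIntegers) (m : ℕ), 0 < m → m < U.d → (a : D) * U.ϖ ^ m ∈ sl1 p F π 1 := by
    intro a m h0 hm
    rw [U.mem_sl1_iff hπ.symm, pow_one]
    refine ⟨?_, U.reducedTrace_mul_ϖ_pow a.2.1 (Nat.not_dvd_of_pos_of_lt h0 hm)⟩
    rw [absD_mul, absD_pow]
    exact (mul_le_of_le_one_left (pow_nonneg (absD_nonneg p _) _) a.2.2).trans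
      (pow_le_of_le_one (absD_nonneg p _) U.absD_ϖ_lt.le h0.ne')
  have hg' : ∀ x ∈ sl1 p F π 1, ∃ a y : ℕ → U.unramIntegers,
      x = ∑ i ∈ (Finset.range U.d).erase 0, (a i : D) * U.ϖ ^ i + ∑ i ∈ Finset.range U.d,
        (U.ϖ ^ i * (U.τ * y i) * (U.ϖ ^ i)⁻¹ - U.τ * y i) := by
    intro x hx
    rw [U.mem_sl1_iff hπ.symm, pow_one] at hx
    exact U.exists_decomposition hx.1 hx.2
  -- The constant `p ^ (w + 1)` is written as `p * p ^ w` because the frame needs `Q` as a multiple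
  -- of `q = p`.
  have hG' : U.ev (Polynomial.X * (Polynomial.derivative P * G)) = ((p * p ^ w : ℕ) :
      U.unramIntegers) := by
    rw [hG, ← pow_succ', Nat.cast_pow]
  obtain ⟨u, hu⟩ := exists_functional_of_frame f hs hJ (U.frame U.sum_ψChar hg hg' hP hG' hc) h2
    (algebraMap ℤ_[p] U.unramIntegers v) (by
      have := congrArg (algebraMap ℤ_[p] U.unramIntegers) hv
      rwa [map_mul, map_natCast, map_ofNat] at this) ρ hρ
  refine ⟨u, fun x y => ?_⟩
  rw [← hu, ← pow_succ', ← pow_succ']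

/-- Transport along multiplication by `p`, which costs the factor `p ^ 2`: one `p` makes the
transported form a cocycle, the other compares the brackets of the two lattices. -/
theorem smul_mem_B2 (U : CyclicStructure p D) (hp : 3 ≤ p) {π : integers p D}
    (hπ : absD p U.ϖ = absD p (π : D)) {e w n : ℕ} (he : absD p (p : D) = absD p U.τ ^ e)
    (hw : p ^ w ∣ e) (hw' : ¬ p ^ (w + 1) ∣ e) (hn : n = U.d * e + 1)
    {M : Type*} [AddCommGroup M] [Module ℤ_[p] M] (f : Z2 ℤ_[p] (sl1 p F π n) M) :
    p ^ (w + 4) • f.1 ∈ B2 ℤ_[p] (sl1 p F π n) M := by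
  obtain ⟨f, hf, hJ⟩ := f
  obtain ⟨g, hg⟩ := U.exists_prime_smul (F := F) he hπ.symm hn
  have hlie : ∀ x y, ⁅g x, g y⁆ = p • g ⁅x, y⁆ := fun x y => by
    apply Subtype.ext
    have h1 : ((p • g ⁅x, y⁆ : sl1 p F π n) : D) = p • (g ⁅x, y⁆ : D) := rfl
    rw [h1, hg, LieSubalgebra.coe_bracket, LieSubalgebra.coe_bracket, hg, hg, Ring.lie_def, Ring.lie_def,
      smul_mul_smul_comm, smul_mul_smul_comm, ← smul_sub, mul_smul, Nat.cast_smul_eq_nsmul, Nat.cast_smul_eq_nsmul]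
  -- Without the factor `p` the bracket of `𝔤_1` would not match: `[g x, g y] = p g [x, y]`, so
  -- `φ([x, y], z) = f([g x, g y], g z)`.
  let φ : sl1 p F π 1 →ₗ[ℤ_[p]] sl1 p F π 1 →ₗ[ℤ_[p]] M :=
    p • f.compl₁₂ g.toLinearMap g.toLinearMap
  have hφ : ∀ x y, φ x y = p • f (g x) (g y) := fun x y => rfl
  have hskew : ∀ x y, f x y = - f y x := fun x y => by
    have h := hf (x + y)
    simp only [map_add, LinearMap.add_apply, hf, zero_add, add_zero] at h
    exact eq_neg_of_add_eq_zero_right h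
  obtain ⟨u, hu⟩ := exists_functional_sl1 U hp hπ he hw hw' φ
    (fun x y => by rw [hφ, hφ, hskew, smul_neg]) fun x y z => by
      have hφ' : ∀ x y z, φ ⁅x, y⁆ z = f ⁅g x, g y⁆ (g z) := fun x y z => by
        rw [hφ, hlie, map_nsmul, LinearMap.smul_apply]
      rw [hφ', hφ', hφ', hJ]
  refine ⟨u ∘ₗ g.symm.toLinearMap, fun x y => ?_⟩
  obtain ⟨x, rfl⟩ := g.surjective x
  obtain ⟨y, rfl⟩ := g.surjective y
  change p ^ (w + 4) • f (g x) (g y) = u (g.symm ⁅g x, g y⁆)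
  rw [hlie, map_nsmul, g.symm_apply_apply, map_nsmul, ← hu, hφ, smul_smul, smul_smul]
  congr 1
  ring

end Main

end NormOne

theorem theorem6p1 (p : ℕ) [Fact p.Prime]
    -- `F` is a `p`-adic field
    (F : Type*) [Field F] [Algebra ℚ_[p] F] [FiniteDimensional ℚ_[p] F]
    [Algebra ℤ_[p] F] [IsScalarTower ℤ_[p] ℚ_[p] F]
    -- `D` is a finite-dimensional central division algebra over `F`
    (D : Type*) [DivisionRing D] [Algebra F D] [Algebra.IsCentral F D] [FiniteDimensional F D]
    [Algebra ℚ_[p] D] [IsScalarTower ℚ_[p] F D] [FiniteDimensional ℚ_[p] D]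
    [Algebra ℤ_[p] D] [IsScalarTower ℤ_[p] ℚ_[p] D]
    (hp : 3 ≤ p)
    (hpd : (p, NormOne.degree F D,
      Nat.card (IsLocalRing.ResidueField (NormOne.integers p F))) ≠ (3, 2, 3))
    -- `π` is a uniformizer of `D`
    (π : NormOne.integers p D) (hπ : NormOne.IsUniformizer π)
    -- `e` is the ramification index of `F`
    (e : ℕ) (he : Ideal.span {(p : NormOne.integers p F)} =
      IsLocalRing.maximalIdeal (NormOne.integers p F) ^ e)
    -- `p ^ w` is the largest power of `p` dividing `e`
    (w : ℕ) (hw : p ^ w ∣ e) (hw_max : ¬ p ^ (w + 1) ∣ e)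
    (n : ℕ) (hn : n = NormOne.degree F D * e + 1) (s : ℕ) :
    AddMonoid.ExponentExists (NormOne.equivariantClasses p F π n s) ∧
      AddMonoid.exponent (NormOne.equivariantClasses p F π n s) ≤ p ^ (w + 4) := by
  -- Annihilation by one positive integer gives both claims; the existence claim excludes the
  -- convention that an infinite exponent is 0.
  suffices h : ∀ c : NormOne.equivariantClasses p F π n s, p ^ (w + 4) • c = 0 by
    have hpos : 0 < p ^ (w + 4) := pow_pos (Fact.out : p.Prime).pos _
    exact ⟨⟨_, hpos, h⟩, AddMonoid.exponent_min' _ hpos h⟩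
  obtain ⟨U, hU⟩ := NormOne.exists_cyclicStructure p π hπ
  rintro ⟨c, z, rfl, -⟩
  refine Subtype.ext ?_
  change p ^ (w + 4) • (QuotientAddGroup.mk z : NormOne.H2 ℤ_[p] (NormOne.sl1 p F π n) _) = 0
  rw [← QuotientAddGroup.mk_nsmul, QuotientAddGroup.eq_zero_iff, AddSubgroup.mem_addSubgroupOf]
  rw [NormOne.CyclicStructure.degree_eq F U] at hn
  exact NormOne.smul_mem_B2 U hp hU (U.absD_natCast_eq_pow he) hw hw_max hn z
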